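/- Let $N\ge 2$, let $F_N$ be the free group of rank $N$ and $\partial F_N$ its boundary, and let $\mathfrak C_N$ be the space of closed subsets of $\partial F_N$ with at least two points, with the topology of the Hausdorff distance of a visual metric on $\partial F_N$. A subset current on $F_N$ is a (positive) Borel measure on $\mathfrak C_N$ that is finite on compact sets and invariant under the translation action of $F_N$. Let $\Gamma$ be a finite connected graph without vertices of degree one (loops and multiple edges allowed), let $\alpha:F_N\to\pi_1(\Gamma,p)$ be an isomorphism, and let $X=\widetilde\Gamma$ be the universal cover, so that $\alpha$ induces an identification of $\partial F_N$ with $\partial X$. For an oriented edge $e$ of $X$ let $Cyl_X(e)\subseteq\partial F_N$ be the set of all $\xi$ such that the geodesic in $X$ from the origin of $e$ to $\xi$ starts with $e$. For a non-degenerate finite subtree $K\subseteq X$ with terminal edges $e_1,\dots,e_n$ (oriented edges of $K$ whose terminal vertex has degree one in $K$), let $\mathcal SCyl_\alpha(K)$ be the set of all $S\in\mathfrak C_N$ with $S\subseteq\bigcup_i Cyl_X(e_i)$ and $S\cap Cyl_X(e_i)\ne\emptyset$ for all $i$, and write $\langle K,\mu\rangle_\alpha=\mu(\mathcal SCyl_\alpha(K))$.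 A $\Gamma$-graph is a graph $\Delta$ with a graph morphism $\tau:\Delta\to\Gamma$ (for example, a subgraph of $X$); a nonempty finite $\Gamma$-graph is cyclically reduced if $\tau$ is locally injective and every vertex of $\Delta$ has degree at least $2$ ($\Delta$ need not be connected). For such $\Delta$, an occurrence of $K$ in $\Delta$ is a graph morphism $f:K\to\Delta$ over $\Gamma$ such that, for each vertex $x$ of degree at least $2$ in $K$, the labels in $\Gamma$ of the edges of $K$ issuing from $x$ are exactly the labels of the edges of $\Delta$ issuing from $f(x)$; let $\langle K;\Delta\rangle$ be the number of occurrences. Denote by $\mu_\Delta$ the unique subset current with $\langle K,\mu_\Delta\rangle_\alpha=\langle K;\Delta\rangle$ for all non-degenerate finite subtrees $K\subseteq X$. For a nontrivial finitely generated subgroup $H\le F_N$ with commensurator $C$ in $F_N$, let $\eta_H=[C:H]\sum_{C_1}\delta_{\Lambda(C_1)}$ be its counting current, where $C_1$ runs over the conjugates of $C$ in $F_N$ and $\Lambda(C_1)\subseteq\partial F_N$ is the limit set of $C_1$. **Theorem.** Let $\mu$ be a nonzero subset current on $F_N$ such that $\langle K,\mu\rangle_\alpha\in\mathbb Z$ for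 every non-degenerate finite subtree $K$ of $X$. Then there is a finite cyclically reduced (possibly disconnected) $\Gamma$-graph $\Delta$ such that $\mu=\mu_\Delta$. Moreover, there are $k\ge 1$ and nontrivial finitely generated subgroups $H_1,\dots,H_k\le F_N$ such that $\mu=\eta_{H_1}+\dots+\eta_{H_k}$. -/

import Mathlib

open MeasureTheory TopologicalSpace
open scoped ENNReal

universe u

namespace SubsetCurrents

/-! ### Graphs, edge-paths, fundamental group, universal cover -/

/-- A graph in the sense of Serre: `E` is the set of oriented edges, `o e` is the initial vertex
of `e`, and `inv e` is the inverse edge of `e`.  Loops and multiple edges are allowed. -/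
structure SerreGraph where
  V : Type u
  E : Type u
  o : E → V
  inv : E → E
  inv_inv : ∀ e, inv (inv e) = e
  inv_ne : ∀ e, inv e ≠ e

namespace SerreGraph

variable (G : SerreGraph.{u})

/-- The terminal vertex of an oriented edge. -/
def t (e : G.E) : G.V := G.o (G.inv e)

/-- The degree of a vertex: the number of oriented edges starting at it. -/
noncomputable def degree (x : G.V) : ℕ := Nat.card {e : G.E // G.o e = x}

/-- `G.IsPath u l v`: the list of oriented edges `l` is an edge-path from `u` to `v`. -/
def IsPath : G.V → List G.E → G.V → Prop
  | u, [], v => u = v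
  | u, e :: l, v => G.o e = u ∧ IsPath (G.t e) l v

/-- An edge-path is reduced if it has no backtracking. -/
def IsReduced (l : List G.E) : Prop := l.IsChain (fun e e' => e' ≠ G.inv e)

def Connected : Prop := Nonempty G.V ∧ ∀ u v : G.V, ∃ l : List G.E, G.IsPath u l v

variable {G}

theorem IsPath.append : ∀ {l₁ l₂ : List G.E} {a b c : G.V},
    G.IsPath a l₁ b → G.IsPath b l₂ c → G.IsPath a (l₁ ++ l₂) c
  | [], _, _, _, _, h₁, h₂ => by
      have h : _ = _ := h₁
      subst h; exact h₂
  | _ :: _, _, _, _, _, h₁, h₂ => ⟨h₁.1, IsPath.append h₁.2 h₂⟩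

theorem IsPath.reverse : ∀ {l : List G.E} {a b : G.V},
    G.IsPath a l b → G.IsPath b (l.reverse.map G.inv) a
  | [], _, _, h => Eq.symm h
  | e :: l, a, b, h => by
      rw [List.reverse_cons, List.map_append]
      refine IsPath.append (IsPath.reverse h.2) ⟨rfl, ?_⟩
      change G.t (G.inv e) = a
      rw [t, G.inv_inv]; exact h.1

variable (G)

/-- Edge-paths from `a` to `b`. -/
def Path (a b : G.V) : Type u := {l : List G.E // G.IsPath a l b}

variable {G}

/-- Elementary reduction of edge-paths: deletion of a subpath `e, e⁻¹`. -/
def Path.Step {a b : G.V} (c d : G.Path a b) : Prop :=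
  ∃ (l₁ : List G.E) (e : G.E) (l₂ : List G.E), c.1 = l₁ ++ e :: G.inv e :: l₂ ∧ d.1 = l₁ ++ l₂

variable (G)

/-- Homotopy classes (with fixed endpoints) of edge-paths from `a` to `b`: the quotient by the
equivalence relation generated by elementary reductions. -/
def HClass (a b : G.V) : Type u := Quot (Path.Step (G := G) (a := a) (b := b))

variable {G}

/-- Homotopy class of the concatenation of a path from `a` to `b` and a path from `b` to `c`. -/
def HClass.comp {a b c : G.V} : G.HClass a b → G.HClass b c → G.HClass a c :=
  Quot.map₂ (fun p q => ⟨p.1 ++ q.1, p.2.append q.2⟩)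
    (by
      rintro p q q' ⟨l₁, e, l₂, h, h'⟩
      exact ⟨p.1 ++ l₁, e, l₂, by simp [h], by simp [h']⟩)
    (by
      rintro p p' q ⟨l₁, e, l₂, h, h'⟩
      exact ⟨l₁, e, l₂ ++ q.1, by simp [h], by simp [h']⟩)

def HClass.nil (a : G.V) : G.HClass a a := Quot.mk _ ⟨[], rfl⟩

/-- The homotopy class of a single edge. -/
def HClass.edge (e : G.E) : G.HClass (G.o e) (G.t e) := Quot.mk _ ⟨[e], rfl, rfl⟩

/-- The homotopy class of the path traversed backwards. -/
def HClass.symm {a b : G.V} : G.HClass a b → G.HClass b a :=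
  Quot.map (fun p => ⟨p.1.reverse.map G.inv, p.2.reverse⟩)
    (by
      rintro p p' ⟨l₁, e, l₂, h, h'⟩
      exact ⟨l₂.reverse.map G.inv, e, l₁.reverse.map G.inv,
        by simp [h, G.inv_inv], by simp [h']⟩)

theorem HClass.comp_assoc {a b c d : G.V} (x : G.HClass a b) (y : G.HClass b c)
    (z : G.HClass c d) : (x.comp y).comp z = x.comp (y.comp z) := by
  induction x using Quot.ind
  induction y using Quot.ind
  induction z using Quot.ind
  exact congrArg (Quot.mk _) (Subtype.ext (List.append_assoc _ _ _))

theorem HClass.nil_comp {a b : G.V} (x : G.HClass a b) : (HClass.nil a).comp x = x := by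
  induction x using Quot.ind
  rfl

theorem HClass.comp_nil {a b : G.V} (x : G.HClass a b) : x.comp (HClass.nil b) = x := by
  induction x using Quot.ind
  exact congrArg (Quot.mk _) (Subtype.ext (List.append_nil _))

theorem HClass.symm_comp_aux : ∀ (l : List G.E) (a b : G.V) (h : G.IsPath a l b),
    (Quot.mk _ ⟨l.reverse.map G.inv ++ l, h.reverse.append h⟩ : G.HClass b b) = HClass.nil b
  | [], _, _, _ => rfl
  | e :: l, a, b, h => by
      rw [← HClass.symm_comp_aux l _ b h.2]
      exact Quot.sound ⟨l.reverse.map G.inv, G.inv e, l, by simp [G.inv_inv], rfl⟩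

theorem HClass.symm_comp {a b : G.V} (x : G.HClass a b) : x.symm.comp x = HClass.nil b := by
  induction x using Quot.ind with
  | mk p => exact HClass.symm_comp_aux p.1 a b p.2

variable (G)

/-- The fundamental group of `G` based at `p`: homotopy classes of closed edge-paths at `p`. -/
def Pi1 (p : G.V) : Type u := G.HClass p p

instance (p : G.V) : Group (G.Pi1 p) where
  mul x y := HClass.comp x y
  one := HClass.nil p
  inv x := HClass.symm x
  mul_assoc x y z := HClass.comp_assoc x y z
  one_mul x := HClass.nil_comp x
  mul_one x := HClass.comp_nil x
  inv_mul_cancel x := HClass.symm_comp x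

variable {G}

/-- Vertices of the universal cover: homotopy classes of edge-paths starting at `p`. -/
def CoverVertex (p : G.V) : Type u := Σ v : G.V, G.HClass p v

/-- Prolong a homotopy class of paths starting at `p` by an edge `e` issuing from its endpoint. -/
def CoverVertex.prolong {p : G.V} (x : CoverVertex p) (e : G.E) (h : G.o e = x.1) :
    CoverVertex p := ⟨G.t e, x.2.comp (h ▸ HClass.edge e)⟩

theorem CoverVertex.prolong_prolong {p : G.V} (x : CoverVertex p) (e : G.E) (h : G.o e = x.1)
    (h' : G.o (G.inv e) = (x.prolong e h).1) : (x.prolong e h).prolong (G.inv e) h' = x := by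
  obtain ⟨v, c⟩ := x
  change G.o e = v at h
  subst h
  have key : ∀ (w : G.V) (hw : G.o e = w) (d : G.HClass (G.t e) w),
      (HClass.edge e).comp d = hw ▸ HClass.nil (G.o e) →
      (⟨w, (c.comp (HClass.edge e)).comp d⟩ : CoverVertex p) = ⟨G.o e, c⟩ := by
    intro w hw d hd
    subst hw
    rw [HClass.comp_assoc, hd]
    exact congrArg (Sigma.mk (G.o e)) (HClass.comp_nil c)
  refine key (G.t (G.inv e)) (by rw [t, G.inv_inv]) (HClass.edge (G.inv e)) ?_
  have key2 : ∀ (w : G.V) (hw : G.o e = w) (q : G.IsPath (G.o e) [e, G.inv e] w),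
      (Quot.mk _ ⟨[e, G.inv e], q⟩ : G.HClass (G.o e) w) = hw ▸ HClass.nil (G.o e) := by
    intro w hw q
    subst hw
    exact Quot.sound ⟨[], e, [], rfl, rfl⟩
  exact key2 _ _ _

variable (G)

/-- The universal cover of a connected graph `G`, constructed from the base vertex `p`.  An
oriented edge is a pair `(x, e)` of a vertex `x` and an edge `e` of `G` issuing from the endpoint
of the class `x`; it goes from `x` to the class `x` prolonged by `e`. -/
def cover (p : G.V) : SerreGraph.{u} where
  V := CoverVertex p
  E := {a : CoverVertex p × G.E // G.o a.2 = a.1.1}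
  o a := a.1.1
  inv a := ⟨(a.1.1.prolong a.1.2 a.2, G.inv a.1.2), rfl⟩
  inv_inv a := Subtype.ext (Prod.ext (CoverVertex.prolong_prolong a.1.1 a.1.2 a.2 rfl) (G.inv_inv _))
  inv_ne a h := G.inv_ne a.1.2 (congrArg (fun b => b.1.2) h)

/-- A morphism of graphs. -/
structure Hom (G H : SerreGraph.{u}) where
  onV : G.V → H.V
  onE : G.E → H.E
  map_o : ∀ e, onV (G.o e) = H.o (onE e)
  map_inv : ∀ e, onE (G.inv e) = H.inv (onE e)

/-- The covering map from the universal cover. -/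
def coverMap (p : G.V) : Hom (G.cover p) G where
  onV := fun x : CoverVertex p => x.1
  onE := fun a : {a : CoverVertex p × G.E // G.o a.2 = a.1.1} => a.1.2
  map_o := fun a : {a : CoverVertex p × G.E // G.o a.2 = a.1.1} => a.2.symm
  map_inv _ := rfl

/-- A subgraph. -/
structure Subgraph where
  verts : Set G.V
  edges : Set G.E
  o_mem : ∀ e ∈ edges, G.o e ∈ verts
  inv_mem : ∀ e ∈ edges, G.inv e ∈ edges

variable {G}

/-- A subgraph as a graph. -/
def Subgraph.coe (K : G.Subgraph) : SerreGraph.{u} where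
  V := K.verts
  E := K.edges
  o e := ⟨G.o e.1, K.o_mem e.1 e.2⟩
  inv e := ⟨G.inv e.1, K.inv_mem e.1 e.2⟩
  inv_inv e := Subtype.ext (G.inv_inv e.1)
  inv_ne e h := G.inv_ne e.1 (congrArg Subtype.val h)

/-- Non-degenerate finite connected subgraphs; if `G` is a tree, these are exactly the
non-degenerate finite subtrees of `G`. -/
structure Subgraph.IsFiniteSubtree (K : G.Subgraph) : Prop where
  finite_verts : K.verts.Finite
  finite_edges : K.edges.Finite
  connected : K.coe.Connected
  nondegenerate : K.edges.Nonempty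

/-- The terminal edges of `K`: oriented edges of `K` whose terminal vertex has degree one
in `K`. -/
def Subgraph.terminalEdges (K : G.Subgraph) : Set G.E :=
  {e | e ∈ K.edges ∧ ∀ e' ∈ K.edges, G.o e' = G.t e → e' = G.inv e}

/-! ### `Γ`-graphs and occurrences.  A `Γ`-graph is a graph with a morphism to `Γ`. -/

/-- The link of the vertex `x`: the function that sends an edge `a` of `Γ` to the number of edges
with origin `x` and label `a`. -/
noncomputable def link {D Γ : SerreGraph.{u}} (τ : Hom D Γ) (x : D.V) (a : Γ.E) : ℕ :=
  Nat.card {e : D.E // D.o e = x ∧ τ.onE e = a}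

/-- A `Γ`-graph is folded if its labelling morphism is an immersion (locally injective). -/
def Folded {D Γ : SerreGraph.{u}} (τ : Hom D Γ) : Prop :=
  ∀ e e' : D.E, D.o e = D.o e' → τ.onE e = τ.onE e' → e = e'

/-- Finite cyclically reduced `Γ`-graphs; they need not be connected. -/
structure IsFiniteCyclicallyReduced {D Γ : SerreGraph.{u}} (τ : Hom D Γ) : Prop where
  nonempty : Nonempty D.V
  finite_verts : Finite D.V
  finite_edges : Finite D.E
  folded : Folded τ
  two_le_degree : ∀ x : D.V, 2 ≤ D.degree x

/-- The label morphism of a subgraph of the universal cover of `Γ`. -/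
def Subgraph.label {Γ : SerreGraph.{u}} {p : Γ.V} (K : (Γ.cover p).Subgraph) : Hom K.coe Γ where
  onV x := (Γ.coverMap p).onV x.1
  onE e := (Γ.coverMap p).onE e.1
  map_o e := (Γ.coverMap p).map_o e.1
  map_inv e := (Γ.coverMap p).map_inv e.1

/-- Occurrences of a `Γ`-graph `K` (a finite subtree of the universal cover) in a `Γ`-graph `D`:
label-preserving morphisms that preserve the link of each vertex of degree at least two in `K`. -/
structure Occurrence {K D Γ : SerreGraph.{u}} (σ : Hom K Γ) (τ : Hom D Γ) extends Hom K D where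
  label_onV : ∀ x, τ.onV (onV x) = σ.onV x
  label_onE : ∀ e, τ.onE (onE e) = σ.onE e
  link_eq : ∀ x, 2 ≤ K.degree x → link σ x = link τ (onV x)

end SerreGraph

/-! ### The boundary of the free group and its hyperspace -/

/-- The boundary of the free group on `Fin N`: infinite freely reduced words.  As in
`FreeGroup`, the letter `(i, true)` is the `i`-th generator and `(i, false)` its inverse. -/
@[ext]
structure Boundary (N : ℕ) where
  word : ℕ → Fin N × Bool
  reduced : ∀ n, word (n + 1) ≠ ((word n).1, !(word n).2)

namespace Boundary

variable {N : ℕ}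

/-- The visual metric: the distance of two distinct infinite words is `2⁻ⁿ`, where `n` is the
length of their longest common prefix. -/
noncomputable instance : MetricSpace (Boundary N) :=
  MetricSpace.induced Boundary.word (fun _ _ h => Boundary.ext h)
    (PiNat.metricSpace (E := fun _ : ℕ => Fin N × Bool))

theorem isInducing_word : Topology.IsInducing (word : Boundary N → ℕ → Fin N × Bool) := ⟨rfl⟩

theorem continuous_coord (n : ℕ) : Continuous (fun ξ : Boundary N => ξ.word n) :=
  (continuous_apply n).comp isInducing_word.continuous

/-- Left multiplication of an infinite reduced word by the letter `a`: cancel if the word starts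
with the inverse of `a`, and otherwise put `a` in front. -/
def letterMul (a : Fin N × Bool) (ξ : Boundary N) : Boundary N :=
  ⟨fun n => if ξ.word 0 = (a.1, !a.2) then ξ.word (n + 1) else if n = 0 then a else ξ.word (n - 1), by
    intro n
    by_cases h : ξ.word 0 = (a.1, !a.2)
    · simpa only [h, if_true] using ξ.reduced (n + 1)
    · cases n with
      | zero => simp [h]
      | succ n => simpa [h] using ξ.reduced n⟩

theorem letterMul_letterMul (a b : Fin N × Bool) (hb : b = (a.1, !a.2)) (ξ : Boundary N) :
    letterMul b (letterMul a ξ) = ξ := by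
  subst hb
  apply Boundary.ext
  funext n
  by_cases h : ξ.word 0 = (a.1, !a.2)
  · have h1 : ξ.word 1 ≠ a := by
      have := ξ.reduced 0
      rw [h] at this
      simpa using this
    cases n with
    | zero => simp [letterMul, h, h1]
    | succ n => simp [letterMul, h, h1]
  · simp [letterMul, h]

theorem continuous_letterMul (a : Fin N × Bool) :
    Continuous (letterMul a : Boundary N → Boundary N) := by
  rw [isInducing_word.continuous_iff]
  refine continuous_pi fun n => ?_
  let F : (Fin N × Bool) × (Fin N × Bool) × (Fin N × Bool) → Fin N × Bool :=
    fun q => if q.1 = (a.1, !a.2) then q.2.1 else if n = 0 then a else q.2.2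
  exact (continuous_of_discreteTopology (f := F)).comp
    ((continuous_coord 0).prodMk ((continuous_coord (n + 1)).prodMk (continuous_coord (n - 1))))

/-- The homeomorphism of the boundary given by the `i`-th generator. -/
noncomputable def generatorHomeo (i : Fin N) : Boundary N ≃ₜ Boundary N where
  toFun := letterMul (i, true)
  invFun := letterMul (i, false)
  left_inv := letterMul_letterMul _ _ rfl
  right_inv := letterMul_letterMul _ _ rfl
  continuous_toFun := continuous_letterMul _
  continuous_invFun := continuous_letterMul _

/-- The action of the free group on its boundary by left translations. -/
noncomputable def act (N : ℕ) : FreeGroup (Fin N) →* (Boundary N ≃ₜ Boundary N) :=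
  FreeGroup.lift generatorHomeo

/-- The prefix of length `n` of an infinite reduced word. -/
def prefixWord (ξ : Boundary N) (n : ℕ) : List (Fin N × Bool) :=
  List.ofFn (fun i : Fin n => ξ.word i)

/-- The limit set of a subgroup: `ξ` is a limit of elements of `H` iff each finite prefix of `ξ`
is a prefix of the reduced word of some element of `H`. -/
def limitSet (H : Subgroup (FreeGroup (Fin N))) : Closeds (Boundary N) where
  carrier := {ξ | ∀ n : ℕ, ∃ h ∈ H, ξ.prefixWord n <+: h.toWord}
  isClosed' := by
    rw [Set.ofPred_forall]
    refine isClosed_iInter fun n => ?_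
    have hc : Continuous (fun (ξ : Boundary N) (i : Fin n) => ξ.word i) :=
      continuous_pi fun i => continuous_coord i
    exact (isClosed_discrete
      {w : Fin n → Fin N × Bool | ∃ h ∈ H, List.ofFn w <+: h.toWord}).preimage hc

end Boundary

/-- The space of closed subsets of the boundary with at least two points, with the topology
given by the Hausdorff distance. -/
@[ext]
structure BigClosed (N : ℕ) where
  toCloseds : Closeds (Boundary N)
  nontrivial : (toCloseds : Set (Boundary N)).Nontrivial

namespace BigClosed

variable {N : ℕ}

noncomputable instance : TopologicalSpace (BigClosed N) :=
  TopologicalSpace.induced BigClosed.toCloseds inferInstance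

noncomputable instance : MeasurableSpace (BigClosed N) := borel _

instance : BorelSpace (BigClosed N) := ⟨rfl⟩

/-- The translation action of the free group: `S ↦ g S`. -/
noncomputable def translate (g : FreeGroup (Fin N)) (S : BigClosed N) : BigClosed N :=
  ⟨⟨Boundary.act N g '' (S.toCloseds : Set (Boundary N)),
      (Boundary.act N g).isClosedMap _ S.toCloseds.isClosed⟩,
    S.nontrivial.image (Boundary.act N g).injective⟩

end BigClosed

/-! ### Subset currents -/

/-- A subset current on the free group of rank `N`: a Borel measure on the space of closed subsets
of the boundary with at least two points, finite on compact sets and invariant under translations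
by the free group. -/
structure SubsetCurrent (N : ℕ) where
  toMeasure : Measure (BigClosed N)
  finite_of_isCompact : ∀ A : Set (BigClosed N), IsCompact A → toMeasure A < ∞
  invariant : ∀ (g : FreeGroup (Fin N)) (A : Set (BigClosed N)), MeasurableSet A →
    toMeasure (BigClosed.translate g ⁻¹' A) = toMeasure A

open Subgroup.Commensurable in
/-- The counting current of a subgroup `H` with commensurator `C`: the index of `H` in `C` times
the sum, over all conjugates `C₁` of `C`, of the Dirac measures at the limit sets of `C₁`.
(For a nontrivial finitely generated `H` the index is finite, and the limit set of each `C₁` has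
at least two points, so that the side condition on `C₁` is automatic.) -/
noncomputable def countingCurrent {N : ℕ} (H : Subgroup (FreeGroup (Fin N))) :
    Measure (BigClosed N) :=
  (H.relIndex (commensurator H) : ℝ≥0∞) •
    Measure.sum (fun C₁ : {C₁ : Subgroup (FreeGroup (Fin N)) //
        (∃ g, C₁ = (commensurator H).map (MulAut.conj g).toMonoidHom) ∧
        (Boundary.limitSet C₁ : Set (Boundary N)).Nontrivial} =>
      Measure.dirac (⟨Boundary.limitSet C₁.1, C₁.2.2⟩ : BigClosed N))

/-! ### Cylinders and weights with respect to a marking -/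

section Marking

open SerreGraph

variable {N : ℕ} {Γ : SerreGraph.{u}} {p : Γ.V} (α : FreeGroup (Fin N) ≃* Γ.Pi1 p)

/-- The orbit map of the action of the free group on the universal cover, at the base vertex
(the class of the constant path): it sends `g` to the class of the closed path `α g`. -/
def orbitPoint (g : FreeGroup (Fin N)) : (Γ.cover p).V :=
  (⟨p, α g⟩ : CoverVertex p)

/-- The reduced edge-ray `ρ` of the universal cover ends at the boundary point `ξ`, under the
identification of boundaries induced by the orbit map: the orbit points of the prefixes of `ξ`
converge to the end of `ρ`, that is, for each `m`, the reduced paths from the origin of `ρ` to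
these orbit points eventually start with the first `m` edges of `ρ`. -/
def RayEndsAt (ρ : ℕ → (Γ.cover p).E) (ξ : Boundary N) : Prop :=
  (∀ n, (Γ.cover p).o (ρ (n + 1)) = (Γ.cover p).t (ρ n)) ∧
  (∀ n, ρ (n + 1) ≠ (Γ.cover p).inv (ρ n)) ∧
  ∀ m : ℕ, ∀ᶠ n in Filter.atTop, ∃ l : List (Γ.cover p).E,
    (Γ.cover p).IsPath ((Γ.cover p).o (ρ 0)) l (orbitPoint α (FreeGroup.mk (ξ.prefixWord n))) ∧
    (Γ.cover p).IsReduced l ∧ List.ofFn (fun i : Fin m => ρ i) <+: l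

/-- The cylinder of an oriented edge `e` of the universal cover: boundary points `ξ` such that the
geodesic ray from the origin of `e` to `ξ` starts with `e`. -/
def cyl (e : (Γ.cover p).E) : Set (Boundary N) := {ξ | ∃ ρ, ρ 0 = e ∧ RayEndsAt α ρ ξ}

/-- The subset cylinder of a finite subtree `K` of the universal cover. -/
def subsetCyl (K : (Γ.cover p).Subgraph) : Set (BigClosed N) :=
  {S | (S.toCloseds : Set (Boundary N)) ⊆ ⋃ e ∈ K.terminalEdges, cyl α e ∧
    ∀ e ∈ K.terminalEdges, ((S.toCloseds : Set (Boundary N)) ∩ cyl α e).Nonempty}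

/-- The weight of `K` in the subset current `μ`. -/
noncomputable def weight (K : (Γ.cover p).Subgraph) (μ : SubsetCurrent N) : ℝ≥0∞ :=
  μ.toMeasure (subsetCyl α K)

/-- `μ` is the subset current of the `Γ`-graph `τ : D → Γ`: the unique subset current whose
weights are the numbers of occurrences in `D` of the non-degenerate finite subtrees of the
universal cover. -/
def IsCurrentOfGraph {D : SerreGraph.{u}} (τ : Hom D Γ) (μ : SubsetCurrent N) : Prop :=
  (∀ K : (Γ.cover p).Subgraph, K.IsFiniteSubtree →
    weight α K μ = (Nat.card (Occurrence K.label τ) : ℝ≥0∞)) ∧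
  ∀ ν : SubsetCurrent N, (∀ K : (Γ.cover p).Subgraph, K.IsFiniteSubtree →
    weight α K ν = (Nat.card (Occurrence K.label τ) : ℝ≥0∞)) → ν = μ

end Marking

end SubsetCurrents

open SubsetCurrents

namespace SubsetCurrents
namespace SerreGraph

/-! ### Edge-paths, backtracking and reduction -/

section General

variable {G : SerreGraph.{u}}

/-! A closed set `S` with at least two points is encoded by its convex hull in the tree `X`: the
edges with points of `S` on both sides. The hull determines `S` (`hullE_injective`). In these terms
`S` lies in the subset cylinder of `K` exactly when the hull contains `K` and branches like `K` at
every interior vertex of `K` (`mem_subsetCyl_iff`). Hence the cylinders of larger and larger balls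
of the hull of `S` decrease to `{S}` (`eq_of_forall_mem_subsetCyl`).

Integrality now forces atomicity. The weights of these balls form a decreasing sequence of natural
numbers, so they become constant: `μ {S}` is a natural number `n S`, and it is already the weight of
some cylinder containing `S` (`exists_natCast_eq_measure_singleton`). Points of mass zero are
therefore covered by null cylinders, of which there are countably many, so `μ` is the sum of its
atoms (`measure_eq_tsum_atoms`). The sets whose hull contains a given edge form a compact set, so
only finitely many atoms among them occur (`finite_atoms`).

For an atom `S` this local finiteness and invariance make `stab S` act on the hull of `S` with
finitely many vertex orbits (`exists_finite_representatives`). Consequently `stab S` is finitely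
generated, has limit set `S`, and equals its own commensurator, so its counting current is the
counting measure of the orbit of `S`. Taking `n S` copies for each orbit of atoms gives the
decomposition (`exists_measure_eq_sum_countingCurrent`).

The graph is the quotient by the free group of the disjoint union of `n S` copies of the hull of
each `S` (`hullGraph`). An occurrence of `K` lifts uniquely to a copy of a hull containing `K`, and
preservation of links is the cylinder condition, so occurrences are counted by the sum of `n S` over
the cylinder (`natCard_occurrence`), which is the weight. Any other current with these weights is
also atomic with the same masses, hence equal to `μ`.

All this needs the boundary of words identified with the ends of `X`; the geometric input is that
far-away edges control long prefixes (`exists_toward_prefix`) and conversely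
(`exists_stable_length`). -/

@[simp] theorem t_inv (e : G.E) : G.t (G.inv e) = G.o e := by
  rw [t, G.inv_inv]

@[simp] theorem o_inv (e : G.E) : G.o (G.inv e) = G.t e := rfl

theorem inv_eq_comm {a b : G.E} : a = G.inv b ↔ b = G.inv a := by
  constructor <;> rintro rfl <;> rw [G.inv_inv]

theorem isPath_append_iff : ∀ {l₁ l₂ : List G.E} {a c : G.V},
    G.IsPath a (l₁ ++ l₂) c ↔ ∃ b, G.IsPath a l₁ b ∧ G.IsPath b l₂ c
  | [], l₂, a, c => by
      constructor
      · intro h; exact ⟨a, rfl, h⟩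
      · rintro ⟨b, h, h'⟩
        have h : a = b := h
        subst h; exact h'
  | e :: l₁, l₂, a, c => by
      constructor
      · rintro ⟨h, h'⟩
        obtain ⟨b, h1, h2⟩ := isPath_append_iff.1 h'
        exact ⟨b, ⟨h, h1⟩, h2⟩
      · rintro ⟨b, ⟨h, h1⟩, h2⟩
        exact ⟨h, isPath_append_iff.2 ⟨b, h1, h2⟩⟩

theorem IsPath.end_unique : ∀ {l : List G.E} {a b c : G.V},
    G.IsPath a l b → G.IsPath a l c → b = c
  | [], _, _, _, h, h' => Eq.trans (Eq.symm h) h'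
  | _ :: _, _, _, _, h, h' => IsPath.end_unique h.2 h'.2

theorem isReduced_cons_cons {e f : G.E} {l : List G.E} :
    G.IsReduced (e :: f :: l) ↔ f ≠ G.inv e ∧ G.IsReduced (f :: l) := by
  simp [IsReduced]

theorem IsReduced.tail {e : G.E} {l : List G.E} (h : G.IsReduced (e :: l)) : G.IsReduced l :=
  List.IsChain.tail h

theorem IsReduced.reverse {l : List G.E} (h : G.IsReduced l) :
    G.IsReduced (l.reverse.map G.inv) := by
  unfold IsReduced at *
  rw [List.isChain_map, List.isChain_reverse]
  refine h.imp fun a b hab h' => hab ?_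
  rw [G.inv_inv] at h'
  exact h'.symm

theorem exists_isReduced : ∀ (l : List G.E) (a b : G.V), G.IsPath a l b →
    ∃ l', G.IsPath a l' b ∧ G.IsReduced l' ∧ l'.length ≤ l.length
  | [], _, _, h => ⟨[], h, List.isChain_nil, le_rfl⟩
  | e :: l, a, b, h => by
      obtain ⟨l', h1, h2, h3⟩ := exists_isReduced l _ b h.2
      match l', h1, h2, h3 with
      | [], h1, _, _ =>
        exact ⟨[e], ⟨h.1, h1⟩, List.isChain_singleton _, by simp⟩
      | f :: l'', h1, h2, h3 =>
        by_cases hf : f = G.inv e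
        · subst hf
          refine ⟨l'', ?_, h2.tail, ?_⟩
          · have := h1.2
            rw [t_inv, h.1] at this
            exact this
          · simp at h3 ⊢; omega
        · exact ⟨e :: f :: l'', ⟨h.1, h1⟩, isReduced_cons_cons.2 ⟨hf, h2⟩, by simpa using h3⟩

/-- The homotopy class of a path. -/
def HClass.ofPath {a b : G.V} (l : List G.E) (h : G.IsPath a l b) : G.HClass a b :=
  Quot.mk _ (⟨l, h⟩ : G.Path a b)

/-! ### Normal forms of homotopy classes of paths -/

open Classical in
/-- Append an edge to a reduced path that is stored as a stack, cancelling if possible. -/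
noncomputable def push (s : List G.E) (e : G.E) : List G.E :=
  match s with
  | [] => [e]
  | f :: s' => if f = G.inv e then s' else e :: f :: s'

theorem push_isReduced {s : List G.E} (hs : G.IsReduced s) (e : G.E) :
    G.IsReduced (push s e) := by
  match s, hs with
  | [], _ => exact List.isChain_singleton _
  | f :: s', hs =>
    by_cases h : f = G.inv e
    · simpa [push, h] using hs.tail
    · simpa [push, h, isReduced_cons_cons] using hs

/-- This makes the stack invariant under elementary reductions. Reducedness is essential: if `e`
cancels the top `e⁻¹`, the next entry must not be `e`, or the second push would cancel again. -/
theorem push_push_inv {s : List G.E} (hs : G.IsReduced s) (e : G.E) :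
    push (push s e) (G.inv e) = s := by
  match s, hs with
  | [], _ => simp [push, G.inv_inv]
  | [f], hs =>
    by_cases h : f = G.inv e
    · simp [push, h]
    · simp [push, h, G.inv_inv]
  | f :: f' :: s', hs =>
    by_cases h : f = G.inv e
    · subst h
      have := (isReduced_cons_cons.1 hs).1
      simp [push, this]
    · simp [push, h, G.inv_inv]

theorem foldl_push_isReduced (l : List G.E) : ∀ {s : List G.E}, G.IsReduced s →
    G.IsReduced (l.foldl push s) := by
  induction l with
  | nil => intro s hs; exact hs
  | cons e l ih => intro s hs; exact ih (push_isReduced hs e)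

theorem foldl_push_of_isReduced : ∀ (l : List G.E) (s : List G.E),
    G.IsReduced (l.reverse ++ s) → l.foldl push s = l.reverse ++ s
  | [], s, _ => rfl
  | e :: l, s, h => by
      have h' : G.IsReduced (l.reverse ++ e :: s) := by simpa using h
      have hp : push s e = e :: s := by
        have h2 : G.IsReduced (e :: s) := List.IsChain.right_of_append h'
        match s, h2 with
        | [], _ => rfl
        | f :: s', h2 => simp [push, (isReduced_cons_cons.1 h2).1]
      rw [List.foldl_cons, hp, foldl_push_of_isReduced l _ h']
      simp

/-- The reduced representative, stored as a stack, of a homotopy class of paths. -/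
noncomputable def HClass.stack {a b : G.V} : G.HClass a b → List G.E :=
  Quot.lift (fun q => q.1.foldl push []) (by
    rintro c d ⟨l₁, e, l₂, h, h'⟩
    simp only [h, h', List.foldl_append, List.foldl_cons]
    rw [push_push_inv (foldl_push_isReduced l₁ List.isChain_nil)])

theorem HClass.stack_ofPath {a b : G.V} {l : List G.E} (hl : G.IsPath a l b)
    (h : G.IsReduced l) : HClass.stack (HClass.ofPath l hl) = l.reverse := by
  have := foldl_push_of_isReduced l [] (by
    rw [List.append_nil]
    unfold IsReduced at *
    rw [List.isChain_reverse]
    exact h.imp fun a b hab h' => hab (inv_eq_comm.1 h'))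
  rw [List.append_nil] at this
  exact this

/-! ### Trees and geodesics -/

/-- A tree: any two vertices are joined by exactly one reduced path. -/
def IsTree (G : SerreGraph.{u}) : Prop :=
  ∀ x z : G.V, ∃! l : List G.E, G.IsPath x l z ∧ G.IsReduced l

/-- The geodesic between two vertices of a tree. -/
noncomputable def geo (hG : G.IsTree) (x z : G.V) : List G.E := (hG x z).choose

variable (hG : G.IsTree)

theorem geo_isPath (x z : G.V) : G.IsPath x (geo hG x z) z := (hG x z).choose_spec.1.1

theorem geo_isReduced (x z : G.V) : G.IsReduced (geo hG x z) := (hG x z).choose_spec.1.2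

theorem geo_eq {x z : G.V} {l : List G.E} (h : G.IsPath x l z) (h' : G.IsReduced l) :
    geo hG x z = l := ((hG x z).choose_spec.2 l ⟨h, h'⟩).symm

@[simp] theorem geo_self (x : G.V) : geo hG x x = [] := geo_eq hG rfl List.isChain_nil

theorem geo_eq_nil {x z : G.V} : geo hG x z = [] ↔ x = z := by
  constructor
  · intro h
    have := geo_isPath hG x z
    rw [h] at this
    exact this
  · rintro rfl; simp

theorem geo_reverse (x z : G.V) : geo hG z x = (geo hG x z).reverse.map G.inv :=
  geo_eq hG (geo_isPath hG x z).reverse (geo_isReduced hG x z).reverse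

/-- The combinatorial distance in a tree. -/
noncomputable def dist (x z : G.V) : ℕ := (geo hG x z).length

theorem dist_comm (x z : G.V) : dist hG x z = dist hG z x := by
  simp [dist, geo_reverse hG x z]

theorem dist_le_length {x z : G.V} {l : List G.E} (h : G.IsPath x l z) :
    dist hG x z ≤ l.length := by
  obtain ⟨l', h1, h2, h3⟩ := exists_isReduced l x z h
  rw [dist, geo_eq hG h1 h2]
  exact h3

theorem dist_triangle (x y z : G.V) : dist hG x z ≤ dist hG x y + dist hG y z := by
  simpa [dist] using dist_le_length hG ((geo_isPath hG x y).append (geo_isPath hG y z))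

theorem dist_eq_zero {x z : G.V} : dist hG x z = 0 ↔ x = z := by
  rw [dist, List.length_eq_zero_iff, geo_eq_nil]

/-- The vertex `z` is on the far side of the oriented edge `e`: the geodesic from the origin of
`e` to `z` starts with `e`. -/
def Side (e : G.E) (z : G.V) : Prop := ∃ l, geo hG (G.o e) z = e :: l

variable {hG}

theorem Side.geo_eq {e : G.E} {z : G.V} (h : Side hG e z) :
    geo hG (G.o e) z = e :: geo hG (G.t e) z := by
  obtain ⟨l, hl⟩ := h
  have h1 := geo_isPath hG (G.o e) z
  have h2 := geo_isReduced hG (G.o e) z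
  rw [hl] at h1 h2 ⊢
  rw [SerreGraph.geo_eq hG h1.2 h2.tail]

theorem Side.dist_eq {e : G.E} {z : G.V} (h : Side hG e z) :
    dist hG (G.o e) z = dist hG (G.t e) z + 1 := by
  rw [dist, h.geo_eq]; rfl

theorem side_of_path {e : G.E} {l : List G.E} {z : G.V} (h : G.IsPath (G.t e) l z)
    (h' : G.IsReduced (e :: l)) : Side hG e z :=
  ⟨l, geo_eq hG ⟨rfl, h⟩ h'⟩

theorem geo_of_not_side {e : G.E} {z : G.V} (h : ¬ Side hG e z) :
    geo hG (G.t e) z = G.inv e :: geo hG (G.o e) z := by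
  refine SerreGraph.geo_eq hG ⟨rfl, ?_⟩ ?_
  · rw [t_inv]; exact geo_isPath hG _ _
  · have h2 := geo_isReduced hG (G.o e) z
    match hl : geo hG (G.o e) z, h2 with
    | [], _ => exact List.isChain_singleton _
    | f :: l, h2 =>
      refine isReduced_cons_cons.2 ⟨?_, h2⟩
      rw [G.inv_inv]
      rintro rfl
      exact h ⟨l, hl⟩

theorem not_side_iff {e : G.E} {z : G.V} : ¬ Side hG e z ↔ Side hG (G.inv e) z := by
  constructor
  · intro h
    exact ⟨_, geo_of_not_side h⟩
  · intro h h'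
    have h1 := h.dist_eq
    have h2 := h'.dist_eq
    rw [t_inv, o_inv] at h1
    omega

theorem side_inv {e : G.E} {z : G.V} : Side hG (G.inv e) z ↔ ¬ Side hG e z := not_side_iff.symm

theorem side_t (e : G.E) : Side hG e (G.t e) :=
  side_of_path (l := []) rfl (List.isChain_singleton _)

theorem not_side_o (e : G.E) : ¬ Side hG e (G.o e) := by
  rintro ⟨l, hl⟩; simp at hl

theorem side_unique {e f : G.E} {z : G.V} (h : G.o e = G.o f) (he : Side hG e z)
    (hf : Side hG f z) : e = f := by
  obtain ⟨l, hl⟩ := he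
  obtain ⟨l', hl'⟩ := hf
  rw [h, hl'] at hl
  simp at hl
  exact hl.1.symm

theorem exists_side {x z : G.V} (h : x ≠ z) : ∃ e, G.o e = x ∧ Side hG e z := by
  match hl : geo hG x z with
  | [] => exact absurd ((geo_eq_nil hG).1 hl) h
  | e :: l =>
    have h1 := geo_isPath hG x z
    rw [hl] at h1
    refine ⟨e, h1.1, l, ?_⟩
    rw [h1.1, hl]

/-- No cancellation occurs at the origin of `e`: the second geodesic starts with `e`, and the first
does not end with `e⁻¹` because `z` is not beyond `e`. -/
theorem geo_of_crossing {e : G.E} {z z' : G.V} (h : ¬ Side hG e z) (h' : Side hG e z') :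
    geo hG z z' = geo hG z (G.o e) ++ geo hG (G.o e) z' := by
  refine SerreGraph.geo_eq hG ((geo_isPath hG _ _).append (geo_isPath hG _ _)) ?_
  unfold IsReduced
  rw [List.isChain_append]
  refine ⟨geo_isReduced hG _ _, geo_isReduced hG _ _, ?_⟩
  intro a ha b hb hab
  rw [h'.geo_eq] at hb
  simp at hb
  subst hb
  rw [geo_reverse hG (G.o e) z] at ha
  match hl : geo hG (G.o e) z with
  | [] => rw [hl] at ha; simp at ha
  | f :: l =>
    rw [hl] at ha
    simp at ha
    subst ha
    rw [G.inv_inv] at hab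
    subst hab
    exact h ⟨l, hl⟩

theorem dist_of_crossing {e : G.E} {z z' : G.V} (h : ¬ Side hG e z) (h' : Side hG e z') :
    dist hG z z' = dist hG z (G.o e) + dist hG (G.o e) z' := by
  simp [dist, geo_of_crossing h h']

/-- Changing sides of `e` requires passing through its origin, which is too far away. This is the
main tool for transferring a side from one point to a nearby one. -/
theorem side_congr {e : G.E} {z z' : G.V} (h : dist hG z z' < dist hG (G.o e) z) :
    Side hG e z ↔ Side hG e z' := by
  by_cases h1 : Side hG e z <;> by_cases h2 : Side hG e z'
  · simp [h1, h2]
  · have := dist_of_crossing h2 h1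
    rw [dist_comm hG z' z] at this
    omega
  · have := dist_of_crossing h1 h2
    rw [dist_comm hG z (G.o e)] at this
    omega
  · simp [h1, h2]

theorem side_of_side {e f : G.E} {z : G.V} (h : G.o f = G.t e) (hne : f ≠ G.inv e)
    (hf : Side hG f z) : Side hG e z := by
  have h1 := hf.geo_eq
  have h2 := geo_isReduced hG (G.o f) z
  have h3 := geo_isPath hG (G.o f) z
  rw [h1] at h2 h3
  rw [h] at h3
  exact side_of_path h3 (isReduced_cons_cons.2 ⟨hne, h2⟩)

end General

/-! ### The universal cover is a tree -/

section Cover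

variable {Γ : SerreGraph.{u}} {p : Γ.V}

/-- The label of an edge of the universal cover. -/
def lab (a : (Γ.cover p).E) : Γ.E := (Γ.coverMap p).onE a

/-- The image in `Γ` of a vertex of the universal cover. -/
def ver (x : (Γ.cover p).V) : Γ.V := (Γ.coverMap p).onV x

theorem o_lab (a : (Γ.cover p).E) : Γ.o (lab a) = ver ((Γ.cover p).o a) :=
  ((Γ.coverMap p).map_o a).symm

theorem cover_edge_ext {a b : (Γ.cover p).E} (h : (Γ.cover p).o a = (Γ.cover p).o b)
    (h' : lab a = lab b) : a = b :=
  Subtype.ext (Prod.ext h h')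

theorem exists_cover_edge (x : (Γ.cover p).V) (e : Γ.E) (h : Γ.o e = ver x) :
    ∃ a : (Γ.cover p).E, (Γ.cover p).o a = x ∧ lab a = e :=
  ⟨⟨(x, e), h⟩, rfl, rfl⟩

/-- The homotopy class of paths represented by a vertex of the universal cover. -/
def cls (x : (Γ.cover p).V) : Γ.HClass p (ver x) := Sigma.snd (β := fun v => Γ.HClass p v) x

/-- The vertex of the universal cover represented by a homotopy class of paths. -/
def coverVertex {v : Γ.V} (c : Γ.HClass p v) : (Γ.cover p).V := (⟨v, c⟩ : CoverVertex p)

/-- The edge of the universal cover with label `e` issuing from the class `c`. -/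
def coverEdge (e : Γ.E) (c : Γ.HClass p (Γ.o e)) : (Γ.cover p).E :=
  ⟨((⟨Γ.o e, c⟩ : CoverVertex p), e), rfl⟩

theorem exists_eq_coverEdge (a : (Γ.cover p).E) : ∃ e c, a = coverEdge e c := by
  obtain ⟨⟨⟨v, c⟩, e⟩, h⟩ := a
  change Γ.o e = v at h
  subst h
  exact ⟨e, c, rfl⟩

theorem HClass.edge_comp_ofPath {e : Γ.E} {l : List Γ.E} {w : Γ.V} (h : Γ.IsPath (Γ.t e) l w) :
    (HClass.edge e).comp (HClass.ofPath l h) = HClass.ofPath (a := Γ.o e) (e :: l) ⟨rfl, h⟩ :=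
  rfl

theorem cover_path_label : ∀ (l : List (Γ.cover p).E) (x z : (Γ.cover p).V),
    (Γ.cover p).IsPath x l z → ∃ h : Γ.IsPath (ver x) (l.map lab) (ver z),
      cls z = HClass.comp (cls x) (HClass.ofPath _ h)
  | [], x, z, h => by
      have h : x = z := h
      subst h
      exact ⟨rfl, (HClass.comp_nil _).symm⟩
  | a :: l, x, z, h => by
      obtain ⟨h1, h2⟩ := h
      subst h1
      obtain ⟨h3, h4⟩ := cover_path_label l _ _ h2
      obtain ⟨e, c, rfl⟩ := exists_eq_coverEdge a
      refine ⟨⟨rfl, h3⟩, h4.trans ?_⟩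
      exact (HClass.comp_assoc c (HClass.edge e) _)

theorem exists_cover_path : ∀ (l : List Γ.E) {v w : Γ.V} (c : Γ.HClass p v)
    (h : Γ.IsPath v l w), ∃ l' : List (Γ.cover p).E,
      (Γ.cover p).IsPath (coverVertex c) l' (coverVertex (HClass.comp c (HClass.ofPath l h)))
      ∧ l'.map lab = l
  | [], v, w, c, h => by
      refine ⟨[], ?_, rfl⟩
      have h' : v = w := h
      subst h'
      exact congrArg coverVertex (HClass.comp_nil c).symm
  | e :: l, v, w, c, h => by
      obtain ⟨h1, h2⟩ := h
      subst h1
      obtain ⟨l', h3, h4⟩ := exists_cover_path l (c.comp (HClass.edge e)) h2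
      rw [HClass.comp_assoc, HClass.edge_comp_ofPath] at h3
      exact ⟨coverEdge e c :: l', ⟨rfl, h3⟩, congrArg (List.cons e) h4⟩

theorem cover_path_unique : ∀ (l l' : List (Γ.cover p).E) (x z z' : (Γ.cover p).V),
    (Γ.cover p).IsPath x l z → (Γ.cover p).IsPath x l' z' → l.map lab = l'.map lab → l = l'
  | [], [], _, _, _, _, _, _ => rfl
  | [], _ :: _, _, _, _, _, _, h => by simp at h
  | _ :: _, [], _, _, _, _, _, h => by simp at h
  | a :: l, b :: l', x, z, z', h1, h2, h => by
      simp only [List.map_cons, List.cons.injEq] at h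
      have hab : a = b := cover_edge_ext (h1.1.trans h2.1.symm) h.1
      subst hab
      rw [cover_path_unique l l' _ _ _ h1.2 h2.2 h.2]

theorem lab_isReduced : ∀ (l : List (Γ.cover p).E) (x z : (Γ.cover p).V),
    (Γ.cover p).IsPath x l z → (Γ.cover p).IsReduced l → Γ.IsReduced (l.map lab)
  | [], _, _, _, _ => List.isChain_nil
  | [_], _, _, _, _ => List.isChain_singleton _
  | a :: b :: l, x, z, h, h' => by
      refine isReduced_cons_cons.2 ⟨?_, lab_isReduced (b :: l) _ _ h.2 h'.tail⟩
      intro hab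
      refine (isReduced_cons_cons.1 h').1 (cover_edge_ext ?_ hab)
      exact h.2.1

theorem exists_path_from_base (x : (Γ.cover p).V) :
    ∃ l, (Γ.cover p).IsPath (coverVertex (HClass.nil p)) l x := by
  obtain ⟨v, c⟩ := x
  induction c using Quot.ind with
  | mk q =>
    obtain ⟨l', h, -⟩ := exists_cover_path q.1 (HClass.nil p) q.2
    exact ⟨l', h⟩

theorem cover_isTree (p : Γ.V) : (Γ.cover p).IsTree := by
  intro x z
  obtain ⟨l₁, h₁⟩ := exists_path_from_base x
  obtain ⟨l₂, h₂⟩ := exists_path_from_base z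
  obtain ⟨l, hl, hr, -⟩ := exists_isReduced _ _ _ (h₁.reverse.append h₂)
  refine ⟨l, ⟨hl, hr⟩, ?_⟩
  -- The class of the inverse of `x` followed by `z` does not depend on the path, and its normal
  -- form is the label of any reduced path from `x` to `z`; unique path lifting then determines the
  -- path.
  have key : ∀ l, (Γ.cover p).IsPath x l z → (Γ.cover p).IsReduced l →
      HClass.stack ((HClass.symm (cls x)).comp (cls z)) = (l.map lab).reverse := by
    intro l h1 h2
    obtain ⟨h3, h4⟩ := cover_path_label l x z h1
    rw [h4, ← HClass.comp_assoc, HClass.symm_comp, HClass.nil_comp]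
    exact HClass.stack_ofPath _ (lab_isReduced l x z h1 h2)
  rintro l' ⟨h1, h2⟩
  have := (key l' h1 h2).symm.trans (key l hl hr)
  exact cover_path_unique _ _ _ _ _ h1 hl (List.reverse_injective this)

end Cover

end SerreGraph
open SerreGraph
open scoped Pointwise

/-! ### Inverses in the fundamental groupoid -/

namespace SerreGraph.HClass

variable {G : SerreGraph.{u}}

theorem symm_symm {a b : G.V} (c : G.HClass a b) : c.symm.symm = c := by
  induction c using Quot.ind with
  | mk q =>
    refine congrArg (Quot.mk _) (Subtype.ext ?_)
    change ((q.1.reverse.map G.inv).reverse.map G.inv) = q.1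
    rw [← List.map_reverse, List.reverse_reverse, List.map_map]
    have : G.inv ∘ G.inv = id := funext G.inv_inv
    rw [this, List.map_id]

theorem comp_symm {a b : G.V} (c : G.HClass a b) : c.comp c.symm = nil a := by
  have := symm_comp c.symm
  rwa [symm_symm] at this

end SerreGraph.HClass

/-! ### The action on the universal cover -/

section Action

variable {N : ℕ} {Γ : SerreGraph.{u}} {p : Γ.V} (α : FreeGroup (Fin N) ≃* Γ.Pi1 p)

/-- The homotopy class of closed paths that corresponds to `g` under the marking. -/
def loopClass (g : FreeGroup (Fin N)) : Γ.HClass p p := α g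

theorem loopClass_mul (g h : FreeGroup (Fin N)) :
    loopClass α (g * h) = (loopClass α g).comp (loopClass α h) := map_mul α g h

theorem loopClass_one : loopClass α 1 = HClass.nil p := map_one α

theorem loopClass_injective : Function.Injective (loopClass α) := α.injective

theorem loopClass_surjective : Function.Surjective (loopClass α) := α.surjective

/-- The action on the vertices of the universal cover. -/
def actV (g : FreeGroup (Fin N)) (x : (Γ.cover p).V) : (Γ.cover p).V :=
  coverVertex ((loopClass α g).comp (cls x))

/-- The action on the edges of the universal cover. -/
def actE (g : FreeGroup (Fin N)) (a : (Γ.cover p).E) : (Γ.cover p).E :=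
  ⟨(actV α g ((Γ.cover p).o a), lab a), o_lab a⟩

theorem ver_actV (g : FreeGroup (Fin N)) (x : (Γ.cover p).V) : ver (actV α g x) = ver x := rfl

theorem lab_actE (g : FreeGroup (Fin N)) (a : (Γ.cover p).E) : lab (actE α g a) = lab a := rfl

theorem o_actE (g : FreeGroup (Fin N)) (a : (Γ.cover p).E) :
    (Γ.cover p).o (actE α g a) = actV α g ((Γ.cover p).o a) := rfl

theorem t_actE (g : FreeGroup (Fin N)) (a : (Γ.cover p).E) :
    (Γ.cover p).t (actE α g a) = actV α g ((Γ.cover p).t a) := by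
  obtain ⟨e, c, rfl⟩ := exists_eq_coverEdge a
  exact congrArg coverVertex (HClass.comp_assoc (loopClass α g) c (HClass.edge e))

theorem actE_inv (g : FreeGroup (Fin N)) (a : (Γ.cover p).E) :
    actE α g ((Γ.cover p).inv a) = (Γ.cover p).inv (actE α g a) :=
  cover_edge_ext (t_actE α g a).symm rfl

theorem actV_one (x : (Γ.cover p).V) : actV α 1 x = x := by
  rw [actV, loopClass_one, HClass.nil_comp]; rfl

theorem actV_mul (g h : FreeGroup (Fin N)) (x : (Γ.cover p).V) :
    actV α (g * h) x = actV α g (actV α h x) := by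
  rw [actV, loopClass_mul, HClass.comp_assoc]; rfl

theorem actE_one (a : (Γ.cover p).E) : actE α 1 a = a :=
  cover_edge_ext (actV_one α _) rfl

theorem actE_mul (g h : FreeGroup (Fin N)) (a : (Γ.cover p).E) :
    actE α (g * h) a = actE α g (actE α h a) :=
  cover_edge_ext (actV_mul α g h _) rfl

@[simp] theorem actV_inv_actV (g : FreeGroup (Fin N)) (x : (Γ.cover p).V) :
    actV α g⁻¹ (actV α g x) = x := by
  rw [← actV_mul, inv_mul_cancel, actV_one]

@[simp] theorem actV_actV_inv (g : FreeGroup (Fin N)) (x : (Γ.cover p).V) :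
    actV α g (actV α g⁻¹ x) = x := by
  rw [← actV_mul, mul_inv_cancel, actV_one]

@[simp] theorem actE_inv_actE (g : FreeGroup (Fin N)) (x : (Γ.cover p).E) :
    actE α g⁻¹ (actE α g x) = x := by
  rw [← actE_mul, inv_mul_cancel, actE_one]

@[simp] theorem actE_actE_inv (g : FreeGroup (Fin N)) (x : (Γ.cover p).E) :
    actE α g (actE α g⁻¹ x) = x := by
  rw [← actE_mul, mul_inv_cancel, actE_one]

/-- A vertex is a homotopy class, and it can be cancelled on the right in the groupoid of paths. -/
theorem actV_free {g : FreeGroup (Fin N)} {x : (Γ.cover p).V} (h : actV α g x = x) : g = 1 := by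
  have h1 : ∀ {v : Γ.V} (c d : Γ.HClass p v), coverVertex c = coverVertex d → c = d := by
    intro v c d h
    exact eq_of_heq (Sigma.mk.inj h).2
  have h2 := h1 _ (cls x) h
  refine loopClass_injective α ?_
  rw [loopClass_one, ← HClass.comp_nil (loopClass α g), ← HClass.comp_symm (cls x),
    ← HClass.comp_assoc, h2]

theorem actV_left_cancel {g h : FreeGroup (Fin N)} {x : (Γ.cover p).V}
    (e : actV α g x = actV α h x) : g = h := by
  have : actV α (h⁻¹ * g) x = x := by rw [actV_mul, e, actV_inv_actV]
  have := actV_free α this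
  exact (inv_mul_eq_one.1 this).symm

theorem exists_actV_eq {x y : (Γ.cover p).V} (h : ver x = ver y) : ∃ g, actV α g x = y := by
  obtain ⟨v, c⟩ := x
  obtain ⟨w, d⟩ := y
  change v = w at h
  subst h
  obtain ⟨g, hg⟩ := loopClass_surjective α (HClass.comp d (HClass.symm c))
  refine ⟨g, ?_⟩
  change coverVertex ((loopClass α g).comp c) = coverVertex d
  rw [hg, HClass.comp_assoc, HClass.symm_comp, HClass.comp_nil]

theorem exists_actE_eq {a b : (Γ.cover p).E} (h : lab a = lab b) : ∃ g, actE α g a = b := by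
  obtain ⟨g, hg⟩ := exists_actV_eq α
    (show ver ((Γ.cover p).o a) = ver ((Γ.cover p).o b) by rw [← o_lab, ← o_lab, h])
  exact ⟨g, cover_edge_ext hg h⟩

theorem orbitPoint_eq (g : FreeGroup (Fin N)) : orbitPoint α g = actV α g (orbitPoint α 1) := by
  have h1 : orbitPoint α 1 = coverVertex (HClass.nil p) :=
    congrArg coverVertex (loopClass_one α)
  rw [h1]
  exact congrArg coverVertex (HClass.comp_nil (loopClass α g)).symm

theorem actV_orbitPoint (g h : FreeGroup (Fin N)) :
    actV α g (orbitPoint α h) = orbitPoint α (g * h) := by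
  rw [orbitPoint_eq α h, orbitPoint_eq α (g * h), actV_mul]

theorem isPath_actE (g : FreeGroup (Fin N)) : ∀ {l : List (Γ.cover p).E} {x z : (Γ.cover p).V},
    (Γ.cover p).IsPath x l z → (Γ.cover p).IsPath (actV α g x) (l.map (actE α g)) (actV α g z)
  | [], _, _, h => congrArg (actV α g) h
  | a :: _, _, _, h => ⟨congrArg (actV α g) h.1, by
      have := isPath_actE g h.2
      rw [← t_actE] at this
      exact this⟩

theorem isReduced_actE (g : FreeGroup (Fin N)) {l : List (Γ.cover p).E}
    (h : (Γ.cover p).IsReduced l) : (Γ.cover p).IsReduced (l.map (actE α g)) := by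
  unfold SerreGraph.IsReduced at *
  rw [List.isChain_map]
  refine h.imp fun a b hab h' => hab ?_
  rw [← actE_inv] at h'
  have := congrArg (actE α g⁻¹) h'
  simpa using this

/-- The geodesic between two vertices of the universal cover. -/
noncomputable abbrev cgeo (x z : (Γ.cover p).V) : List (Γ.cover p).E := geo (cover_isTree p) x z

/-- The distance of two vertices of the universal cover. -/
noncomputable abbrev cdist (x z : (Γ.cover p).V) : ℕ := dist (cover_isTree p) x z

/-- The far side of an edge of the universal cover. -/
abbrev CSide (e : (Γ.cover p).E) (z : (Γ.cover p).V) : Prop := Side (cover_isTree p) e z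

theorem cgeo_actV (g : FreeGroup (Fin N)) (x z : (Γ.cover p).V) :
    cgeo (actV α g x) (actV α g z) = (cgeo x z).map (actE α g) :=
  geo_eq _ (isPath_actE α g (geo_isPath _ _ _)) (isReduced_actE α g (geo_isReduced _ _ _))

theorem cdist_actV (g : FreeGroup (Fin N)) (x z : (Γ.cover p).V) :
    cdist (actV α g x) (actV α g z) = cdist x z := by
  have := congrArg List.length (cgeo_actV α g x z)
  rwa [List.length_map] at this

theorem CSide.act (g : FreeGroup (Fin N)) {e : (Γ.cover p).E} {z : (Γ.cover p).V}
    (h : CSide e z) : CSide (actE α g e) (actV α g z) := by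
  obtain ⟨l, hl⟩ := h
  refine ⟨l.map (actE α g), ?_⟩
  have := cgeo_actV α g ((Γ.cover p).o e) z
  rw [o_actE]
  refine this.trans ?_
  rw [cgeo, hl, List.map_cons]

theorem cside_act_iff (g : FreeGroup (Fin N)) {e : (Γ.cover p).E} {z : (Γ.cover p).V} :
    CSide (actE α g e) (actV α g z) ↔ CSide e z := by
  refine ⟨fun h => ?_, CSide.act α g⟩
  have := CSide.act α g⁻¹ h
  simpa using this

theorem cdist_orbitPoint (g h : FreeGroup (Fin N)) :
    cdist (orbitPoint α g) (orbitPoint α h) = cdist (orbitPoint α 1) (orbitPoint α (g⁻¹ * h)) := by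
  rw [← cdist_actV α g⁻¹, actV_orbitPoint, actV_orbitPoint, inv_mul_cancel]

/-- A vertex is determined by the labels along the geodesic from `x`, a word of length at most `r`
in a finite alphabet. -/
theorem finite_ball [Finite Γ.E] (x : (Γ.cover p).V) (r : ℕ) : {z | cdist x z ≤ r}.Finite := by
  refine Set.Finite.of_finite_image (f := fun z => (cgeo x z).map lab)
    ((List.finite_length_le Γ.E r).subset ?_) ?_
  · rintro _ ⟨z, hz, rfl⟩
    exact (List.length_map _).trans_le hz
  · intro z _ z' _ h
    have h1 := geo_isPath (cover_isTree p) x z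
    have h2 := geo_isPath (cover_isTree p) x z'
    have := cover_path_unique _ _ _ _ _ h1 h2 h
    rw [this] at h1
    exact h1.end_unique h2

theorem finite_setOf_cdist_orbitPoint_le [Finite Γ.E] (x : (Γ.cover p).V) (r : ℕ) :
    {g | cdist x (orbitPoint α g) ≤ r}.Finite := by
  refine Set.Finite.of_finite_image (f := orbitPoint α) ((finite_ball x r).subset ?_) ?_
  · rintro _ ⟨z, hz, rfl⟩
    exact hz
  · intro g _ h _ e
    rw [orbitPoint_eq α g, orbitPoint_eq α h] at e
    exact actV_left_cancel α e

end Action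

/-! ### Reduced words -/

section Words

variable {N : ℕ}

/-- Cancellation in `g⁻¹ h` removes only the common prefix, which is shorter than `u`; at least `|h|
- |u|` letters of `h` survive. -/
theorem length_le_norm_add {u : List (Fin N × Bool)} : ∀ {g h : List (Fin N × Bool)},
    FreeGroup.IsReduced g → FreeGroup.IsReduced h → u <+: h → ¬ u <+: g →
    h.length ≤ ((FreeGroup.mk g)⁻¹ * FreeGroup.mk h).norm + u.length := by
  induction u with
  | nil => intro g h _ _ _ hu; exact absurd List.nil_prefix hu
  | cons a u ih =>
    intro g h hg hh huh hug
    match h, hh, huh with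
    | [], _, huh => simp at huh
    | a' :: h', hh, huh =>
      obtain ⟨rfl, huh2⟩ := List.cons_prefix_cons.1 huh
      match g, hg, hug with
      | [], _, _ =>
        have : (1 : FreeGroup (Fin N)) = FreeGroup.mk [] := rfl
        rw [← this, inv_one, one_mul, FreeGroup.norm, FreeGroup.toWord_mk, hh.reduce_eq]
        omega
      | b :: g', hg, hug =>
        by_cases hab : a = b
        · subst hab
          have h1 := ih (g := g') (h := h') (List.IsChain.tail hg) (List.IsChain.tail hh) huh2
            (fun h => hug (List.cons_prefix_cons.2 ⟨rfl, h⟩))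
          have h2 : ((FreeGroup.mk (a :: g'))⁻¹ * FreeGroup.mk (a :: h')) =
              (FreeGroup.mk g')⁻¹ * FreeGroup.mk h' := by
            have e1 : ∀ l, FreeGroup.mk (a :: l) = FreeGroup.mk [a] * FreeGroup.mk l := by
              intro l; simp [FreeGroup.mul_mk]
            rw [e1 g', e1 h']
            group
          rw [h2]
          simp only [List.length_cons]
          omega
        · have hinv : FreeGroup.IsReduced (FreeGroup.invRev (b :: g')) := by
            rw [FreeGroup.isReduced_iff_reduce_eq, FreeGroup.reduce_invRev, hg.reduce_eq]
          have hr : FreeGroup.IsReduced (FreeGroup.invRev (b :: g') ++ a :: h') := by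
            unfold FreeGroup.IsReduced
            rw [List.isChain_append]
            refine ⟨hinv, hh, ?_⟩
            intro x hx y hy hxy
            simp [FreeGroup.invRev] at hx hy
            subst hx hy
            by_contra hne
            refine hab (Prod.ext hxy.symm ?_)
            revert hne
            simp only
            cases a.2 <;> cases b.2 <;> simp
          rw [FreeGroup.inv_mk, FreeGroup.mul_mk, FreeGroup.norm, FreeGroup.toWord_mk, hr.reduce_eq]
          simp
          omega

theorem finite_setOf_norm_le (n : ℕ) : {g : FreeGroup (Fin N) | g.norm ≤ n}.Finite := by
  refine Set.Finite.of_finite_image (f := FreeGroup.toWord)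
    ((List.finite_length_le (Fin N × Bool) n).subset ?_) FreeGroup.toWord_injective.injOn
  rintro _ ⟨g, hg, rfl⟩
  exact hg

namespace Boundary

@[simp] theorem length_prefixWord (ξ : Boundary N) (n : ℕ) : (ξ.prefixWord n).length = n := by
  simp [prefixWord]

theorem prefixWord_isReduced (ξ : Boundary N) (n : ℕ) : FreeGroup.IsReduced (ξ.prefixWord n) := by
  unfold FreeGroup.IsReduced
  rw [List.isChain_iff_getElem]
  intro i hi
  simp only [prefixWord, List.getElem_ofFn]
  intro h
  have := ξ.reduced i
  by_contra hne
  refine this (Prod.ext h.symm ?_)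
  revert hne
  simp only
  cases (ξ.word i).2 <;> cases (ξ.word (i + 1)).2 <;> simp

theorem toWord_mk_prefixWord (ξ : Boundary N) (n : ℕ) :
    (FreeGroup.mk (ξ.prefixWord n)).toWord = ξ.prefixWord n := by
  rw [FreeGroup.toWord_mk, (ξ.prefixWord_isReduced n).reduce_eq]

theorem prefixWord_eq_take (ξ : Boundary N) {m n : ℕ} (h : m ≤ n) :
    ξ.prefixWord m = (ξ.prefixWord n).take m := by
  apply List.ext_getElem
  · simp [h]
  · intro i h1 h2
    simp [prefixWord]

theorem prefixWord_prefix (ξ : Boundary N) {m n : ℕ} (h : m ≤ n) :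
    ξ.prefixWord m <+: ξ.prefixWord n := by
  rw [prefixWord_eq_take ξ h]
  exact List.take_prefix _ _

theorem eq_prefixWord_of_prefix (ξ : Boundary N) {l : List (Fin N × Bool)} {n : ℕ}
    (h : l <+: ξ.prefixWord n) : l = ξ.prefixWord l.length := by
  have hl : l.length ≤ n := by simpa using h.length_le
  rw [prefixWord_eq_take ξ hl]
  exact List.prefix_iff_eq_take.1 h

theorem word_eq_of_prefixWord_eq {ξ η : Boundary N} {n : ℕ} (h : ξ.prefixWord n = η.prefixWord n)
    {i : ℕ} (hi : i < n) : ξ.word i = η.word i := by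
  have := List.ofFn_injective h
  exact congrFun this ⟨i, hi⟩

end Boundary

end Words

/-! ### The boundary of the free group and the ends of the universal cover -/

section Ends

variable {N : ℕ} {Γ : SerreGraph.{u}} {p : Γ.V} (α : FreeGroup (Fin N) ≃* Γ.Pi1 p)

/-- The orbit point of the prefix of length `n` of a boundary point. -/
def prefixPoint (ξ : Boundary N) (n : ℕ) : (Γ.cover p).V :=
  orbitPoint α (FreeGroup.mk (ξ.prefixWord n))

/-- The edge `e` points toward the boundary point `ξ`. -/
def Toward (e : (Γ.cover p).E) (ξ : Boundary N) : Prop :=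
  ∀ᶠ n in Filter.atTop, CSide e (prefixPoint α ξ n)

theorem exists_step_bound : ∃ B : ℕ, ∀ (g : FreeGroup (Fin N)) (a : Fin N × Bool),
    cdist (orbitPoint α g) (orbitPoint α (g * FreeGroup.mk [a])) ≤ B := by
  obtain ⟨B, hB⟩ := Finite.exists_le
    (fun a : Fin N × Bool => cdist (orbitPoint α 1) (orbitPoint α (FreeGroup.mk [a])))
  refine ⟨B, fun g a => ?_⟩
  rw [cdist_orbitPoint, inv_mul_cancel_left]
  exact hB a

theorem mk_append_singleton (L : List (Fin N × Bool)) (a : Fin N × Bool) :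
    FreeGroup.mk (L ++ [a]) = FreeGroup.mk L * FreeGroup.mk [a] := (FreeGroup.mul_mk).symm

variable {α} in
-- Reading a word letter by letter moves the orbit point by jumps of length at most `B`, so the jump
-- that first crosses `e` starts within `B` of its origin.
theorem exists_prefix_near {B : ℕ} (hB : ∀ (g : FreeGroup (Fin N)) (a : Fin N × Bool),
    cdist (orbitPoint α g) (orbitPoint α (g * FreeGroup.mk [a])) ≤ B) {e : (Γ.cover p).E}
    (h1 : ¬ CSide e (orbitPoint α 1)) (L : List (Fin N × Bool)) :
    CSide e (orbitPoint α (FreeGroup.mk L)) →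
    ∃ L₁, L₁ <+: L ∧ cdist (orbitPoint α (FreeGroup.mk L₁)) ((Γ.cover p).o e) ≤ B := by
  induction L using List.reverseRecOn with
  | nil => intro h; exact absurd h h1
  | append_singleton L a ih =>
    intro h
    by_cases h2 : CSide e (orbitPoint α (FreeGroup.mk L))
    · obtain ⟨L₁, h3, h4⟩ := ih h2
      exact ⟨L₁, h3.trans (List.prefix_append _ _), h4⟩
    · refine ⟨L, List.prefix_append _ _, ?_⟩
      have h3 := hB (FreeGroup.mk L) a
      rw [← mk_append_singleton] at h3
      have h4 := dist_of_crossing h2 h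
      unfold cdist at *
      omega

theorem exists_norm_bound [Finite Γ.E] (x : (Γ.cover p).V) (r : ℕ) :
    ∃ n, ∀ g : FreeGroup (Fin N), n ≤ g.norm → r < cdist x (orbitPoint α g) := by
  obtain ⟨n, hn⟩ := ((finite_setOf_cdist_orbitPoint_le α x r).image FreeGroup.norm).bddAbove
  refine ⟨n + 1, fun g hg => ?_⟩
  by_contra h
  have := hn ⟨g, not_lt.1 h, rfl⟩
  omega

/-- The orbit map is proper, so beyond some word length the orbit points are farther from `x` than
one letter can move them; by `side_congr` further letters no longer change the side of an edge at
`x`. -/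
theorem exists_stable_length [Finite Γ.E] (x : (Γ.cover p).V) : ∃ n₀,
    (∀ g : FreeGroup (Fin N), n₀ ≤ g.norm → x ≠ orbitPoint α g) ∧
    ∀ e, (Γ.cover p).o e = x → ∀ L v : List (Fin N × Bool), n₀ ≤ L.length →
      FreeGroup.IsReduced (L ++ v) →
      (CSide e (orbitPoint α (FreeGroup.mk (L ++ v))) ↔ CSide e (orbitPoint α (FreeGroup.mk L))) := by
  obtain ⟨B, hB⟩ := exists_step_bound α
  obtain ⟨n₀, hn⟩ := exists_norm_bound α x B
  refine ⟨n₀, ?_, ?_⟩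
  · rintro g hg rfl
    have := hn g hg
    simp [cdist, SerreGraph.dist] at this
  · intro e he L v hL
    induction v using List.reverseRecOn with
    | nil => intro _; simp
    | append_singleton v a ih =>
      intro hr
      rw [← List.append_assoc] at hr
      have hr' : FreeGroup.IsReduced (L ++ v) := List.IsChain.left_of_append hr
      rw [← ih hr', ← List.append_assoc, mk_append_singleton]
      refine (side_congr ?_).symm
      rw [he]
      refine lt_of_le_of_lt (hB _ a) (hn _ ?_)
      rw [FreeGroup.norm, FreeGroup.toWord_mk, hr'.reduce_eq]
      simp; omega

theorem exists_stable_prefix [Finite Γ.E] (x : (Γ.cover p).V) : ∃ n₀,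
    (∀ ξ : Boundary N, x ≠ prefixPoint α ξ n₀) ∧
    ∀ e, (Γ.cover p).o e = x → ∀ (ξ : Boundary N) (m : ℕ), n₀ ≤ m →
      (CSide e (prefixPoint α ξ m) ↔ CSide e (prefixPoint α ξ n₀)) := by
  obtain ⟨n₀, h1, h2⟩ := exists_stable_length α x
  refine ⟨n₀, fun ξ => h1 _ ?_, fun e he ξ m hm => ?_⟩
  · rw [FreeGroup.norm, ξ.toWord_mk_prefixWord, ξ.length_prefixWord]
  · obtain ⟨v, hv⟩ := ξ.prefixWord_prefix hm
    unfold prefixPoint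
    rw [← hv]
    refine h2 e he _ v (by simp) ?_
    rw [hv]
    exact ξ.prefixWord_isReduced m

variable {α}

theorem toward_iff_of_stable {e : (Γ.cover p).E} {n₀ : ℕ} {ξ : Boundary N}
    (h : ∀ m, n₀ ≤ m → (CSide e (prefixPoint α ξ m) ↔ CSide e (prefixPoint α ξ n₀))) :
    Toward α e ξ ↔ CSide e (prefixPoint α ξ n₀) := by
  constructor
  · intro h1
    obtain ⟨m, hm, hm'⟩ := (h1.and (Filter.eventually_ge_atTop n₀)).exists
    exact (h m hm').1 hm
  · intro h1
    filter_upwards [Filter.eventually_ge_atTop n₀] with m hm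
    exact (h m hm).2 h1

theorem toward_inv [Finite Γ.E] {e : (Γ.cover p).E} {ξ : Boundary N} :
    Toward α ((Γ.cover p).inv e) ξ ↔ ¬ Toward α e ξ := by
  obtain ⟨n₀, -, h⟩ := exists_stable_prefix α ((Γ.cover p).o e)
  rw [toward_iff_of_stable (h e rfl ξ), toward_iff_of_stable (n₀ := n₀)]
  · exact side_inv
  · intro m hm
    rw [CSide, CSide, side_inv, side_inv, not_iff_not]
    exact h e rfl ξ m hm

theorem Toward.unique {e f : (Γ.cover p).E} {ξ : Boundary N} (he : Toward α e ξ)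
    (hf : Toward α f ξ) (h : (Γ.cover p).o e = (Γ.cover p).o f) : e = f := by
  obtain ⟨m, h1, h2⟩ := (he.and hf).exists
  exact side_unique h h1 h2

theorem Toward.of_toward {e f : (Γ.cover p).E} {ξ : Boundary N} (hf : Toward α f ξ)
    (h : (Γ.cover p).o f = (Γ.cover p).t e) (hne : f ≠ (Γ.cover p).inv e) : Toward α e ξ :=
  hf.mono fun _ h' => side_of_side h hne h'

variable (α) in
theorem exists_toward [Finite Γ.E] (x : (Γ.cover p).V) (ξ : Boundary N) :
    ∃ e, (Γ.cover p).o e = x ∧ Toward α e ξ := by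
  obtain ⟨n₀, h1, h⟩ := exists_stable_prefix α x
  obtain ⟨e, he, he'⟩ := exists_side (hG := cover_isTree p) (h1 ξ)
  exact ⟨e, he, (toward_iff_of_stable (h e he ξ)).2 he'⟩

theorem prefix_geo_of_side (m : ℕ) : ∀ (ρ : ℕ → (Γ.cover p).E) (z : (Γ.cover p).V),
    (∀ n, (Γ.cover p).o (ρ (n + 1)) = (Γ.cover p).t (ρ n)) → (∀ i < m, CSide (ρ i) z) →
    List.ofFn (fun i : Fin m => ρ i) <+: cgeo ((Γ.cover p).o (ρ 0)) z := by
  induction m with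
  | zero => intro ρ z _ _; simp
  | succ m ih =>
    intro ρ z h1 h2
    rw [List.ofFn_succ, cgeo, (h2 0 (by omega)).geo_eq]
    refine List.cons_prefix_cons.2 ⟨rfl, ?_⟩
    rw [← h1 0]
    exact ih (fun n => ρ (n + 1)) z (fun n => h1 (n + 1)) (fun i hi => h2 (i + 1) (by omega))

/-- This trades rays for the sides of prefix points. A ray is recovered by always following the edge
toward `ξ`; it cannot backtrack since `e` and `e⁻¹` never both point toward `ξ`. -/
theorem mem_cyl_iff [Finite Γ.E] {e : (Γ.cover p).E} {ξ : Boundary N} :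
    ξ ∈ cyl α e ↔ Toward α e ξ := by
  constructor
  · rintro ⟨ρ, rfl, -, -, h⟩
    refine (h 1).mono ?_
    rintro n ⟨l, h1, h2, h3⟩
    obtain ⟨v, rfl⟩ := h3
    exact ⟨v, geo_eq _ h1 h2⟩
  · intro h
    choose next hn1 hn2 using fun x => exists_toward α x ξ
    let ρ : ℕ → (Γ.cover p).E := fun n => Nat.rec e (fun _ a => next ((Γ.cover p).t a)) n
    have ht : ∀ n, Toward α (ρ n) ξ := by
      intro n
      cases n with
      | zero => exact h
      | succ n => exact hn2 _
    have ho : ∀ n, (Γ.cover p).o (ρ (n + 1)) = (Γ.cover p).t (ρ n) := fun n => hn1 _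
    refine ⟨ρ, rfl, ho, fun n hn => ?_, fun m => ?_⟩
    · have := ht (n + 1)
      rw [hn, toward_inv] at this
      exact this (ht n)
    · have : ∀ᶠ n in Filter.atTop, ∀ i ∈ Finset.range m, CSide (ρ i) (prefixPoint α ξ n) :=
        (Filter.eventually_all_finset _).2 fun i _ => ht i
      refine this.mono fun n hn => ⟨_, geo_isPath (cover_isTree p) _ _, geo_isReduced _ _ _, ?_⟩
      exact prefix_geo_of_side m ρ _ ho fun i hi => hn i (Finset.mem_range.2 hi)

theorem exists_far_toward [Finite Γ.E] (ξ : Boundary N) (k : ℕ) : ∃ e, Toward α e ξ ∧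
    ¬ CSide e (orbitPoint α 1) ∧ cdist (orbitPoint α 1) ((Γ.cover p).o e) = k := by
  induction k with
  | zero =>
    obtain ⟨e, he, h⟩ := exists_toward α (orbitPoint α 1) ξ
    refine ⟨e, h, ?_, ?_⟩
    · rw [← he]; exact not_side_o e
    · rw [he]; exact (dist_eq_zero _).2 rfl
  | succ k ih =>
    obtain ⟨e, h1, h2, h3⟩ := ih
    obtain ⟨f, hf, h⟩ := exists_toward α ((Γ.cover p).t e) ξ
    have hne : f ≠ (Γ.cover p).inv e := by
      rintro rfl
      exact toward_inv.1 h h1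
    refine ⟨f, h, fun h' => h2 (side_of_side hf hne h'), ?_⟩
    have := (not_side_iff.1 h2).dist_eq
    rw [o_inv, t_inv, dist_comm, dist_comm _ ((Γ.cover p).o e)] at this
    rw [hf]
    unfold cdist at *
    omega

/-- Words crossing the same distant edge have prefixes whose orbit points are close together, hence
prefixes that differ by a short element; such prefixes, being long, must share their first `n`
letters. -/
theorem exists_toward_prefix [Finite Γ.E] (ξ : Boundary N) (n : ℕ) : ∃ e, Toward α e ξ ∧
    ∀ g, CSide e (orbitPoint α g) → ξ.prefixWord n <+: g.toWord := by
  obtain ⟨B, hB⟩ := exists_step_bound α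
  -- Two orbit points within `B` of the origin of `e` are at distance at most `2B`, so their group
  -- elements differ by an element of norm at most `L`. The bound `M` is chosen so that a prefix
  -- near an edge at distance `M + B + 1` must be longer than `n + L`.
  obtain ⟨L, hL⟩ := ((finite_setOf_cdist_orbitPoint_le α (orbitPoint α 1) (B + B)).image
    FreeGroup.norm).bddAbove
  obtain ⟨M, hM⟩ := ((finite_setOf_norm_le (N := N) (n + L)).image
    (fun g => cdist (orbitPoint α 1) (orbitPoint α g))).bddAbove
  obtain ⟨e, h1, h2, h3⟩ := exists_far_toward (α := α) ξ (M + B + 1)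
  refine ⟨e, h1, fun g hg => ?_⟩
  by_contra hng
  obtain ⟨m, hm⟩ := h1.exists
  obtain ⟨P, hP, hP'⟩ := exists_prefix_near hB h2 _ hm
  rw [← FreeGroup.mk_toWord (x := g)] at hg
  obtain ⟨Q, hQ, hQ'⟩ := exists_prefix_near hB h2 _ hg
  have hPr : FreeGroup.IsReduced P := (ξ.prefixWord_isReduced m).infix hP.isInfix
  have hQr : FreeGroup.IsReduced Q := FreeGroup.isReduced_toWord.infix hQ.isInfix
  have hPn : n + L < P.length := by
    by_contra hle
    have h4 : cdist (orbitPoint α 1) (orbitPoint α (FreeGroup.mk P)) ≤ M :=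
      hM ⟨FreeGroup.mk P, by
        change FreeGroup.norm _ ≤ _
        rw [FreeGroup.norm, FreeGroup.toWord_mk, hPr.reduce_eq]; omega, rfl⟩
    have h5 := dist_triangle (cover_isTree p) (orbitPoint α 1) (orbitPoint α (FreeGroup.mk P))
      ((Γ.cover p).o e)
    unfold cdist at *
    omega
  have hpre : ξ.prefixWord n <+: P := by
    rw [ξ.eq_prefixWord_of_prefix hP]
    exact ξ.prefixWord_prefix (by omega)
  have hnQ : ¬ ξ.prefixWord n <+: Q := fun h => hng (h.trans hQ)
  have h6 := length_le_norm_add hQr hPr hpre hnQ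
  rw [Boundary.length_prefixWord] at h6
  have h7 : ((FreeGroup.mk Q)⁻¹ * FreeGroup.mk P).norm ≤ L := by
    refine hL ⟨_, ?_, rfl⟩
    change cdist _ _ ≤ _
    rw [← cdist_orbitPoint]
    have h8 := dist_triangle (cover_isTree p) (orbitPoint α (FreeGroup.mk Q)) ((Γ.cover p).o e)
      (orbitPoint α (FreeGroup.mk P))
    rw [dist_comm _ ((Γ.cover p).o e)] at h8
    unfold cdist at *
    omega
  omega

/-- Cylinders of edges form a basis: a basic open set fixes finitely many letters, and a far edge
toward `ξ` fixes a longer prefix. -/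
theorem exists_cyl_subset [Finite Γ.E] {U : Set (Boundary N)} (hU : IsOpen U) {ξ : Boundary N}
    (hξ : ξ ∈ U) : ∃ e, ξ ∈ cyl α e ∧ cyl α e ⊆ U := by
  obtain ⟨V, hV, rfl⟩ := Boundary.isInducing_word.isOpen_iff.1 hU
  obtain ⟨I, u, hu1, hu2⟩ := isOpen_pi_iff.1 hV _ hξ
  obtain ⟨n, hn⟩ := I.bddAbove
  obtain ⟨e, h1, h2⟩ := exists_toward_prefix (α := α) ξ (n + 1)
  refine ⟨e, mem_cyl_iff.2 h1, fun η hη => hu2 fun i hi => ?_⟩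
  obtain ⟨m, hm, hm'⟩ := ((mem_cyl_iff.1 hη).and (Filter.eventually_ge_atTop (n + 1))).exists
  have h3 := h2 _ hm
  rw [η.toWord_mk_prefixWord] at h3
  have h4 := η.eq_prefixWord_of_prefix h3
  rw [Boundary.length_prefixWord] at h4
  have := Boundary.word_eq_of_prefixWord_eq h4 (Nat.lt_succ_of_le (hn hi))
  rw [← this]
  exact (hu1 i hi).2

theorem cyl_inv [Finite Γ.E] (e : (Γ.cover p).E) :
    cyl α ((Γ.cover p).inv e) = (cyl α e)ᶜ := by
  ext ξ
  rw [Set.mem_compl_iff, mem_cyl_iff, mem_cyl_iff, toward_inv]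

theorem isClopen_cyl [Finite Γ.E] (e : (Γ.cover p).E) : IsClopen (cyl α e) := by
  obtain ⟨n₀, -, h⟩ := exists_stable_prefix α ((Γ.cover p).o e)
  have : cyl α e = (fun (ξ : Boundary N) (i : Fin n₀) => ξ.word i) ⁻¹'
      {w | CSide e (orbitPoint α (FreeGroup.mk (List.ofFn w)))} := by
    ext ξ
    rw [mem_cyl_iff, toward_iff_of_stable (h e rfl ξ)]
    rfl
  rw [this]
  exact (isClopen_discrete _).preimage (continuous_pi fun i => Boundary.continuous_coord i)

theorem cyl_subset_cyl [Finite Γ.E] {e f : (Γ.cover p).E} (h : (Γ.cover p).o f = (Γ.cover p).t e)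
    (hne : f ≠ (Γ.cover p).inv e) : cyl α f ⊆ cyl α e := fun _ hξ =>
  mem_cyl_iff.2 ((mem_cyl_iff.1 hξ).of_toward h hne)

theorem eventually_succ {P : ℕ → Prop} :
    (∀ᶠ n in Filter.atTop, P (n + 1)) ↔ ∀ᶠ n in Filter.atTop, P n := by
  conv_rhs => rw [← Filter.map_add_atTop_eq_nat 1]
  exact Iff.rfl

/-- The prefixes of `aξ` are `a` times the prefixes of `ξ`, with the length shifted by one up or
down according to cancellation; a shift is invisible to eventual statements. -/
theorem toward_letterMul (a : Fin N × Bool) (e : (Γ.cover p).E) (ξ : Boundary N) :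
    Toward α (actE α (FreeGroup.mk [a]) e) (Boundary.letterMul a ξ) ↔ Toward α e ξ := by
  have hpre : ∀ (η : Boundary N) (n : ℕ), η.prefixWord (n + 1) =
      η.word 0 :: List.ofFn (fun i : Fin n => η.word (i + 1)) := by
    intro η n
    simp [Boundary.prefixWord, List.ofFn_succ]
  have hcons : ∀ (b : Fin N × Bool) (l : List (Fin N × Bool)),
      FreeGroup.mk (b :: l) = FreeGroup.mk [b] * FreeGroup.mk l := by
    intro b l; simp [FreeGroup.mul_mk]
  by_cases h : ξ.word 0 = (a.1, !a.2)
  · have key : ∀ n, prefixPoint α (Boundary.letterMul a ξ) n =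
        actV α (FreeGroup.mk [a]) (prefixPoint α ξ (n + 1)) := by
      intro n
      unfold prefixPoint
      rw [actV_orbitPoint]
      congr 1
      have h1 : Boundary.prefixWord (Boundary.letterMul a ξ) n =
          List.ofFn (fun i : Fin n => ξ.word (i + 1)) := by
        simp [Boundary.prefixWord, Boundary.letterMul, h]
      rw [hpre ξ n, hcons (ξ.word 0), ← mul_assoc, h1, h]
      have : FreeGroup.mk [a] * FreeGroup.mk [(a.1, !a.2)] = 1 := by
        rw [FreeGroup.mul_mk]
        have := FreeGroup.inv_mk (L := [a])
        have h2 : FreeGroup.mk [(a.1, !a.2)] = (FreeGroup.mk [a])⁻¹ := by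
          rw [this]; simp [FreeGroup.invRev]
        rw [← FreeGroup.mul_mk, h2, mul_inv_cancel]
      rw [this, one_mul]
    unfold Toward
    simp only [key, cside_act_iff]
    exact eventually_succ (P := fun n => CSide e (prefixPoint α ξ n))
  · have key : ∀ n, prefixPoint α (Boundary.letterMul a ξ) (n + 1) =
        actV α (FreeGroup.mk [a]) (prefixPoint α ξ n) := by
      intro n
      unfold prefixPoint
      rw [actV_orbitPoint]
      congr 1
      rw [hpre, hcons]
      simp [Boundary.prefixWord, Boundary.letterMul, h]
    unfold Toward
    rw [← eventually_succ]
    simp only [key, cside_act_iff]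

theorem toward_act (g : FreeGroup (Fin N)) : ∀ (e : (Γ.cover p).E) (ξ : Boundary N),
    Toward α (actE α g e) (Boundary.act N g ξ) ↔ Toward α e ξ := by
  induction g using FreeGroup.induction_on with
  | C1 => intro e ξ; rw [actE_one, map_one]; rfl
  | of i =>
    intro e ξ
    have : Boundary.act N (FreeGroup.of i) ξ = Boundary.letterMul (i, true) ξ := by
      rw [Boundary.act, FreeGroup.lift_apply_of]; rfl
    have h2 := toward_letterMul (α := α) (i, true) e ξ
    rw [← this] at h2
    exact h2
  | inv_of i _ =>
    intro e ξ
    have : Boundary.act N (FreeGroup.of i)⁻¹ ξ = Boundary.letterMul (i, false) ξ := by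
      rw [map_inv, Boundary.act, FreeGroup.lift_apply_of]; rfl
    have h2 := toward_letterMul (α := α) (i, false) e ξ
    rw [← this] at h2
    exact h2
  | mul g h hg hh =>
    intro e ξ
    rw [actE_mul, map_mul]
    exact (hg _ _).trans (hh _ _)

theorem act_mem_cyl [Finite Γ.E] (g : FreeGroup (Fin N)) (e : (Γ.cover p).E) (ξ : Boundary N) :
    Boundary.act N g ξ ∈ cyl α (actE α g e) ↔ ξ ∈ cyl α e := by
  rw [mem_cyl_iff, mem_cyl_iff, toward_act]

end Ends

/-! ### Sides of edges and finite subtrees of a tree -/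

namespace SerreGraph

variable {G : SerreGraph.{u}} {hG : G.IsTree}

theorem mem_geo {g : G.E} {x y : G.V} (h : g ∈ geo hG x y) :
    Side hG g y ∧ ¬ Side hG g x ∧ dist hG x (G.o g) ≤ dist hG x y ∧
      dist hG x (G.t g) ≤ dist hG x y := by
  obtain ⟨s, t, hst⟩ := List.append_of_mem h
  have h1 := geo_isPath hG x y
  have h2 := geo_isReduced hG x y
  have hlen : dist hG x y = s.length + (t.length + 1) := by
    rw [dist, hst]; simp
  rw [hst] at h1 h2
  obtain ⟨b, hb1, hb2, hb3⟩ := isPath_append_iff.1 h1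
  subst hb2
  have h3 : G.IsReduced (g :: t) := List.IsChain.right_of_append h2
  have h4 : G.IsReduced (s ++ [g]) := by
    have : s ++ g :: t = (s ++ [g]) ++ t := by simp
    rw [this] at h2
    exact List.IsChain.left_of_append h2
  have h5 : G.IsPath x (s ++ [g]) (G.t g) := hb1.append ⟨rfl, rfl⟩
  refine ⟨side_of_path hb3 h3, ?_, ?_, ?_⟩
  · rw [not_side_iff]
    have h6 := h4.reverse
    rw [List.reverse_append] at h6
    refine side_of_path (l := s.reverse.map G.inv) ?_ h6
    rw [t_inv]
    exact hb1.reverse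
  · have := dist_le_length hG hb1
    omega
  · have := dist_le_length hG h5
    simp at this
    omega

theorem geo_o_t (f : G.E) : geo hG (G.o f) (G.t f) = [f] :=
  geo_eq hG ⟨rfl, rfl⟩ (List.isChain_singleton _)

theorem side_t_of_side_o {g f : G.E} (h : Side hG g (G.o f)) (h' : ¬ Side hG f (G.o g)) :
    Side hG g (G.t f) := by
  obtain ⟨l, hl⟩ := h
  have := geo_of_crossing h' (side_t f)
  rw [hl] at this
  exact ⟨_, this⟩

theorem side_trans {g f : G.E} {z : G.V} (h : Side hG g (G.t f)) (h' : ¬ Side hG f (G.o g))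
    (hz : Side hG f z) : Side hG g z := by
  obtain ⟨l, hl⟩ := h
  have h1 := geo_of_crossing h' (side_t f)
  have h2 := geo_of_crossing h' hz
  rw [geo_o_t] at h1
  rw [hz.geo_eq, List.append_cons, ← h1, hl] at h2
  exact ⟨_, h2⟩

theorem dist_t_of_not_side {f : G.E} {x : G.V} (h : ¬ Side hG f x) :
    dist hG x (G.t f) = dist hG x (G.o f) + 1 := by
  have := (not_side_iff.1 h).dist_eq
  rwa [t_inv, o_inv, dist_comm, dist_comm _ (G.o f)] at this

/-- The inclusion of the edges of a subgraph. -/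
def Subgraph.valE {K : G.Subgraph} (e : K.coe.E) : G.E := Subtype.val (p := (· ∈ K.edges)) e

/-- The inclusion of the vertices of a subgraph. -/
def Subgraph.valV {K : G.Subgraph} (x : K.coe.V) : G.V := Subtype.val (p := (· ∈ K.verts)) x

theorem Subgraph.valE_mem {K : G.Subgraph} (e : K.coe.E) : Subgraph.valE e ∈ K.edges :=
  Subtype.property (p := (· ∈ K.edges)) e

theorem Subgraph.valV_mem {K : G.Subgraph} (x : K.coe.V) : Subgraph.valV x ∈ K.verts :=
  Subtype.property (p := (· ∈ K.verts)) x

theorem Subgraph.valE_injective {K : G.Subgraph} :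
    Function.Injective (Subgraph.valE : K.coe.E → G.E) := fun _ _ h => Subtype.ext h

/-- An edge of a subgraph as an edge of the graph `K.coe`. -/
def Subgraph.mkE {K : G.Subgraph} {e : G.E} (he : e ∈ K.edges) : K.coe.E :=
  (⟨e, he⟩ : {e // e ∈ K.edges})

/-- A vertex of a subgraph as a vertex of the graph `K.coe`. -/
def Subgraph.mkV {K : G.Subgraph} {x : G.V} (hx : x ∈ K.verts) : K.coe.V :=
  (⟨x, hx⟩ : {x // x ∈ K.verts})

theorem Subgraph.coe_isPath_val {K : G.Subgraph} : ∀ {l : List K.coe.E} {a b : K.coe.V},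
    K.coe.IsPath a l b → G.IsPath (valV a) (l.map valE) (valV b)
  | [], _, _, h => congrArg valV h
  | _ :: _, _, _, h => ⟨congrArg valV h.1, coe_isPath_val h.2⟩

theorem Subgraph.geo_subset {K : G.Subgraph} (hK : K.coe.Connected) {x y : G.V}
    (hx : x ∈ K.verts) (hy : y ∈ K.verts) {g : G.E} (hg : g ∈ geo hG x y) : g ∈ K.edges := by
  obtain ⟨l, hl⟩ := hK.2 (mkV hx) (mkV hy)
  obtain ⟨l', h1, h2, -⟩ := exists_isReduced l _ _ hl
  have h3 : G.IsReduced (l'.map valE) := by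
    unfold SerreGraph.IsReduced at *
    rw [List.isChain_map]
    exact h2.imp fun a b hab h => hab (valE_injective h)
  have h4 : G.IsPath x (l'.map valE) y := coe_isPath_val h1
  rw [geo_eq hG h4 h3] at hg
  obtain ⟨e, -, rfl⟩ := List.mem_map.1 hg
  exact valE_mem e

theorem Subgraph.t_mem {K : G.Subgraph} {e : G.E} (he : e ∈ K.edges) : G.t e ∈ K.verts :=
  K.o_mem _ (K.inv_mem e he)

theorem Subgraph.exists_continuation {K : G.Subgraph} {e : G.E} (he : e ∈ K.edges)
    (h : e ∉ K.terminalEdges) : ∃ f ∈ K.edges, G.o f = G.t e ∧ f ≠ G.inv e := by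
  by_contra! h'
  exact h ⟨he, h'⟩

/-- Walking on through edges satisfying `P` must stop, since `K` is finite. The end of the walk is
found as an edge with `P` pointing away from the start and with its terminal vertex at maximal
distance. -/
theorem Subgraph.exists_terminalEdge (hG : G.IsTree) {K : G.Subgraph} (hK : K.IsFiniteSubtree)
    (P : G.E → Prop)
    (hP : ∀ g ∈ K.edges, P g → g ∉ K.terminalEdges → ∃ f ∈ K.edges, G.o f = G.t g ∧
      f ≠ G.inv g ∧ P f) {e : G.E} (he : e ∈ K.edges) (h : P e) : ∃ g ∈ K.terminalEdges, P g := by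
  let A := {g | g ∈ K.edges ∧ P g ∧ ¬ Side hG g (G.o e)}
  have hA : A.Finite := hK.finite_edges.subset fun g hg => hg.1
  obtain ⟨g, ⟨hg1, hg2, hg3⟩, hg⟩ := Set.exists_max_image A (fun g => dist hG (G.o e) (G.t g)) hA
    ⟨e, he, h, not_side_o e⟩
  by_cases ht : g ∈ K.terminalEdges
  · exact ⟨g, ht, hg2⟩
  · obtain ⟨f, hf1, hf2, hf3, hf4⟩ := hP g hg1 hg2 ht
    have hf5 : ¬ Side hG f (G.o e) := fun h' => hg3 (side_of_side hf2 hf3 h')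
    have h1 : dist hG (G.o e) (G.t f) ≤ dist hG (G.o e) (G.t g) := hg f ⟨hf1, hf4, hf5⟩
    have h2 := dist_t_of_not_side hf5
    rw [hf2] at h2
    omega

end SerreGraph

/-! ### Convex hulls -/

/-- The underlying set of boundary points. -/
abbrev BigClosed.pts {N : ℕ} (S : BigClosed N) : Set (Boundary N) := S.toCloseds

theorem BigClosed.ext_pts {N : ℕ} {S T : BigClosed N} (h : S.pts = T.pts) : S = T :=
  BigClosed.ext (TopologicalSpace.Closeds.ext h)

theorem BigClosed.mem_translate {N : ℕ} {g : FreeGroup (Fin N)} {S : BigClosed N} {ξ : Boundary N} :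
    Boundary.act N g ξ ∈ (BigClosed.translate g S).pts ↔ ξ ∈ S.pts :=
  (Boundary.act N g).injective.mem_set_image

section Hull

variable {N : ℕ} {Γ : SerreGraph.{u}} {p : Γ.V} (α : FreeGroup (Fin N) ≃* Γ.Pi1 p)

/-- Some point of `S` lies in the cylinder of `e`. -/
def Meets (S : BigClosed N) (e : (Γ.cover p).E) : Prop := (S.pts ∩ cyl α e).Nonempty

/-- The edges of the convex hull of `S` in the universal cover. -/
def hullE (S : BigClosed N) : Set (Γ.cover p).E :=
  {e | Meets α S e ∧ Meets α S ((Γ.cover p).inv e)}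

/-- The vertices of the convex hull of `S` in the universal cover. -/
def hullV (S : BigClosed N) : Set (Γ.cover p).V := {x | ∃ e ∈ hullE α S, (Γ.cover p).o e = x}

variable {α}

theorem inv_mem_hullE {S : BigClosed N} {e : (Γ.cover p).E} (h : e ∈ hullE α S) :
    (Γ.cover p).inv e ∈ hullE α S := by
  refine ⟨h.2, ?_⟩
  rw [SerreGraph.inv_inv]
  exact h.1

theorem o_mem_hullV {S : BigClosed N} {e : (Γ.cover p).E} (h : e ∈ hullE α S) :
    (Γ.cover p).o e ∈ hullV α S := ⟨e, h, rfl⟩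

theorem t_mem_hullV {S : BigClosed N} {e : (Γ.cover p).E} (h : e ∈ hullE α S) :
    (Γ.cover p).t e ∈ hullV α S := ⟨_, inv_mem_hullE h, rfl⟩

variable [Finite Γ.E]

theorem hullE_next {S : BigClosed N} {e f : (Γ.cover p).E} (he : e ∈ hullE α S)
    (h : (Γ.cover p).o f = (Γ.cover p).t e) (hne : f ≠ (Γ.cover p).inv e) (hf : Meets α S f) :
    f ∈ hullE α S := by
  refine ⟨hf, he.2.mono (Set.inter_subset_inter_right _ ?_)⟩
  refine cyl_subset_cyl (by rw [t_inv, o_inv, h]) ?_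
  rw [SerreGraph.inv_inv]
  exact hne.symm

theorem exists_hullE_next_of_mem {S : BigClosed N} {e : (Γ.cover p).E} (he : e ∈ hullE α S)
    {ξ : Boundary N} (hξ : ξ ∈ S.pts) (h : ξ ∈ cyl α e) : ∃ f ∈ hullE α S,
      (Γ.cover p).o f = (Γ.cover p).t e ∧ f ≠ (Γ.cover p).inv e ∧ ξ ∈ cyl α f := by
  obtain ⟨f, hf1, hf2⟩ := exists_toward α ((Γ.cover p).t e) ξ
  rw [← mem_cyl_iff] at hf2
  have hne : f ≠ (Γ.cover p).inv e := by
    rintro rfl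
    rw [cyl_inv] at hf2
    exact hf2 h
  exact ⟨f, hullE_next he hf1 hne ⟨ξ, hξ, hf2⟩, hf1, hne, hf2⟩

theorem exists_hullE_next {S : BigClosed N} {e : (Γ.cover p).E} (he : e ∈ hullE α S) :
    ∃ f ∈ hullE α S, (Γ.cover p).o f = (Γ.cover p).t e ∧ f ≠ (Γ.cover p).inv e := by
  obtain ⟨ξ, h1, h2⟩ := he.1
  obtain ⟨f, hf, h3, h4, -⟩ := exists_hullE_next_of_mem he h1 h2
  exact ⟨f, hf, h3, h4⟩

theorem exists_two_hullE {S : BigClosed N} {x : (Γ.cover p).V} (hx : x ∈ hullV α S) :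
    ∃ e ∈ hullE α S, ∃ f ∈ hullE α S, (Γ.cover p).o e = x ∧ (Γ.cover p).o f = x ∧ e ≠ f := by
  obtain ⟨e, he, rfl⟩ := hx
  obtain ⟨f, hf, h1, h2⟩ := exists_hullE_next (inv_mem_hullE he)
  rw [t_inv] at h1
  rw [SerreGraph.inv_inv] at h2
  exact ⟨e, he, f, hf, rfl, h1, h2.symm⟩

theorem cyl_subset_of_side {g f : (Γ.cover p).E} (h : CSide g ((Γ.cover p).t f))
    (h' : ¬ CSide f ((Γ.cover p).o g)) : cyl α f ⊆ cyl α g := fun _ hξ =>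
  mem_cyl_iff.2 ((mem_cyl_iff.1 hξ).mono fun _ hz => side_trans h h' hz)

/-- At least two hull edges issue from `y`, and at most one of them points back to the origin of
`g`; the cylinder of another one lies in that of `g` and meets `S`. -/
theorem meets_of_side {S : BigClosed N} {y : (Γ.cover p).V} (hy : y ∈ hullV α S)
    {g : (Γ.cover p).E} (hg : CSide g y) : Meets α S g := by
  obtain ⟨e, he, f, hf, h1, h2, hne⟩ := exists_two_hullE hy
  have key : ∀ f ∈ hullE α S, (Γ.cover p).o f = y → ¬ CSide f ((Γ.cover p).o g) →
      Meets α S g := by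
    rintro f hf rfl h
    exact hf.1.mono (Set.inter_subset_inter_right _
      (cyl_subset_of_side (side_t_of_side_o hg h) h))
  by_cases h : CSide e ((Γ.cover p).o g)
  · exact key f hf h2 fun h' => hne (side_unique (h1.trans h2.symm) h h')
  · exact key e he h1 h

theorem geo_subset_hullE {S : BigClosed N} {x y : (Γ.cover p).V} (hx : x ∈ hullV α S)
    (hy : y ∈ hullV α S) {g : (Γ.cover p).E} (hg : g ∈ cgeo x y) : g ∈ hullE α S := by
  obtain ⟨h1, h2, -⟩ := mem_geo hg
  exact ⟨meets_of_side hy h1, meets_of_side hx (not_side_iff.1 h2)⟩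

variable (α) in
-- A small cylinder about `ξ` avoids `S` and also a second point `η` of `T`; the latter puts its
-- edge into the hull of `T`.
theorem exists_mem_hullE_of_ne {S T : BigClosed N} {ξ : Boundary N} (hξ : ξ ∈ T.pts)
    (h : ξ ∉ S.pts) : ∃ e ∈ hullE α T, ¬ Meets α S e := by
  obtain ⟨η, hη, hne⟩ := T.nontrivial.exists_ne ξ
  have hU : IsOpen (S.ptsᶜ ∩ {η}ᶜ) := S.toCloseds.isClosed.isOpen_compl.inter isOpen_compl_singleton
  obtain ⟨e, h1, h2⟩ := exists_cyl_subset (α := α) hU (ξ := ξ) ⟨h, fun h' => hne h'.symm⟩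
  refine ⟨e, ⟨⟨ξ, hξ, h1⟩, ⟨η, hη, ?_⟩⟩, ?_⟩
  · rw [cyl_inv]
    intro h3
    exact (h2 h3).2 rfl
  · rintro ⟨ζ, h3, h4⟩
    exact (h2 h4).1 h3

variable (α) in
theorem hullE_injective {S T : BigClosed N} (h : hullE α S = hullE α T) : S = T := by
  refine BigClosed.ext_pts (Set.Subset.antisymm ?_ ?_) <;> intro ξ hξ <;> by_contra h'
  · obtain ⟨e, h1, h2⟩ := exists_mem_hullE_of_ne α hξ h'
    rw [h] at h1
    exact h2 h1.1
  · obtain ⟨e, h1, h2⟩ := exists_mem_hullE_of_ne α hξ h'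
    rw [← h] at h1
    exact h2 h1.1

variable (α) in
theorem hullE_nonempty (S : BigClosed N) : (hullE α S).Nonempty := by
  obtain ⟨ξ, hξ, η, hη, hne⟩ := S.nontrivial
  obtain ⟨e, h1, h2⟩ := exists_cyl_subset (α := α) (U := {η}ᶜ) isOpen_compl_singleton (ξ := ξ) hne
  refine ⟨e, ⟨ξ, hξ, h1⟩, ⟨η, hη, ?_⟩⟩
  rw [cyl_inv]
  intro h3
  exact h2 h3 rfl

theorem meets_translate {g : FreeGroup (Fin N)} {S : BigClosed N} {e : (Γ.cover p).E} :
    Meets α (BigClosed.translate g S) (actE α g e) ↔ Meets α S e := by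
  constructor
  · rintro ⟨η, h1, h2⟩
    obtain ⟨ξ, rfl⟩ := (Boundary.act N g).surjective η
    exact ⟨ξ, BigClosed.mem_translate.1 h1, (act_mem_cyl g e ξ).1 h2⟩
  · rintro ⟨ξ, h1, h2⟩
    exact ⟨_, BigClosed.mem_translate.2 h1, (act_mem_cyl g e ξ).2 h2⟩

theorem hullE_translate {g : FreeGroup (Fin N)} {S : BigClosed N} {e : (Γ.cover p).E} :
    actE α g e ∈ hullE α (BigClosed.translate g S) ↔ e ∈ hullE α S := by
  unfold hullE
  simp only [Set.mem_ofPred_eq, ← actE_inv, meets_translate]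

theorem hullV_translate {g : FreeGroup (Fin N)} {S : BigClosed N} {x : (Γ.cover p).V} :
    actV α g x ∈ hullV α (BigClosed.translate g S) ↔ x ∈ hullV α S := by
  constructor
  · rintro ⟨e, he, h⟩
    refine ⟨actE α g⁻¹ e, ?_, ?_⟩
    · rw [← hullE_translate (g := g), actE_actE_inv]
      exact he
    · rw [o_actE, h, actV_inv_actV]
  · rintro ⟨e, he, rfl⟩
    exact ⟨actE α g e, hullE_translate.2 he, rfl⟩

/-- The terminal vertices of non-terminal edges are the interior vertices of `K`. If the hull
branches there only along `K`, the path toward a point of `S` can leave `K` only through a terminal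
edge; conversely an extra branch would carry a point of `S` outside all terminal cylinders. -/
theorem mem_subsetCyl_iff {K : (Γ.cover p).Subgraph} (hK : K.IsFiniteSubtree) {S : BigClosed N} :
    S ∈ subsetCyl α K ↔ K.edges ⊆ hullE α S ∧ ∀ e ∈ K.edges, e ∉ K.terminalEdges →
      ∀ f ∈ hullE α S, (Γ.cover p).o f = (Γ.cover p).t e → f ∈ K.edges := by
  have hT := cover_isTree p
  constructor
  · rintro ⟨h1, h2⟩
    have hmeet : ∀ e ∈ K.edges, Meets α S e := by
      intro e he
      obtain ⟨g, hg, hg'⟩ := Subgraph.exists_terminalEdge hT hK (fun g => cyl α g ⊆ cyl α e)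
        (by
          intro g hg hsub hgt
          obtain ⟨f, hf1, hf2, hf3⟩ := Subgraph.exists_continuation hg hgt
          exact ⟨f, hf1, hf2, hf3, (cyl_subset_cyl hf2 hf3).trans hsub⟩) he subset_rfl
      exact (h2 g hg).mono (Set.inter_subset_inter_right _ hg')
    refine ⟨fun e he => ⟨hmeet e he, hmeet _ (K.inv_mem e he)⟩, ?_⟩
    intro e he het f hf hfe
    obtain ⟨ξ, hξ, hξf⟩ := hf.1
    obtain ⟨d, hd, hξd⟩ := Set.mem_iUnion₂.1 (h1 hξ)
    have hne : (Γ.cover p).t e ≠ (Γ.cover p).t d := by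
      intro h
      obtain ⟨e', he'1, he'2, he'3⟩ := Subgraph.exists_continuation he het
      have h3 := hd.2 e' he'1 (he'2.trans h)
      have h4 := hd.2 _ (K.inv_mem e he) h
      exact he'3 (h3.trans h4.symm)
    -- `c` is the first edge of the geodesic inside `K` from the end of `e` to the end of `d`. As
    -- `d` is terminal, that geodesic ends with `d`, so `c` also points toward `ξ` and must equal
    -- `f`.
    obtain ⟨c, hc1, l, hl⟩ := exists_side (hG := hT) hne
    obtain ⟨j, hj1, l', hl'⟩ := exists_side (hG := hT) hne.symm
    have hcK : c ∈ K.edges := by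
      refine Subgraph.geo_subset (hG := hT) hK.connected (Subgraph.t_mem he)
        (Subgraph.t_mem hd.1) (g := c) ?_
      rw [← hc1, hl]; simp
    have hjK : j ∈ K.edges := by
      refine Subgraph.geo_subset (hG := hT) hK.connected (Subgraph.t_mem hd.1)
        (Subgraph.t_mem he) (g := j) ?_
      rw [← hj1, hl']; simp
    have hjd := hd.2 j hjK hj1
    have hside : ¬ CSide d ((Γ.cover p).o c) := by
      rw [CSide, not_side_iff, ← hjd, hc1]
      exact ⟨l', hl'⟩
    have hξc : ξ ∈ cyl α c := cyl_subset_of_side ⟨l, hl⟩ hside hξd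
    have : f = c := (mem_cyl_iff.1 hξf).unique (mem_cyl_iff.1 hξc) (hfe.trans hc1.symm)
    rwa [this]
  · rintro ⟨h1, h2⟩
    refine ⟨fun ξ hξ => ?_, fun e he => (h1 he.1).1⟩
    obtain ⟨e₀, he₀⟩ := hK.nondegenerate
    obtain ⟨e, he, hξe⟩ : ∃ e ∈ K.edges, ξ ∈ cyl α e := by
      by_cases h : ξ ∈ cyl α e₀
      · exact ⟨e₀, he₀, h⟩
      · refine ⟨_, K.inv_mem _ he₀, ?_⟩
        rw [cyl_inv]; exact h
    obtain ⟨g, hg, hg'⟩ := Subgraph.exists_terminalEdge hT hK (fun g => ξ ∈ cyl α g)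
      (by
        intro g hg hξg hgt
        obtain ⟨f, hf1, hf2, hf3, hf4⟩ := exists_hullE_next_of_mem (h1 hg) hξ hξg
        exact ⟨f, h2 g hg hgt f hf1 hf2, hf2, hf3, hf4⟩) he hξe
    exact Set.mem_iUnion₂.2 ⟨g, hg, hg'⟩

end Hull

/-! ### Topology of the hyperspace -/

section Topology

variable {N : ℕ}

instance : CompactSpace (Boundary N) := by
  have hc : IsClosed (Set.range (Boundary.word : Boundary N → ℕ → Fin N × Bool)) := by
    have : Set.range (Boundary.word : Boundary N → ℕ → Fin N × Bool) =
        ⋂ n, {w | w (n + 1) ≠ ((w n).1, !(w n).2)} := by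
      ext w
      simp only [Set.mem_range, Set.mem_iInter, Set.mem_ofPred_eq]
      constructor
      · rintro ⟨ξ, rfl⟩; exact ξ.reduced
      · intro h; exact ⟨⟨w, h⟩, rfl⟩
    rw [this]
    refine isClosed_iInter fun n => ?_
    let F : (ℕ → Fin N × Bool) → (Fin N × Bool) × (Fin N × Bool) := fun w => (w (n + 1), w n)
    have hF : Continuous F := (continuous_apply _).prodMk (continuous_apply _)
    exact (isClosed_discrete {q : (Fin N × Bool) × (Fin N × Bool) |
      q.1 ≠ (q.2.1, !q.2.2)}).preimage hF
  refine ⟨?_⟩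
  rw [Boundary.isInducing_word.isCompact_iff, Set.image_univ]
  exact hc.isCompact

/-- It is the projection, along the compact boundary, of the closed incidence relation between
points of `F` and closed sets. -/
theorem isClosed_inter_nonempty {F : Set (Boundary N)} (hF : IsClosed F) :
    IsClosed {t : Closeds (Boundary N) | ((t : Set (Boundary N)) ∩ F).Nonempty} := by
  have h1 : IsClosed {q : Boundary N × Closeds (Boundary N) |
      q.1 ∈ F ∧ Metric.infEDist q.1 q.2 = 0} :=
    (hF.preimage continuous_fst).inter
      (isClosed_singleton.preimage Closeds.continuous_infEDist)
  convert isClosedMap_snd_of_compactSpace _ h1 using 1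
  ext t
  constructor
  · rintro ⟨ξ, h, h'⟩
    exact ⟨(ξ, t), ⟨h', Metric.infEDist_zero_of_mem h⟩, rfl⟩
  · rintro ⟨⟨ξ, t'⟩, ⟨h, h'⟩, rfl⟩
    exact ⟨ξ, (Metric.mem_iff_infEDist_zero_of_closed t'.isClosed).2 h', h⟩

instance : T2Space (BigClosed N) :=
  T2Space.of_injective_continuous (f := BigClosed.toCloseds)
    (fun _ _ h => BigClosed.ext h) continuous_induced_dom

variable {Γ : SerreGraph.{u}} {p : Γ.V} (α : FreeGroup (Fin N) ≃* Γ.Pi1 p) [Finite Γ.E]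

/-- Meeting both cylinders of `e` is a closed condition in the compact hyperspace, and it already
forces two distinct points, so nothing is lost by leaving out the smaller sets. -/
theorem isCompact_setOf_mem_hullE (e : (Γ.cover p).E) :
    IsCompact {S : BigClosed N | e ∈ hullE α S} := by
  have hi : Topology.IsInducing (BigClosed.toCloseds : BigClosed N → _) := ⟨rfl⟩
  let C : Set (Closeds (Boundary N)) := {t | ((t : Set (Boundary N)) ∩ cyl α e).Nonempty} ∩
    {t | ((t : Set (Boundary N)) ∩ cyl α ((Γ.cover p).inv e)).Nonempty}
  have hC : IsClosed C := (isClosed_inter_nonempty (isClopen_cyl _).1).inter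
    (isClosed_inter_nonempty (isClopen_cyl _).1)
  have hr : C ⊆ Set.range (BigClosed.toCloseds : BigClosed N → _) := by
    rintro t ⟨⟨ξ, h1, h2⟩, η, h3, h4⟩
    refine ⟨⟨t, ξ, h1, η, h3, ?_⟩, rfl⟩
    rintro rfl
    rw [cyl_inv] at h4
    exact h4 h2
  exact (hi.isCompact_preimage_iff hr).2 hC.isCompact

theorem measurableSet_meets (e : (Γ.cover p).E) : MeasurableSet {S : BigClosed N | Meets α S e} :=
  ((Closeds.isOpen_inter_nonempty_of_isOpen (isClopen_cyl (α := α) e).2).preimage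
    continuous_induced_dom).measurableSet

theorem measurableSet_subsetCyl {K : (Γ.cover p).Subgraph} (hK : K.IsFiniteSubtree) :
    MeasurableSet (subsetCyl α K) := by
  have : subsetCyl α K = {S : BigClosed N | S.pts ⊆ ⋃ e ∈ K.terminalEdges, cyl α e} ∩
      ⋂ e ∈ K.terminalEdges, {S | Meets α S e} := by
    ext S
    simp [subsetCyl, Meets]
  have hf : K.terminalEdges.Finite := hK.finite_edges.subset fun e he => he.1
  rw [this]
  refine MeasurableSet.inter ?_ ?_
  · exact ((Closeds.isClosed_subsets_of_isClosed
      (hf.isClosed_biUnion fun e _ => (isClopen_cyl e).1)).preimage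
        continuous_induced_dom).measurableSet
  · exact MeasurableSet.biInter hf.countable fun e _ => measurableSet_meets α e

end Topology

/-! ### Balls in convex hulls -/

theorem SerreGraph.Subgraph.exists_coe_path {G : SerreGraph.{u}} {K : G.Subgraph} :
    ∀ {l : List G.E} {a b : G.V} (ha : a ∈ K.verts) (hb : b ∈ K.verts), G.IsPath a l b →
    (∀ e ∈ l, e ∈ K.edges) → ∃ l', K.coe.IsPath (Subgraph.mkV ha) l' (Subgraph.mkV hb)
  | [], _, _, _, _, h, _ => ⟨[], Subtype.ext h⟩
  | e :: l, a, b, ha, hb, h, hl => by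
      have he := hl e List.mem_cons_self
      obtain ⟨l', h'⟩ := exists_coe_path (Subgraph.t_mem he) hb h.2
        fun f hf => hl f (List.mem_cons_of_mem _ hf)
      exact ⟨Subgraph.mkE he :: l', Subtype.ext h.1, h'⟩

section Ball

variable {N : ℕ} {Γ : SerreGraph.{u}} {p : Γ.V} (α : FreeGroup (Fin N) ≃* Γ.Pi1 p)

/-- The ball of radius `r` about `x` in the convex hull of `S`. -/
def hullBall (S : BigClosed N) (x : (Γ.cover p).V) (r : ℕ) : (Γ.cover p).Subgraph where
  verts := {y | y ∈ hullV α S ∧ cdist x y ≤ r}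
  edges := {f | f ∈ hullE α S ∧ cdist x ((Γ.cover p).o f) ≤ r ∧ cdist x ((Γ.cover p).t f) ≤ r}
  o_mem f hf := ⟨o_mem_hullV hf.1, hf.2.1⟩
  inv_mem f hf := ⟨inv_mem_hullE hf.1, hf.2.2, by rw [t_inv]; exact hf.2.1⟩

variable {α}

theorem cdist_self (x : (Γ.cover p).V) : cdist x x = 0 := (dist_eq_zero (cover_isTree p)).2 rfl

/-- Two distinct edges of the ball issue from the end of `e`; one of them points away from `x`, and
its other end is one step farther but still within `r`. -/
theorem cdist_lt_of_notMem_terminalEdges {S : BigClosed N} {x : (Γ.cover p).V} {r : ℕ}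
    {e : (Γ.cover p).E} (he : e ∈ (hullBall α S x r).edges)
    (ht : e ∉ (hullBall α S x r).terminalEdges) : cdist x ((Γ.cover p).t e) < r := by
  obtain ⟨f, hf, h1, h2⟩ := Subgraph.exists_continuation he ht
  have key : ∀ g ∈ (hullBall α S x r).edges, (Γ.cover p).o g = (Γ.cover p).t e →
      ¬ CSide g x → cdist x ((Γ.cover p).t e) < r := by
    intro g hg hge hs
    have := dist_t_of_not_side hs
    have h3 := hg.2.2
    rw [hge] at this
    unfold cdist at *
    omega
  by_cases h : CSide f x
  · refine key _ ((hullBall α S x r).inv_mem e he) rfl fun h' => h2 ?_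
    exact side_unique (h1.trans (o_inv e).symm) h h'
  · exact key f hf h1 h

theorem mem_hullBall_of_continuation {S : BigClosed N} {x : (Γ.cover p).V} {r : ℕ}
    {e f : (Γ.cover p).E} (he : cdist x ((Γ.cover p).t e) < r) (hf : f ∈ hullE α S)
    (h : (Γ.cover p).o f = (Γ.cover p).t e) : f ∈ (hullBall α S x r).edges := by
  have h1 := dist_triangle (cover_isTree p) x ((Γ.cover p).o f) ((Γ.cover p).t f)
  have h2 := dist_le_length (cover_isTree p) (x := (Γ.cover p).o f) (l := [f]) ⟨rfl, rfl⟩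
  rw [List.length_singleton] at h2
  rw [← h] at he
  unfold cdist at *
  exact ⟨hf, he.le, by unfold cdist; omega⟩

variable [Finite Γ.E]

theorem finite_setOf_o_mem {A : Set (Γ.cover p).V} (hA : A.Finite) :
    {e | (Γ.cover p).o e ∈ A}.Finite := by
  refine Set.Finite.of_finite_image (f := fun e => ((Γ.cover p).o e, lab e))
    ((hA.prod (Set.toFinite (Set.univ : Set Γ.E))).subset ?_) ?_
  · rintro _ ⟨e, he, rfl⟩
    exact ⟨he, Set.mem_univ _⟩
  · intro e _ f _ h
    exact cover_edge_ext (Prod.mk.inj h).1 (Prod.mk.inj h).2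

theorem hullBall_isFiniteSubtree {S : BigClosed N} {x : (Γ.cover p).V} (hx : x ∈ hullV α S)
    {r : ℕ} (hr : 1 ≤ r) : (hullBall α S x r).IsFiniteSubtree where
  finite_verts := (finite_ball x r).subset fun y hy => hy.2
  finite_edges := (finite_setOf_o_mem (finite_ball x r)).subset fun f hf => hf.2.1
  connected := by
    have hxx : x ∈ (hullBall α S x r).verts :=
      ⟨hx, by rw [cdist_self]; omega⟩
    have key : ∀ y : (hullBall α S x r).coe.V, ∃ l,
        (hullBall α S x r).coe.IsPath (Subgraph.mkV hxx) l y := by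
      rintro ⟨y, hy⟩
      refine Subgraph.exists_coe_path hxx hy (geo_isPath (cover_isTree p) x y) fun g hg => ?_
      obtain ⟨-, -, h1, h2⟩ := mem_geo hg
      exact ⟨geo_subset_hullE hx hy.1 hg, h1.trans hy.2, h2.trans hy.2⟩
    refine ⟨⟨Subgraph.mkV hxx⟩, fun y z => ?_⟩
    obtain ⟨l, hl⟩ := key y
    obtain ⟨l', hl'⟩ := key z
    exact ⟨_, hl.reverse.append hl'⟩
  nondegenerate := by
    obtain ⟨e, he, rfl⟩ := hx
    refine ⟨e, he, ?_, ?_⟩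
    · rw [cdist_self]; omega
    · refine le_trans (dist_le_length (cover_isTree p) (l := [e]) ⟨rfl, rfl⟩) ?_
      simpa using hr

theorem exists_notMem_terminalEdges {S : BigClosed N} {x y : (Γ.cover p).V} {r : ℕ}
    (hy : y ∈ hullV α S) (h : cdist x y < r) : ∃ e ∈ (hullBall α S x r).edges,
      (Γ.cover p).t e = y ∧ e ∉ (hullBall α S x r).terminalEdges := by
  have key : ∀ e ∈ hullE α S, (Γ.cover p).o e = y → e ∈ (hullBall α S x r).edges := by
    rintro e he rfl
    have h1 := dist_triangle (cover_isTree p) x ((Γ.cover p).o e) ((Γ.cover p).t e)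
    have h2 := dist_le_length (cover_isTree p) (x := (Γ.cover p).o e) (l := [e]) ⟨rfl, rfl⟩
    rw [List.length_singleton] at h2
    unfold cdist at *
    exact ⟨he, h.le, by unfold cdist; omega⟩
  obtain ⟨e, he, f, hf, h1, h2, hne⟩ := exists_two_hullE hy
  refine ⟨_, Subgraph.inv_mem _ _ (key e he h1), by rw [t_inv, h1], fun h3 => ?_⟩
  have h4 := h3.2 f (key f hf h2) (by rw [t_inv, h1, h2])
  rw [SerreGraph.inv_inv] at h4
  exact hne h4.symm

theorem mem_subsetCyl_hullBall {S : BigClosed N} {x : (Γ.cover p).V} (hx : x ∈ hullV α S)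
    {r : ℕ} (hr : 1 ≤ r) : S ∈ subsetCyl α (hullBall α S x r) :=
  (mem_subsetCyl_iff (hullBall_isFiniteSubtree hx hr)).2 ⟨fun _ h => h.1, fun _ he ht _ hf h =>
    mem_hullBall_of_continuation (cdist_lt_of_notMem_terminalEdges he ht) hf h⟩

theorem subsetCyl_hullBall_anti {S : BigClosed N} {x : (Γ.cover p).V} (hx : x ∈ hullV α S)
    {r s : ℕ} (hr : 1 ≤ r) (hrs : r ≤ s) :
    subsetCyl α (hullBall α S x s) ⊆ subsetCyl α (hullBall α S x r) := by
  intro T hT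
  rw [mem_subsetCyl_iff (hullBall_isFiniteSubtree hx (hr.trans hrs))] at hT
  rw [mem_subsetCyl_iff (hullBall_isFiniteSubtree hx hr)]
  refine ⟨fun f hf => hT.1 ⟨hf.1, hf.2.1.trans hrs, hf.2.2.trans hrs⟩, fun e he ht f hf h => ?_⟩
  have h1 := cdist_lt_of_notMem_terminalEdges he ht
  obtain ⟨e', he', h2, h3⟩ := exists_notMem_terminalEdges (t_mem_hullV he.1) (h1.trans_le hrs)
  have h4 := hT.2 e' he' h3 f hf (h.trans h2.symm)
  exact mem_hullBall_of_continuation h1 h4.1 h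

/-- The balls exhaust the hull of `S`, so it lies in that of `T`; the latter cannot branch off at
any vertex of the former and is connected, so the hulls agree. -/
theorem eq_of_forall_mem_subsetCyl {S T : BigClosed N} {x : (Γ.cover p).V} (hx : x ∈ hullV α S)
    (hT : ∀ r, T ∈ subsetCyl α (hullBall α S x (r + 1))) : T = S := by
  have hST : hullE α S ⊆ hullE α T := by
    intro f hf
    let r := max (cdist x ((Γ.cover p).o f)) (cdist x ((Γ.cover p).t f))
    refine ((mem_subsetCyl_iff (hullBall_isFiniteSubtree hx (Nat.le_add_left 1 r))).1 (hT r)).1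
      ⟨hf, ?_, ?_⟩
    · exact (le_max_left _ _).trans (Nat.le_succ r)
    · exact (le_max_right _ _).trans (Nat.le_succ r)
  have hstep : ∀ f ∈ hullE α T, (Γ.cover p).o f ∈ hullV α S → f ∈ hullE α S := by
    intro f hf hv
    -- In the ball of radius `r + 1` the origin of `f` is an interior vertex, so the cylinder
    -- condition applies there.
    let r := cdist x ((Γ.cover p).o f)
    obtain ⟨e, he, h1, h2⟩ := exists_notMem_terminalEdges (x := x) hv (Nat.lt_succ_self r)
    exact (((mem_subsetCyl_iff (hullBall_isFiniteSubtree hx (Nat.le_add_left 1 r))).1 (hT r)).2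
      e he h2 f hf h1.symm).1
  have hpath : ∀ (l : List (Γ.cover p).E) (a b : (Γ.cover p).V), (Γ.cover p).IsPath a l b →
      (∀ e ∈ l, e ∈ hullE α T) → a ∈ hullV α S → b ∈ hullV α S := by
    intro l
    induction l with
    | nil => intro a b h _ ha; have h : a = b := h; rwa [← h]
    | cons e l ih =>
      intro a b h hl ha
      have he := hstep e (hl e List.mem_cons_self) (by rw [h.1]; exact ha)
      exact ih _ _ h.2 (fun f hf => hl f (List.mem_cons_of_mem _ hf)) (t_mem_hullV he)
  have hxT : x ∈ hullV α T := by
    obtain ⟨e, he, h⟩ := hx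
    exact ⟨e, hST he, h⟩
  refine hullE_injective α (Set.Subset.antisymm (fun f hf => ?_) hST)
  exact hstep f hf (hpath _ _ _ (geo_isPath (cover_isTree p) x _)
    (fun e he => geo_subset_hullE hxT (o_mem_hullV hf) he) hx)

end Ball

/-! ### Measures with integral weights are atomic -/

section Atomic

variable {N : ℕ} {Γ : SerreGraph.{u}} {p : Γ.V} {α : FreeGroup (Fin N) ≃* Γ.Pi1 p} [Finite Γ.E]

theorem tendsto_measure_subsetCyl_hullBall {μ : Measure (BigClosed N)} {S : BigClosed N}
    {x : (Γ.cover p).V} (hx : x ∈ hullV α S)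
    (hμ : ∀ K : (Γ.cover p).Subgraph, K.IsFiniteSubtree → ∃ n : ℕ, μ (subsetCyl α K) = n) :
    Filter.Tendsto (fun r => μ (subsetCyl α (hullBall α S x (r + 1)))) Filter.atTop
      (nhds (μ {S})) := by
  have hK := fun r : ℕ => hullBall_isFiniteSubtree hx (Nat.le_add_left 1 r)
  have h1 : {S} = ⋂ r, subsetCyl α (hullBall α S x (r + 1)) := by
    ext T
    simp only [Set.mem_singleton_iff, Set.mem_iInter]
    constructor
    · rintro rfl r
      exact mem_subsetCyl_hullBall hx (Nat.le_add_left 1 r)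
    · exact eq_of_forall_mem_subsetCyl hx
  rw [h1]
  refine tendsto_measure_iInter_atTop
    (fun r => (measurableSet_subsetCyl α (hK r)).nullMeasurableSet) ?_ ⟨0, ?_⟩
  · intro r s hrs
    exact subsetCyl_hullBall_anti hx (Nat.le_add_left 1 r) (Nat.succ_le_succ hrs)
  · obtain ⟨n, hn⟩ := hμ _ (hK 0)
    rw [hn]
    exact ENNReal.natCast_ne_top n

theorem exists_natCast_eq_measure_singleton {μ : Measure (BigClosed N)}
    (hμ : ∀ K : (Γ.cover p).Subgraph, K.IsFiniteSubtree → ∃ n : ℕ, μ (subsetCyl α K) = n)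
    (S : BigClosed N) : ∃ n : ℕ, μ {S} = n ∧ ∃ K : (Γ.cover p).Subgraph, K.IsFiniteSubtree ∧
      S ∈ subsetCyl α K ∧ μ (subsetCyl α K) = n := by
  obtain ⟨e, he⟩ := hullE_nonempty α S
  have hx := o_mem_hullV he
  have hK := fun r : ℕ => hullBall_isFiniteSubtree hx (Nat.le_add_left 1 r)
  choose c hc using fun r => hμ _ (hK r)
  have hanti : Antitone c := by
    intro r s hrs
    have := measure_mono (μ := μ) (subsetCyl_hullBall_anti hx (Nat.le_add_left 1 r)
      (Nat.succ_le_succ hrs))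
    rw [hc, hc] at this
    exact_mod_cast this
  -- A decreasing sequence of natural numbers keeps its minimum once it is reached; this is where
  -- integrality enters.
  obtain ⟨r, hr⟩ : ∃ r, ∀ s, c r ≤ c s :=
    ⟨Function.argmin c, fun s => Function.argmin_le c s⟩
  have hlim := tendsto_measure_subsetCyl_hullBall hx hμ
  refine ⟨c r, ?_, _, hK r, mem_subsetCyl_hullBall hx (Nat.le_add_left 1 r), hc r⟩
  refine tendsto_nhds_unique hlim (tendsto_const_nhds.congr' ?_)
  filter_upwards [Filter.eventually_ge_atTop r] with s hs
  rw [hc, le_antisymm (hr s) (hanti hs)]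

theorem measure_singleton_eq {μ ν : Measure (BigClosed N)}
    (hμ : ∀ K : (Γ.cover p).Subgraph, K.IsFiniteSubtree → ∃ n : ℕ, μ (subsetCyl α K) = n)
    (hν : ∀ K : (Γ.cover p).Subgraph, K.IsFiniteSubtree → ν (subsetCyl α K) = μ (subsetCyl α K))
    (S : BigClosed N) : ν {S} = μ {S} := by
  obtain ⟨e, he⟩ := hullE_nonempty α S
  have hx := o_mem_hullV he
  refine tendsto_nhds_unique (tendsto_measure_subsetCyl_hullBall hx fun K hK => ?_)
    ((tendsto_measure_subsetCyl_hullBall hx hμ).congr fun r => ?_)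
  · rw [hν K hK]; exact hμ K hK
  · exact (hν _ (hullBall_isFiniteSubtree hx (Nat.le_add_left 1 r))).symm

theorem countable_cover_verts : Countable (Γ.cover p).V := by
  let x : (Γ.cover p).V := coverVertex (HClass.nil p)
  rw [← Set.countable_univ_iff]
  refine (Set.countable_iUnion fun r => (finite_ball x r).countable).mono fun y _ => ?_
  exact Set.mem_iUnion.2 ⟨cdist x y, le_refl (cdist x y)⟩

theorem countable_cover_edges : Countable (Γ.cover p).E := by
  have := countable_cover_verts (p := p)
  rw [← Set.countable_univ_iff]
  refine (Set.countable_iUnion fun x : (Γ.cover p).V =>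
    (finite_setOf_o_mem (Set.finite_singleton x)).countable).mono fun e _ => ?_
  exact Set.mem_iUnion.2 ⟨(Γ.cover p).o e, rfl⟩

theorem countable_finiteSubtrees :
    {K : (Γ.cover p).Subgraph | K.IsFiniteSubtree}.Countable := by
  have := countable_cover_verts (p := p)
  have := countable_cover_edges (p := p)
  refine Set.MapsTo.countable_of_injOn (f := fun K => (K.verts, K.edges))
    (t := {s | s.Finite ∧ s ⊆ Set.univ} ×ˢ {s | s.Finite ∧ s ⊆ Set.univ}) ?_ ?_ ?_
  · intro K hK
    exact ⟨⟨hK.finite_verts, Set.subset_univ _⟩, hK.finite_edges, Set.subset_univ _⟩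
  · rintro ⟨V, E, _, _⟩ _ ⟨V', E', _, _⟩ _ h
    obtain ⟨rfl, rfl⟩ := Prod.mk.inj h
    rfl
  · exact (Set.countable_ofPred_finite_subset (Set.to_countable _)).prod
      (Set.countable_ofPred_finite_subset (Set.to_countable _))

/-- Each point of mass zero lies in a cylinder of measure zero, and there are only countably many
finite subtrees. -/
theorem measure_setOf_measure_singleton_eq_zero {μ : Measure (BigClosed N)}
    (hμ : ∀ K : (Γ.cover p).Subgraph, K.IsFiniteSubtree → ∃ n : ℕ, μ (subsetCyl α K) = n) :
    μ {S | μ {S} = 0} = 0 := by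
  let A : Set (Γ.cover p).Subgraph := {K | K.IsFiniteSubtree ∧ μ (subsetCyl α K) = 0}
  have hA : A.Countable := countable_finiteSubtrees.mono fun K hK => hK.1
  refine measure_mono_null ?_ ((measure_biUnion_null_iff hA).2 fun K hK => hK.2)
  intro S hS
  obtain ⟨n, h1, K, hK, h2, h3⟩ := exists_natCast_eq_measure_singleton hμ S
  have hS : μ {S} = 0 := hS
  exact Set.mem_iUnion₂.2 ⟨K, ⟨hK, by rw [h3, ← h1, hS]⟩, h2⟩

/-- Atoms have mass at least `1` by integrality, and they are disjoint inside a set of finite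
measure. -/
theorem finite_atoms {μ : Measure (BigClosed N)}
    (hμ : ∀ K : (Γ.cover p).Subgraph, K.IsFiniteSubtree → ∃ n : ℕ, μ (subsetCyl α K) = n)
    (hfin : ∀ e : (Γ.cover p).E, μ {S | e ∈ hullE α S} < ∞) (e : (Γ.cover p).E) :
    {S | e ∈ hullE α S ∧ μ {S} ≠ 0}.Finite := by
  let As : {S : BigClosed N // e ∈ hullE α S} → Set (BigClosed N) := fun S => {S.1}
  have h := Measure.finite_const_le_meas_of_disjoint_iUnion μ (ε := 1) one_pos (As := As)
    (fun S => measurableSet_singleton _)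
    (fun S T h => Set.disjoint_singleton.2 fun h' => h (Subtype.ext h'))
    (ne_of_lt ((measure_mono (Set.iUnion_subset fun S => by
      rintro _ rfl; exact S.2)).trans_lt (hfin e)))
  refine (h.image Subtype.val).subset ?_
  rintro S ⟨h1, h2⟩
  refine ⟨⟨S, h1⟩, ?_, rfl⟩
  obtain ⟨n, hn, -⟩ := exists_natCast_eq_measure_singleton hμ S
  change 1 ≤ μ {S}
  rw [hn] at h2 ⊢
  have : n ≠ 0 := by rintro rfl; simp at h2
  exact_mod_cast Nat.one_le_iff_ne_zero.2 this

theorem countable_atoms {μ : Measure (BigClosed N)}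
    (hμ : ∀ K : (Γ.cover p).Subgraph, K.IsFiniteSubtree → ∃ n : ℕ, μ (subsetCyl α K) = n)
    (hfin : ∀ e : (Γ.cover p).E, μ {S | e ∈ hullE α S} < ∞) :
    {S | μ {S} ≠ 0}.Countable := by
  have := countable_cover_edges (p := p)
  refine (Set.countable_iUnion fun e : (Γ.cover p).E =>
    (finite_atoms hμ hfin e).countable).mono fun S hS => ?_
  obtain ⟨e, he⟩ := hullE_nonempty α S
  exact Set.mem_iUnion.2 ⟨e, he, hS⟩

theorem measure_eq_tsum_atoms {μ : Measure (BigClosed N)}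
    (hμ : ∀ K : (Γ.cover p).Subgraph, K.IsFiniteSubtree → ∃ n : ℕ, μ (subsetCyl α K) = n)
    (hfin : ∀ e : (Γ.cover p).E, μ {S | e ∈ hullE α S} < ∞) (A : Set (BigClosed N)) :
    μ A = ∑' S : BigClosed N, A.indicator (fun S => μ {S}) S := by
  have hc := countable_atoms hμ hfin
  have h1 : μ A = μ (⋃ S ∈ {S | S ∈ A ∧ μ {S} ≠ 0}, {S}) := by
    refine measure_congr ?_
    have h0 := measure_setOf_measure_singleton_eq_zero hμ
    rw [measure_eq_zero_iff_ae_notMem] at h0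
    filter_upwards [h0] with S hS
    refine propext ?_
    change S ∈ A ↔ S ∈ ⋃ S ∈ {S | S ∈ A ∧ μ {S} ≠ 0}, {S}
    have hS : μ {S} ≠ 0 := hS
    simp [hS]
  rw [h1, measure_biUnion (hc.mono fun S hS => hS.2)
    (fun S _ T _ h => Set.disjoint_singleton.2 h) (fun S _ => measurableSet_singleton S),
    tsum_subtype {S | S ∈ A ∧ μ {S} ≠ 0} (fun S => μ {S})]
  refine tsum_congr fun S => ?_
  by_cases h : S ∈ A <;> by_cases h' : μ {S} = 0 <;> simp [Set.indicator, h, h']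

end Atomic

/-! ### Stabilizers -/

section Translate

variable {N : ℕ}

theorem BigClosed.translate_one (S : BigClosed N) : BigClosed.translate 1 S = S := by
  refine BigClosed.ext_pts ?_
  change Boundary.act N 1 '' S.pts = S.pts
  rw [map_one]
  exact Set.image_id _

theorem BigClosed.translate_mul (g h : FreeGroup (Fin N)) (S : BigClosed N) :
    BigClosed.translate (g * h) S = BigClosed.translate g (BigClosed.translate h S) := by
  refine BigClosed.ext_pts ?_
  change Boundary.act N (g * h) '' S.pts = Boundary.act N g '' (Boundary.act N h '' S.pts)
  rw [map_mul, Set.image_image]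
  rfl

theorem BigClosed.translate_inv_translate (g : FreeGroup (Fin N)) (S : BigClosed N) :
    BigClosed.translate g⁻¹ (BigClosed.translate g S) = S := by
  rw [← translate_mul, inv_mul_cancel, translate_one]

theorem BigClosed.translate_translate_inv (g : FreeGroup (Fin N)) (S : BigClosed N) :
    BigClosed.translate g (BigClosed.translate g⁻¹ S) = S := by
  rw [← translate_mul, mul_inv_cancel, translate_one]

/-- The stabilizer of a closed subset of the boundary. -/
noncomputable def stab (S : BigClosed N) : Subgroup (FreeGroup (Fin N)) where
  carrier := {g | BigClosed.translate g S = S}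
  mul_mem' {g h} hg hh := by
    have hg : BigClosed.translate g S = S := hg
    have hh : BigClosed.translate h S = S := hh
    change BigClosed.translate (g * h) S = S
    rw [BigClosed.translate_mul, hh, hg]
  one_mem' := BigClosed.translate_one S
  inv_mem' {g} hg := by
    have hg : BigClosed.translate g S = S := hg
    change BigClosed.translate g⁻¹ S = S
    conv_lhs => rw [← hg]
    exact BigClosed.translate_inv_translate g S

theorem mem_stab {S : BigClosed N} {g : FreeGroup (Fin N)} :
    g ∈ stab S ↔ BigClosed.translate g S = S := Iff.rfl

theorem mem_stab_translate {S : BigClosed N} {g h : FreeGroup (Fin N)} :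
    h ∈ stab (BigClosed.translate g S) ↔ g⁻¹ * h * g ∈ stab S := by
  rw [mem_stab, mem_stab, BigClosed.translate_mul, BigClosed.translate_mul]
  constructor
  · intro h1
    rw [h1, BigClosed.translate_inv_translate]
  · intro h1
    rw [← BigClosed.translate_translate_inv g (BigClosed.translate h _), h1]

theorem stab_translate_eq_map (S : BigClosed N) (g : FreeGroup (Fin N)) :
    stab (BigClosed.translate g S) = (stab S).map (MulAut.conj g).toMonoidHom := by
  ext h
  rw [mem_stab_translate, Subgroup.mem_map]
  constructor
  · intro h1
    exact ⟨_, h1, by simp [mul_assoc]⟩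
  · rintro ⟨k, hk, rfl⟩
    simpa [mul_assoc] using hk

theorem stab_translate_eq_smul (S : BigClosed N) (g : FreeGroup (Fin N)) :
    stab (BigClosed.translate g S) = ConjAct.toConjAct g • stab S := by
  ext h
  rw [mem_stab_translate, Subgroup.mem_pointwise_smul_iff_inv_smul_mem, ← ConjAct.toConjAct_inv,
    ConjAct.toConjAct_smul, _root_.inv_inv]

end Translate

/-! ### Limit sets -/

section LimitSet

variable {N : ℕ}

theorem mem_limitSet {H : Subgroup (FreeGroup (Fin N))} {ξ : Boundary N} :
    ξ ∈ (Boundary.limitSet H : Set (Boundary N)) ↔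
      ∀ n : ℕ, ∃ h ∈ H, ξ.prefixWord n <+: h.toWord := Iff.rfl

theorem limitSet_bot : (Boundary.limitSet (⊥ : Subgroup (FreeGroup (Fin N))) : Set (Boundary N)) = ∅ := by
  refine Set.eq_empty_of_forall_notMem fun ξ hξ => ?_
  obtain ⟨h, hh, h1⟩ := mem_limitSet.1 hξ 1
  rw [Subgroup.mem_bot] at hh
  subst hh
  have := h1.length_le
  simp at this

/-- Every `k ∈ K` becomes an element of `H` after right multiplication by one of finitely many coset
representatives, which disturbs only a bounded final piece of its word. -/
theorem limitSet_le_of_relIndex_ne_zero {H K : Subgroup (FreeGroup (Fin N))}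
    (h : H.relIndex K ≠ 0) :
    (Boundary.limitSet K : Set (Boundary N)) ⊆ (Boundary.limitSet H : Set (Boundary N)) := by
  have hfin : Finite (K ⧸ H.subgroupOf K) := by
    have : (H.subgroupOf K).FiniteIndex := ⟨h⟩
    infer_instance
  obtain ⟨L, hL⟩ := Finite.exists_le
    (fun q : K ⧸ H.subgroupOf K => ((Quotient.out q : K) : FreeGroup (Fin N)).norm)
  intro ξ hξ n
  -- If `k * t` lost the prefix of length `n`, then `k` would have length at most `n + L`; hence the
  -- extra `1`.
  obtain ⟨k, hk, h1⟩ := mem_limitSet.1 hξ (n + L + 1)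
  let q : K ⧸ H.subgroupOf K := QuotientGroup.mk (⟨k, hk⟩ : K)⁻¹
  let t : FreeGroup (Fin N) := ((Quotient.out q : K) : FreeGroup (Fin N))
  have hq : t⁻¹ * k⁻¹ ∈ H := by
    have h2 : (QuotientGroup.mk (Quotient.out q) : K ⧸ H.subgroupOf K) = q := Quotient.out_eq q
    have h3 := QuotientGroup.eq.1 h2
    exact Subgroup.mem_subgroupOf.1 h3
  have hkt : k * t ∈ H := by
    have := H.inv_mem hq
    simpa using this
  refine ⟨k * t, hkt, ?_⟩
  by_contra hn
  have h4 := length_le_norm_add FreeGroup.isReduced_toWord FreeGroup.isReduced_toWord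
    ((ξ.prefixWord_prefix (by omega : n ≤ n + L + 1)).trans h1) hn
  rw [FreeGroup.mk_toWord, FreeGroup.mk_toWord, Boundary.length_prefixWord, mul_inv_rev,
    inv_mul_cancel_right, FreeGroup.norm_inv_eq] at h4
  have h5 : t.norm ≤ L := hL q
  have h6 := h1.length_le
  rw [Boundary.length_prefixWord] at h6
  omega

theorem limitSet_eq_of_commensurable {H K : Subgroup (FreeGroup (Fin N))}
    (h : Subgroup.Commensurable H K) : Boundary.limitSet H = Boundary.limitSet K :=
  TopologicalSpace.Closeds.ext (Set.Subset.antisymm (limitSet_le_of_relIndex_ne_zero h.2)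
    (limitSet_le_of_relIndex_ne_zero h.1))

end LimitSet

/-! ### Locally finite invariant families of closed sets -/

section Family

variable {N : ℕ} {Γ : SerreGraph.{u}} {p : Γ.V} (α : FreeGroup (Fin N) ≃* Γ.Pi1 p)

/-- A translation invariant set of closed subsets of the boundary such that each edge of the
universal cover lies in the convex hulls of finitely many members. -/
structure IsLocallyFiniteFamily (P : Set (BigClosed N)) : Prop where
  translate_mem : ∀ (g : FreeGroup (Fin N)) (S : BigClosed N), S ∈ P → BigClosed.translate g S ∈ P
  finite : ∀ e : (Γ.cover p).E, {S | e ∈ hullE α S ∧ S ∈ P}.Finite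

theorem SerreGraph.ver_surjective (hconn : Γ.Connected) :
    Function.Surjective (ver : (Γ.cover p).V → Γ.V) := by
  intro v
  obtain ⟨l, hl⟩ := hconn.2 p v
  exact ⟨coverVertex (HClass.ofPath l hl), rfl⟩

theorem SerreGraph.lab_surjective (hconn : Γ.Connected) :
    Function.Surjective (lab : (Γ.cover p).E → Γ.E) := by
  intro e
  obtain ⟨x, hx⟩ := ver_surjective (p := p) hconn (Γ.o e)
  obtain ⟨a, -, ha⟩ := exists_cover_edge x e hx.symm
  exact ⟨a, ha⟩

variable {α}
variable [Finite Γ.E] {P : Set (BigClosed N)}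

theorem IsLocallyFiniteFamily.finite_vert (hP : IsLocallyFiniteFamily α P) (x : (Γ.cover p).V) :
    {S | x ∈ hullV α S ∧ S ∈ P}.Finite := by
  refine ((finite_setOf_o_mem (Set.finite_singleton x)).biUnion
    fun e _ => hP.finite e).subset ?_
  rintro S ⟨⟨e, he, h⟩, hS⟩
  exact Set.mem_iUnion₂.2 ⟨e, h, he, hS⟩

/-- Move each hull vertex `y` to the chosen lift of its image in `Γ` and record that image and the
translate of `S`. Local finiteness leaves finitely many records, and vertices with equal records
differ by an element of `stab S`. -/
theorem IsLocallyFiniteFamily.exists_finite_representatives [Finite Γ.V] (hconn : Γ.Connected)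
    (hP : IsLocallyFiniteFamily α P) {S : BigClosed N} (hS : S ∈ P) :
    ∃ R : Set (Γ.cover p).V, R.Finite ∧ R ⊆ hullV α S ∧
      ∀ y ∈ hullV α S, ∃ c ∈ stab S, ∃ r ∈ R, actV α c r = y := by
  obtain ⟨s, hs⟩ := (ver_surjective (p := p) hconn).hasRightInverse
  choose g hg using fun y : (Γ.cover p).V => exists_actV_eq α (hs (ver y)).symm
  let f : (Γ.cover p).V → Γ.V × BigClosed N := fun y => (ver y, BigClosed.translate (g y) S)
  obtain ⟨R, hR, hbij⟩ := Set.exists_subset_bijOn (hullV α S) f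
  have hfin : (f '' hullV α S).Finite := by
    refine (Set.finite_iUnion fun v : Γ.V =>
      (Set.finite_singleton v).prod (hP.finite_vert (s v))).subset ?_
    rintro _ ⟨y, hy, rfl⟩
    refine Set.mem_iUnion.2 ⟨ver y, rfl, ?_, hP.translate_mem _ _ hS⟩
    rw [← hg y]
    exact hullV_translate.2 hy
  refine ⟨R, ?_, hR, fun y hy => ?_⟩
  · refine Set.Finite.of_finite_image (f := f) ?_ hbij.injOn
    rw [hbij.image_eq]
    exact hfin
  · obtain ⟨r, hr, hry⟩ := hbij.surjOn ⟨y, hy, rfl⟩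
    obtain ⟨h1, h2⟩ := Prod.mk.inj hry
    refine ⟨(g y)⁻¹ * g r, ?_, r, hr, ?_⟩
    · rw [mem_stab, BigClosed.translate_mul, h2, BigClosed.translate_inv_translate]
    · rw [actV_mul, hg r, h1, ← hg y, actV_inv_actV]

theorem hullV_nonempty (S : BigClosed N) : (hullV α S).Nonempty := by
  obtain ⟨e, he⟩ := hullE_nonempty α S
  exact ⟨_, o_mem_hullV he⟩

theorem actV_mem_hullV {S : BigClosed N} {c : FreeGroup (Fin N)} (hc : c ∈ stab S)
    {x : (Γ.cover p).V} : actV α c x ∈ hullV α S ↔ x ∈ hullV α S := by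
  conv_lhs => rw [← mem_stab.1 hc]
  exact hullV_translate

/-- The generators are the stabilizing elements that carry a representative to a representative or
to a neighbour of one. Finite by freeness of the action, they generate because a hull geodesic from
`b` to `c b` can be followed edge by edge. -/
theorem IsLocallyFiniteFamily.stab_fg [Finite Γ.V] (hconn : Γ.Connected)
    (hP : IsLocallyFiniteFamily α P) {S : BigClosed N} (hS : S ∈ P) : (stab S).FG := by
  obtain ⟨R, hR, hRS, hrep⟩ := hP.exists_finite_representatives hconn hS
  let Y : Set (Γ.cover p).V := R ∪ (Γ.cover p).t '' {e | (Γ.cover p).o e ∈ R}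
  have hY : Y.Finite := hR.union ((finite_setOf_o_mem hR).image _)
  let F : Set (FreeGroup (Fin N)) := {c | c ∈ stab S ∧ ∃ r ∈ R, ∃ y ∈ Y, actV α c r = y}
  have hF : F.Finite := by
    refine (hR.biUnion fun r _ => hY.biUnion fun y _ =>
      (Set.Subsingleton.finite (s := {c | actV α c r = y}) ?_)).subset ?_
    · intro c hc d hd
      exact actV_left_cancel α (Eq.trans hc (Eq.symm hd))
    · rintro c ⟨-, r, hr, y, hy, h⟩
      exact Set.mem_iUnion₂.2 ⟨r, hr, Set.mem_iUnion₂.2 ⟨y, hy, h⟩⟩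
  have hle : Subgroup.closure F ≤ stab S := (Subgroup.closure_le _).2 fun c hc => hc.1
  have hpath : ∀ (l : List (Γ.cover p).E) (a b : (Γ.cover p).V), (Γ.cover p).IsPath a l b →
      (∀ e ∈ l, e ∈ hullE α S) → (∃ c ∈ Subgroup.closure F, ∃ r ∈ R, actV α c r = a) →
      ∃ c ∈ Subgroup.closure F, ∃ r ∈ R, actV α c r = b := by
    intro l
    induction l with
    | nil => intro a b h _ ha; have h : a = b := h; rwa [← h]
    | cons e l ih =>
      intro a b h hl ha
      refine ih _ _ h.2 (fun f hf => hl f (List.mem_cons_of_mem _ hf)) ?_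
      obtain ⟨c, hc, r, hr, hcr⟩ := ha
      have hcS := hle hc
      have ht := t_mem_hullV (hl e List.mem_cons_self)
      have hy : actV α c⁻¹ ((Γ.cover p).t e) ∈ hullV α S :=
        (actV_mem_hullV ((stab S).inv_mem hcS)).2 ht
      obtain ⟨d, hd, r', hr', hdr⟩ := hrep _ hy
      refine ⟨c * d, mul_mem hc (Subgroup.subset_closure ⟨hd, r', hr', _, ?_, hdr⟩), r', hr', ?_⟩
      · refine Or.inr ⟨actE α c⁻¹ e, ?_, t_actE α c⁻¹ e⟩
        change (Γ.cover p).o (actE α c⁻¹ e) ∈ R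
        rw [o_actE, h.1, ← hcr, actV_inv_actV]
        exact hr
      · rw [actV_mul, hdr, actV_actV_inv]
  rw [Subgroup.fg_iff]
  refine ⟨F, le_antisymm hle fun c hc => ?_, hF⟩
  obtain ⟨y, hy⟩ := hullV_nonempty (α := α) S
  obtain ⟨-, -, b, hb, -⟩ := hrep y hy
  obtain ⟨d, hd, r, hr, h⟩ := hpath _ b (actV α c b) (geo_isPath (cover_isTree p) _ _)
    (fun e he => geo_subset_hullE (hRS hb) ((actV_mem_hullV hc).2 (hRS hb)) he)
    ⟨1, one_mem _, b, hb, actV_one α b⟩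
  have h1 : d⁻¹ * c ∈ F := by
    refine ⟨mul_mem (inv_mem (hle hd)) hc, b, hb, r, Or.inl hr, ?_⟩
    rw [actV_mul, ← h, actV_inv_actV]
  have := mul_mem hd (Subgroup.subset_closure h1)
  rwa [mul_inv_cancel_left] at this

/-- If `ξ` were outside `S`, some cylinder about `ξ` would miss `S`. A long `h ∈ stab S` near `ξ`
moves a fixed hull vertex to the far side of that edge, and hull vertices there force `S` to meet
the cylinder. -/
theorem limitSet_stab_subset (α : FreeGroup (Fin N) ≃* Γ.Pi1 p) (S : BigClosed N) :
    (Boundary.limitSet (stab S) : Set (Boundary N)) ⊆ S.pts := by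
  intro ξ hξ
  by_contra hS
  obtain ⟨e, h1, h2⟩ := exists_cyl_subset (α := α) S.toCloseds.isClosed.isOpen_compl hS
  obtain ⟨x, hx⟩ := hullV_nonempty (α := α) S
  obtain ⟨n₀, -, hn₀⟩ := exists_stable_length α ((Γ.cover p).o e)
  obtain ⟨n₁, hn₁⟩ := exists_norm_bound α ((Γ.cover p).o e) (cdist (orbitPoint α 1) x)
  obtain ⟨n, hn, hn'⟩ := ((mem_cyl_iff.1 h1).and
    (Filter.eventually_ge_atTop (max n₀ n₁))).exists
  obtain ⟨h, hh, v, hv⟩ := mem_limitSet.1 hξ n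
  have hmk : h = FreeGroup.mk (ξ.prefixWord n ++ v) := by rw [hv, FreeGroup.mk_toWord]
  have hside : CSide e (orbitPoint α h) := by
    rw [hmk]
    refine (hn₀ e rfl _ v ?_ ?_).2 hn
    · rw [Boundary.length_prefixWord]; exact (le_max_left _ _).trans hn'
    · rw [hv]; exact FreeGroup.isReduced_toWord
  have hnorm : n₁ ≤ h.norm := by
    rw [FreeGroup.norm, ← hv, List.length_append, Boundary.length_prefixWord]
    have := (le_max_right n₀ n₁).trans hn'
    omega
  have hside' : CSide e (actV α h x) := by
    refine (side_congr ?_).1 hside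
    refine lt_of_eq_of_lt ?_ (hn₁ h hnorm)
    rw [orbitPoint_eq α h]
    exact cdist_actV α h _ _
  obtain ⟨η, h3, h4⟩ := meets_of_side ((actV_mem_hullV hh).2 hx) hside'
  exact h2 h4 h3

theorem exists_far_hullE {S : BigClosed N} {ξ : Boundary N} (hξ : ξ ∈ S.pts)
    {e : (Γ.cover p).E} (he : e ∈ hullE α S) (h : ξ ∈ cyl α e) (k : ℕ) :
    ∃ f ∈ hullE α S, ξ ∈ cyl α f ∧ CSide e ((Γ.cover p).t f) ∧ ¬ CSide f ((Γ.cover p).o e) ∧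
      k < cdist ((Γ.cover p).o e) ((Γ.cover p).t f) := by
  induction k with
  | zero =>
    refine ⟨e, he, h, side_t e, not_side_o e, ?_⟩
    rw [cdist, (side_t e).dist_eq]
    omega
  | succ k ih =>
    obtain ⟨f, hf, h1, h2, h3, h4⟩ := ih
    obtain ⟨f', hf', h5, h6, h7⟩ := exists_hullE_next_of_mem hf hξ h1
    have h8 : ¬ CSide f' ((Γ.cover p).o e) := fun h' => h3 (side_of_side h5 h6 h')
    refine ⟨f', hf', h7, side_t_of_side_o (by rwa [h5]) h8, h8, ?_⟩
    rw [cdist, dist_t_of_not_side h8, h5]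
    exact Nat.succ_lt_succ h4

/-- Along the hull toward `ξ` every vertex is within `D` of some orbit point of `stab S`. Going
deeper than `D` past an edge that forces the prefix of `ξ`, this orbit point lies beyond the edge
too. -/
theorem IsLocallyFiniteFamily.subset_limitSet_stab [Finite Γ.V] (hconn : Γ.Connected)
    (hP : IsLocallyFiniteFamily α P) {S : BigClosed N} (hS : S ∈ P) :
    S.pts ⊆ (Boundary.limitSet (stab S) : Set (Boundary N)) := by
  obtain ⟨R, hR, hRS, hrep⟩ := hP.exists_finite_representatives hconn hS
  obtain ⟨D, hD⟩ := (hR.image fun r => cdist r (orbitPoint α 1)).bddAbove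
  intro ξ hξ
  rw [mem_limitSet]
  intro n
  obtain ⟨η, hη, hne⟩ := S.nontrivial.exists_ne ξ
  obtain ⟨i, hi⟩ : ∃ i, η.word i ≠ ξ.word i := by
    by_contra! h
    exact hne (Boundary.ext (funext h))
  -- Length `i + 1` includes the letter where `η` and `ξ` differ, so `η` is not beyond `e` and `e`
  -- is a hull edge.
  obtain ⟨e, he, hpre⟩ := exists_toward_prefix (α := α) ξ (max n (i + 1))
  have hηe : ¬ Toward α e η := by
    intro h
    obtain ⟨m, hm⟩ := h.exists
    have h1 := hpre _ hm
    rw [η.toWord_mk_prefixWord] at h1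
    have h2 := η.eq_prefixWord_of_prefix h1
    rw [Boundary.length_prefixWord] at h2
    exact hi (Boundary.word_eq_of_prefixWord_eq h2
      (lt_of_lt_of_le (Nat.lt_succ_self i) (le_max_right _ _))).symm
  have heS : e ∈ hullE α S := by
    refine ⟨⟨ξ, hξ, mem_cyl_iff.2 he⟩, η, hη, ?_⟩
    rw [cyl_inv]
    exact fun h => hηe (mem_cyl_iff.1 h)
  obtain ⟨f, hf, -, h2, -, h4⟩ := exists_far_hullE hξ heS (mem_cyl_iff.2 he) D
  obtain ⟨c, hc, r, hr, hcr⟩ := hrep _ (t_mem_hullV hf)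
  refine ⟨c, hc, (ξ.prefixWord_prefix (le_max_left n (i + 1))).trans (hpre c ?_)⟩
  refine (side_congr (lt_of_le_of_lt ?_ h4)).1 h2
  rw [← hcr, orbitPoint_eq α c]
  refine le_of_eq_of_le (cdist_actV α c _ _) (hD ⟨r, hr, rfl⟩)

theorem IsLocallyFiniteFamily.limitSet_stab [Finite Γ.V] (hconn : Γ.Connected)
    (hP : IsLocallyFiniteFamily α P) {S : BigClosed N} (hS : S ∈ P) :
    Boundary.limitSet (stab S) = S.toCloseds :=
  TopologicalSpace.Closeds.ext
    (Set.Subset.antisymm (limitSet_stab_subset α S) (hP.subset_limitSet_stab hconn hS))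

/-- Commensurable subgroups have equal limit sets, and the conjugate of `stab S` by `g` has limit
set `g S`. -/
theorem IsLocallyFiniteFamily.commensurator_stab [Finite Γ.V] (hconn : Γ.Connected)
    (hP : IsLocallyFiniteFamily α P) {S : BigClosed N} (hS : S ∈ P) :
    Subgroup.Commensurable.commensurator (stab S) = stab S := by
  ext g
  rw [Subgroup.Commensurable.commensurator_mem_iff]
  constructor
  · intro h
    rw [← stab_translate_eq_smul] at h
    have h1 := limitSet_eq_of_commensurable h
    rw [hP.limitSet_stab hconn hS, hP.limitSet_stab hconn (hP.translate_mem g S hS)] at h1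
    exact BigClosed.ext h1
  · intro h
    rw [← stab_translate_eq_smul, mem_stab.1 h]

theorem IsLocallyFiniteFamily.stab_ne_bot [Finite Γ.V] (hconn : Γ.Connected)
    (hP : IsLocallyFiniteFamily α P) {S : BigClosed N} (hS : S ∈ P) : stab S ≠ ⊥ := by
  intro h
  have h1 := hP.subset_limitSet_stab hconn hS
  rw [h, limitSet_bot] at h1
  obtain ⟨ξ, hξ⟩ := S.nontrivial.nonempty
  exact h1 hξ

open Classical in
-- The index is `1`, and conjugates of `stab S` correspond bijectively to translates of `S`: each is
-- the stabilizer of its limit set.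
theorem IsLocallyFiniteFamily.countingCurrent_stab [Finite Γ.V] (hconn : Γ.Connected)
    (hP : IsLocallyFiniteFamily α P) {S : BigClosed N} (hS : S ∈ P) {A : Set (BigClosed N)}
    (hA : MeasurableSet A) : countingCurrent (stab S) A =
      ∑' T : BigClosed N, if T ∈ A ∧ ∃ g, T = BigClosed.translate g S then 1 else 0 := by
  have hcomm := hP.commensurator_stab hconn hS
  have hlim := fun g => hP.limitSet_stab hconn (hP.translate_mem g S hS)
  have hrel : (stab S).relIndex (Subgroup.Commensurable.commensurator (stab S)) = 1 := by
    rw [hcomm, Subgroup.relIndex_self]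
  unfold countingCurrent
  rw [hrel, Nat.cast_one, one_smul, Measure.sum_apply _ hA]
  let φ : {C₁ : Subgroup (FreeGroup (Fin N)) //
      (∃ g, C₁ = (Subgroup.Commensurable.commensurator (stab S)).map
        (MulAut.conj g).toMonoidHom) ∧
        (Boundary.limitSet C₁ : Set (Boundary N)).Nontrivial} →
      {T : BigClosed N | ∃ g, T = BigClosed.translate g S} := fun C₁ =>
    ⟨⟨Boundary.limitSet C₁.1, C₁.2.2⟩, by
      obtain ⟨g, hg⟩ := C₁.2.1
      refine ⟨g, BigClosed.ext ?_⟩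
      change Boundary.limitSet C₁.1 = _
      rw [hg, hcomm, ← stab_translate_eq_map, hlim]⟩
  have hφ : Function.Bijective φ := by
    constructor
    · rintro ⟨C, ⟨g, hg⟩, hC⟩ ⟨C', ⟨g', hg'⟩, hC'⟩ h
      rw [hcomm] at hg hg'
      have h1 : Boundary.limitSet C = Boundary.limitSet C' :=
        congrArg (fun T => T.1.toCloseds) h
      refine Subtype.ext ?_
      change C = C'
      rw [hg, hg', ← stab_translate_eq_map, ← stab_translate_eq_map]
      rw [hg, hg', ← stab_translate_eq_map, ← stab_translate_eq_map, hlim, hlim] at h1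
      rw [BigClosed.ext h1]
    · rintro ⟨T, g, rfl⟩
      have h1 := hlim g
      rw [stab_translate_eq_map] at h1
      rw [← hcomm] at h1
      refine ⟨⟨_, ⟨g, rfl⟩, ?_⟩, Subtype.ext (BigClosed.ext h1)⟩
      rw [h1]
      exact (BigClosed.translate g S).nontrivial
  have h2 : ∀ C₁, (Measure.dirac (⟨Boundary.limitSet C₁.1, C₁.2.2⟩ : BigClosed N)) A =
      (fun T : {T : BigClosed N | ∃ g, T = BigClosed.translate g S} =>
        A.indicator (1 : BigClosed N → ℝ≥0∞) T.1) (φ C₁) := fun C₁ => Measure.dirac_apply' _ hA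
  refine (tsum_congr h2).trans (((Equiv.ofBijective φ hφ).tsum_eq (fun T =>
    A.indicator (1 : BigClosed N → ℝ≥0∞) T.1)).trans ?_)
  rw [tsum_subtype
      {T : BigClosed N | ∃ g, T = BigClosed.translate g S} (A.indicator (1 : BigClosed N → ℝ≥0∞))]
  refine tsum_congr fun T => ?_
  by_cases h3 : T ∈ A <;> by_cases h4 : ∃ g, T = BigClosed.translate g S <;>
    simp [Set.indicator, h3, h4]

end Family

/-! ### Decomposition into counting currents -/

section Decomposition

variable {N : ℕ} {Γ : SerreGraph.{u}} {p : Γ.V} {α : FreeGroup (Fin N) ≃* Γ.Pi1 p} [Finite Γ.E]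

open Classical in
theorem exists_measure_eq_sum_countingCurrent [Finite Γ.V] (hconn : Γ.Connected)
    {μ : Measure (BigClosed N)}
    (hμ : ∀ K : (Γ.cover p).Subgraph, K.IsFiniteSubtree → ∃ n : ℕ, μ (subsetCyl α K) = n)
    (hfin : ∀ e : (Γ.cover p).E, μ {S | e ∈ hullE α S} < ∞) (hne : μ ≠ 0)
    (hinv : ∀ g S, μ {BigClosed.translate g S} = μ {S}) :
    ∃ (k : ℕ) (H : Fin k → Subgroup (FreeGroup (Fin N))), 1 ≤ k ∧
      (∀ i, H i ≠ ⊥ ∧ (H i).FG) ∧ μ = ∑ i, countingCurrent (H i) := by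
  let P : Set (BigClosed N) := {S | μ {S} ≠ 0}
  have hP : IsLocallyFiniteFamily α P :=
    ⟨fun g S hS => by change μ _ ≠ 0; rw [hinv]; exact hS, finite_atoms hμ hfin⟩
  choose n hn _ using exists_natCast_eq_measure_singleton hμ
  let f : BigClosed N → Set (BigClosed N) := fun S => {T | ∃ g, T = BigClosed.translate g S}
  have hf : ∀ g S, f (BigClosed.translate g S) = f S := by
    intro g S
    ext T
    constructor
    · rintro ⟨h, rfl⟩
      exact ⟨h * g, (BigClosed.translate_mul h g S).symm⟩
    · rintro ⟨h, rfl⟩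
      refine ⟨h * g⁻¹, ?_⟩
      rw [BigClosed.translate_mul, BigClosed.translate_inv_translate]
  obtain ⟨R, hRP, hbij⟩ := Set.exists_subset_bijOn P f
  obtain ⟨s, hs⟩ := (lab_surjective (p := p) hconn).hasRightInverse
  -- Every orbit contains a set whose hull passes through one of the finitely many chosen lifts of
  -- edges of `Γ`.
  have hRfin : R.Finite := by
    refine Set.Finite.of_finite_image (f := f) ?_ hbij.injOn
    rw [hbij.image_eq]
    refine ((Set.finite_iUnion fun ε : Γ.E => hP.finite (s ε)).image f).subset ?_
    rintro _ ⟨S, hS, rfl⟩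
    obtain ⟨e, he⟩ := hullE_nonempty α S
    obtain ⟨g, hg⟩ := exists_actE_eq α (hs (lab e)).symm
    refine ⟨BigClosed.translate g S, Set.mem_iUnion.2 ⟨lab e, ?_, hP.translate_mem g S hS⟩, hf g S⟩
    rw [← hg]
    exact hullE_translate.2 he
  have : Fintype R := hRfin.fintype
  -- The family lists the stabilizer of each orbit representative with its multiplicity.
  let e := Fintype.equivFin (Σ S : R, Fin (n S.1))
  have hsum : μ = ∑ i, countingCurrent (stab (e.symm i).1.1) := by
    refine Measure.ext fun A hA => ?_
    rw [Measure.finsetSum_apply, e.symm.sum_comp (fun x => countingCurrent (stab x.1.1) A),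
      Fintype.sum_sigma, measure_eq_tsum_atoms hμ hfin]
    have h1 : ∀ S : R, ∑ _i : Fin (n S.1), countingCurrent (stab S.1) A =
        ∑' T : BigClosed N, n S.1 *
          if T ∈ A ∧ ∃ g, T = BigClosed.translate g S.1 then (1 : ℝ≥0∞) else 0 := by
      intro S
      rw [Finset.sum_const, Finset.card_univ, Fintype.card_fin, nsmul_eq_mul,
        hP.countingCurrent_stab hconn (hRP S.2) hA, ENNReal.tsum_mul_left]
    rw [Finset.sum_congr rfl fun S _ => h1 S, ← Summable.tsum_finsetSum fun S _ => ENNReal.summable]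
    refine tsum_congr fun T => ?_
    by_cases hTA : T ∈ A
    · rw [Set.indicator_of_mem hTA]
      simp only [hTA, true_and]
      by_cases hT : T ∈ P
      · obtain ⟨S, hS, hST⟩ := hbij.surjOn ⟨T, hT, rfl⟩
        obtain ⟨g, hg⟩ : T ∈ f S := by
          rw [hST]
          exact ⟨1, (BigClosed.translate_one T).symm⟩
        rw [Finset.sum_eq_single ⟨S, hS⟩]
        · rw [if_pos ⟨g, hg⟩, mul_one, ← hn S, hg, hinv]
        · rintro ⟨S', hS'⟩ - hne'
          rw [if_neg, mul_zero]
          rintro ⟨h, hh⟩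
          refine hne' (Subtype.ext (hbij.injOn hS' hS ?_))
          change f S' = f S
          rw [hST, hh, hf]
        · intro h; exact absurd (Finset.mem_univ _) h
      · have hT0 : μ {T} = 0 := not_not.1 hT
        rw [hT0]
        refine (Finset.sum_eq_zero fun S _ => ?_).symm
        rw [if_neg, mul_zero]
        rintro ⟨g, rfl⟩
        exact hT (hP.translate_mem g _ (hRP S.2))
    · rw [Set.indicator_of_notMem hTA]
      simp [hTA]
  refine ⟨_, fun i => stab (e.symm i).1.1, ?_, fun i => ?_, hsum⟩
  · by_contra hk
    have hk0 : Fintype.card (Σ S : R, Fin (n S.1)) = 0 := by omega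
    refine hne (hsum.trans (Finset.sum_eq_zero fun i _ => ?_))
    exact absurd i.2 (by omega)
  · exact ⟨hP.stab_ne_bot hconn (hRP (e.symm i).1.2), hP.stab_fg hconn (hRP (e.symm i).1.2)⟩

end Decomposition

/-! ### The quotient graph of a family of convex hulls -/

section HullGraph

variable {N : ℕ} {Γ : SerreGraph.{u}} {p : Γ.V} (α : FreeGroup (Fin N) ≃* Γ.Pi1 p)
  (n : BigClosed N → ℕ)

/-- A vertex of one of the `n S` copies of the convex hull of `S`. -/
structure HullVertex where
  S : BigClosed N
  i : ℕ
  x : (Γ.cover p).V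
  lt : i < n S
  mem : x ∈ hullV α S

/-- An edge of one of the `n S` copies of the convex hull of `S`. -/
structure HullEdge where
  S : BigClosed N
  i : ℕ
  e : (Γ.cover p).E
  lt : i < n S
  mem : e ∈ hullE α S

/-- The orbit relation on the vertices of convex hulls. -/
def hullVertexSetoid : Setoid (HullVertex α n) where
  r a b := ∃ g, BigClosed.translate g a.S = b.S ∧ a.i = b.i ∧ actV α g a.x = b.x
  iseqv := by
    refine ⟨fun a => ⟨1, BigClosed.translate_one _, rfl, actV_one α _⟩, ?_, ?_⟩
    · rintro a b ⟨g, h1, h2, h3⟩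
      exact ⟨g⁻¹, by rw [← h1, BigClosed.translate_inv_translate], h2.symm,
        by rw [← h3, actV_inv_actV]⟩
    · rintro a b c ⟨g, h1, h2, h3⟩ ⟨h, h4, h5, h6⟩
      exact ⟨h * g, by rw [BigClosed.translate_mul, h1, h4], h2.trans h5,
        by rw [actV_mul, h3, h6]⟩

/-- The orbit relation on the edges of convex hulls. -/
def hullEdgeSetoid : Setoid (HullEdge α n) where
  r a b := ∃ g, BigClosed.translate g a.S = b.S ∧ a.i = b.i ∧ actE α g a.e = b.e
  iseqv := by
    refine ⟨fun a => ⟨1, BigClosed.translate_one _, rfl, actE_one α _⟩, ?_, ?_⟩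
    · rintro a b ⟨g, h1, h2, h3⟩
      exact ⟨g⁻¹, by rw [← h1, BigClosed.translate_inv_translate], h2.symm,
        by rw [← h3, actE_inv_actE]⟩
    · rintro a b c ⟨g, h1, h2, h3⟩ ⟨h, h4, h5, h6⟩
      exact ⟨h * g, by rw [BigClosed.translate_mul, h1, h4], h2.trans h5,
        by rw [actE_mul, h3, h6]⟩

/-- The origin of an edge of a convex hull. -/
def HullEdge.origin (a : HullEdge α n) : HullVertex α n :=
  ⟨a.S, a.i, (Γ.cover p).o a.e, a.lt, o_mem_hullV a.mem⟩

/-- The inverse of an edge of a convex hull. -/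
def HullEdge.reverse (a : HullEdge α n) : HullEdge α n :=
  ⟨a.S, a.i, (Γ.cover p).inv a.e, a.lt, inv_mem_hullE a.mem⟩

/-- The label of an orbit of edges of convex hulls. -/
def hullEdgeLabel : Quotient (hullEdgeSetoid α n) → Γ.E :=
  Quotient.lift (fun a => lab a.e) (by
    rintro a b ⟨g, -, -, h⟩
    rw [← h, lab_actE])

/-- The label of an orbit of vertices of convex hulls. -/
def hullVertexLabel : Quotient (hullVertexSetoid α n) → Γ.V :=
  Quotient.lift (fun a => ver a.x) (by
    rintro a b ⟨g, -, -, h⟩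
    rw [← h, ver_actV])

/-- The inversion of orbits of edges of convex hulls. -/
def hullEdgeInv : Quotient (hullEdgeSetoid α n) → Quotient (hullEdgeSetoid α n) :=
  Quotient.map (HullEdge.reverse α n) (by
    rintro a b ⟨g, h1, h2, h3⟩
    exact ⟨g, h1, h2, (actE_inv α g a.e).trans (congrArg _ h3)⟩)

/-- The origins of orbits of edges of convex hulls. -/
def hullEdgeOrigin : Quotient (hullEdgeSetoid α n) → Quotient (hullVertexSetoid α n) :=
  Quotient.map (HullEdge.origin α n) (by
    rintro a b ⟨g, h1, h2, h3⟩
    exact ⟨g, h1, h2, congrArg (Γ.cover p).o h3⟩)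

/-- The quotient by the free group of the disjoint union of `n S` copies of the convex hull
of `S`, for all `S`. -/
def hullGraph : SerreGraph.{u} where
  V := Quotient (hullVertexSetoid α n)
  E := Quotient (hullEdgeSetoid α n)
  o := hullEdgeOrigin α n
  inv := hullEdgeInv α n
  inv_inv e := by
    induction e using Quotient.ind with
    | _ a =>
      refine congrArg (Quotient.mk _) ?_
      obtain ⟨S, i, e, _, _⟩ := a
      simp [HullEdge.reverse, SerreGraph.inv_inv]
  inv_ne e h := by
    induction e using Quotient.ind with
    | _ a => exact Γ.inv_ne (lab a.e) (congrArg (hullEdgeLabel α n) h)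

/-- The labelling of the quotient graph. -/
def hullGraphLabel : Hom (hullGraph α n) Γ where
  onV := hullVertexLabel α n
  onE := hullEdgeLabel α n
  map_o e := by
    induction e using Quotient.ind with
    | _ a => exact (o_lab a.e).symm
  map_inv e := by
    induction e using Quotient.ind with
    | _ a => rfl

variable {α n}

/-- The orbit of a vertex. -/
def hullGraphV (S : BigClosed N) (i : ℕ) (x : (Γ.cover p).V) (hi : i < n S)
    (hx : x ∈ hullV α S) : (hullGraph α n).V :=
  Quotient.mk (hullVertexSetoid α n) ⟨S, i, x, hi, hx⟩

/-- The orbit of an edge. -/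
def hullGraphE (S : BigClosed N) (i : ℕ) (e : (Γ.cover p).E) (hi : i < n S)
    (he : e ∈ hullE α S) : (hullGraph α n).E :=
  Quotient.mk (hullEdgeSetoid α n) ⟨S, i, e, hi, he⟩

theorem exists_hullGraphV (v : (hullGraph α n).V) : ∃ S i x hi hx,
    v = hullGraphV S i x hi hx := by
  induction v using Quotient.ind with
  | _ a => exact ⟨a.S, a.i, a.x, a.lt, a.mem, rfl⟩

theorem exists_hullGraphE (v : (hullGraph α n).E) : ∃ S i e hi he,
    v = hullGraphE S i e hi he := by
  induction v using Quotient.ind with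
  | _ a => exact ⟨a.S, a.i, a.e, a.lt, a.mem, rfl⟩

theorem hullGraphV_eq_iff {S T : BigClosed N} {i j : ℕ} {x y : (Γ.cover p).V} {hi : i < n S}
    {hx : x ∈ hullV α S} {hj : j < n T} {hy : y ∈ hullV α T} :
    hullGraphV S i x hi hx = hullGraphV T j y hj hy ↔
      ∃ g, BigClosed.translate g S = T ∧ i = j ∧ actV α g x = y :=
  ⟨fun h => Quotient.exact h, fun h => Quotient.sound h⟩

theorem hullGraphE_eq_iff {S T : BigClosed N} {i j : ℕ} {x y : (Γ.cover p).E} {hi : i < n S}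
    {hx : x ∈ hullE α S} {hj : j < n T} {hy : y ∈ hullE α T} :
    hullGraphE S i x hi hx = hullGraphE T j y hj hy ↔
      ∃ g, BigClosed.translate g S = T ∧ i = j ∧ actE α g x = y :=
  ⟨fun h => Quotient.exact h, fun h => Quotient.sound h⟩

theorem o_hullGraphE {S : BigClosed N} {i : ℕ} {e : (Γ.cover p).E} {hi : i < n S}
    {he : e ∈ hullE α S} : (hullGraph α n).o (hullGraphE S i e hi he) =
      hullGraphV S i ((Γ.cover p).o e) hi (o_mem_hullV he) := rfl

theorem inv_hullGraphE {S : BigClosed N} {i : ℕ} {e : (Γ.cover p).E} {hi : i < n S}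
    {he : e ∈ hullE α S} : (hullGraph α n).inv (hullGraphE S i e hi he) =
      hullGraphE S i ((Γ.cover p).inv e) hi (inv_mem_hullE he) := rfl

theorem label_hullGraphE {S : BigClosed N} {i : ℕ} {e : (Γ.cover p).E} {hi : i < n S}
    {he : e ∈ hullE α S} : (hullGraphLabel α n).onE (hullGraphE S i e hi he) = lab e := rfl

theorem label_hullGraphV {S : BigClosed N} {i : ℕ} {x : (Γ.cover p).V} {hi : i < n S}
    {hx : x ∈ hullV α S} : (hullGraphLabel α n).onV (hullGraphV S i x hi hx) = ver x := rfl

theorem hullGraph_o_surjective : Function.Surjective (hullGraph α n).o := by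
  intro v
  obtain ⟨S, i, x, hi, ⟨e, he, rfl⟩, rfl⟩ := exists_hullGraphV v
  exact ⟨hullGraphE S i e hi he, rfl⟩

variable [Finite Γ.E]

/-- Edges of the quotient graph with given origin and label are orbits of edges of the
given hull. -/
theorem exists_eq_hullGraphE {c : (hullGraph α n).E} {S : BigClosed N} {i : ℕ}
    {x : (Γ.cover p).V} {hi : i < n S} {hx : x ∈ hullV α S}
    (h : (hullGraph α n).o c = hullGraphV S i x hi hx) :
    ∃ e he, (Γ.cover p).o e = x ∧ c = hullGraphE S i e hi he := by
  obtain ⟨S', i', e', hi', he', rfl⟩ := exists_hullGraphE c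
  rw [o_hullGraphE, hullGraphV_eq_iff] at h
  obtain ⟨g, rfl, rfl, rfl⟩ := h
  exact ⟨actE α g e', hullE_translate.2 he', rfl, hullGraphE_eq_iff.2 ⟨g, rfl, rfl, rfl⟩⟩

theorem hullGraph_folded : Folded (hullGraphLabel α n) := by
  intro c c' h h'
  obtain ⟨S, i, e, hi, he, rfl⟩ := exists_hullGraphE c'
  obtain ⟨f, hf, h1, rfl⟩ := exists_eq_hullGraphE (h.trans o_hullGraphE)
  rw [label_hullGraphE, label_hullGraphE] at h'
  have := cover_edge_ext h1 h'
  subst this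
  rfl

/-- Each orbit of edges can be translated onto the chosen lift of its label, where finitely many
sets and copies compete. -/
theorem finite_hullGraph_edges (hconn : Γ.Connected)
    (hfin : ∀ e : (Γ.cover p).E, {S | e ∈ hullE α S ∧ n S ≠ 0}.Finite)
    (hn : ∀ g S, n (BigClosed.translate g S) = n S) : Finite (hullGraph α n).E := by
  obtain ⟨s, hs⟩ := (lab_surjective (p := p) hconn).hasRightInverse
  have hfin' : ∀ ε : Γ.E,
      Finite {q : BigClosed N × ℕ // q.2 < n q.1 ∧ s ε ∈ hullE α q.1} := by
    intro ε
    refine Set.Finite.to_subtype (s := {q : BigClosed N × ℕ | q.2 < n q.1 ∧ s ε ∈ hullE α q.1}) ?_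
    refine ((hfin (s ε)).biUnion fun S _ =>
      (Set.finite_singleton S).prod (Set.finite_Iio (n S))).subset ?_
    rintro ⟨S, i⟩ ⟨h1, h2⟩
    exact Set.mem_iUnion₂.2 ⟨S, ⟨h2, by dsimp only at h1; omega⟩, rfl, h1⟩
  let F : (Σ ε : Γ.E, {q : BigClosed N × ℕ // q.2 < n q.1 ∧ s ε ∈ hullE α q.1}) →
      (hullGraph α n).E := fun a => hullGraphE a.2.1.1 a.2.1.2 (s a.1) a.2.2.1 a.2.2.2
  refine Finite.of_surjective F fun c => ?_
  obtain ⟨S, i, e, hi, he, rfl⟩ := exists_hullGraphE c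
  obtain ⟨g, hg⟩ := exists_actE_eq α (hs (lab e))
  have h1 : e ∈ hullE α (BigClosed.translate g (BigClosed.translate g⁻¹ S)) := by
    rwa [BigClosed.translate_translate_inv]
  rw [← hg, hullE_translate] at h1
  refine ⟨⟨lab e, (BigClosed.translate g⁻¹ S, i), by rwa [hn], h1⟩, ?_⟩
  exact hullGraphE_eq_iff.2 ⟨g, BigClosed.translate_translate_inv g S, rfl, hg⟩

theorem two_le_degree_hullGraph [Finite (hullGraph α n).E] (v : (hullGraph α n).V) :
    2 ≤ (hullGraph α n).degree v := by
  obtain ⟨S, i, x, hi, hx, rfl⟩ := exists_hullGraphV v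
  obtain ⟨e, he, f, hf, h1, h2, hne⟩ := exists_two_hullE hx
  subst h1
  refine Finite.one_lt_card_iff_nontrivial.2 ⟨⟨hullGraphE S i e hi he, rfl⟩,
    ⟨hullGraphE S i f hi hf, ?_⟩, fun h => ?_⟩
  · exact hullGraphV_eq_iff.2 ⟨1, BigClosed.translate_one S, rfl, by rw [actV_one, h2]⟩
  · have h3 := congrArg (hullGraphLabel α n).onE (congrArg Subtype.val h)
    exact hne (cover_edge_ext h2.symm h3)

theorem hullGraph_isFiniteCyclicallyReduced (hconn : Γ.Connected)
    (hfin : ∀ e : (Γ.cover p).E, {S | e ∈ hullE α S ∧ n S ≠ 0}.Finite)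
    (hn : ∀ g S, n (BigClosed.translate g S) = n S) (hne : ∃ S, n S ≠ 0) :
    IsFiniteCyclicallyReduced (hullGraphLabel α n) := by
  have hE := finite_hullGraph_edges hconn hfin hn
  refine ⟨?_, Finite.of_surjective _ hullGraph_o_surjective, hE, hullGraph_folded,
    two_le_degree_hullGraph⟩
  obtain ⟨S, hS⟩ := hne
  obtain ⟨x, hx⟩ := hullV_nonempty (α := α) S
  exact ⟨hullGraphV S 0 x (Nat.pos_of_ne_zero hS) hx⟩

/-! ### Occurrences in the quotient graph -/

theorem SerreGraph.Occurrence.ext_maps {K D Γ : SerreGraph.{u}} {σ : Hom K Γ} {τ : Hom D Γ}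
    {f g : Occurrence σ τ} (hV : ∀ x, f.onV x = g.onV x) (hE : ∀ e, f.onE e = g.onE e) :
    f = g := by
  obtain ⟨⟨fV, fE, _, _⟩, _, _, _⟩ := f
  obtain ⟨⟨gV, gE, _, _⟩, _, _, _⟩ := g
  obtain rfl : fV = gV := funext hV
  obtain rfl : fE = gE := funext hE
  rfl

theorem SerreGraph.Subgraph.exists_edge_at {G : SerreGraph.{u}} (hG : G.IsTree) {K : G.Subgraph}
    (hK : K.IsFiniteSubtree) {x : G.V} (hx : x ∈ K.verts) : ∃ e ∈ K.edges, G.o e = x := by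
  obtain ⟨e, he⟩ := hK.nondegenerate
  by_cases h : x = G.o e
  · exact ⟨e, he, h.symm⟩
  · obtain ⟨f, hf, l, hl⟩ := exists_side (hG := hG) h
    refine ⟨f, K.geo_subset (hG := hG) hK.connected hx (K.o_mem e he) ?_, hf⟩
    rw [← hf, hl]
    exact List.mem_cons_self

theorem SerreGraph.Subgraph.two_le_degree_of_notMem_terminalEdges {G : SerreGraph.{u}}
    {K : G.Subgraph} (hK : K.IsFiniteSubtree) {e : G.E} (he : e ∈ K.edges)
    (ht : e ∉ K.terminalEdges) : 2 ≤ K.coe.degree (Subgraph.mkV (K.t_mem he)) := by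
  obtain ⟨f, hf, h1, h2⟩ := Subgraph.exists_continuation he ht
  have : Finite K.coe.E := hK.finite_edges.to_subtype
  refine Finite.one_lt_card_iff_nontrivial.2
    ⟨⟨Subgraph.mkE hf, Subtype.ext h1⟩, ⟨Subgraph.mkE (K.inv_mem e he), rfl⟩, fun h => h2 ?_⟩
  exact congrArg (fun a => Subgraph.valE a.1) h

theorem SerreGraph.Subgraph.exists_notMem_terminalEdges_of_degree {G : SerreGraph.{u}}
    {K : G.Subgraph} (hK : K.IsFiniteSubtree) {x : K.coe.V} (h : 2 ≤ K.coe.degree x) :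
    ∃ e ∈ K.edges, G.t e = Subgraph.valV x ∧ e ∉ K.terminalEdges := by
  have : Finite K.coe.E := hK.finite_edges.to_subtype
  obtain ⟨⟨e, he⟩, ⟨f, hf⟩, hne⟩ := Finite.one_lt_card_iff_nontrivial.1 h
  refine ⟨G.inv (Subgraph.valE e), K.inv_mem _ (Subgraph.valE_mem e), ?_, fun ht => hne ?_⟩
  · rw [t_inv]
    exact congrArg Subgraph.valV he
  · have h1 := ht.2 (Subgraph.valE f) (Subgraph.valE_mem f) (by
      rw [t_inv]
      exact congrArg Subgraph.valV (hf.trans he.symm))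
    rw [SerreGraph.inv_inv] at h1
    exact Subtype.ext (Subgraph.valE_injective h1.symm)

theorem natCard_eq_of_subsingleton {A B : Type*} [Subsingleton A] [Subsingleton B]
    (f : A → B) (g : Nonempty B → Nonempty A) : Nat.card A = Nat.card B := by
  rcases isEmpty_or_nonempty A with h | h
  · have : IsEmpty B := ⟨fun b => (g ⟨b⟩).elim fun a => h.elim a⟩
    simp
  · obtain ⟨a⟩ := h
    exact Nat.card_congr ⟨f, fun _ => a, fun _ => Subsingleton.elim _ _,
      fun _ => Subsingleton.elim _ _⟩

theorem SerreGraph.Folded.subsingleton {D Γ : SerreGraph.{u}} {τ : Hom D Γ} (h : Folded τ)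
    (x : D.V) (a : Γ.E) : Subsingleton {e : D.E // D.o e = x ∧ τ.onE e = a} :=
  ⟨fun e f => Subtype.ext (h _ _ (e.2.1.trans f.2.1.symm) (e.2.2.trans f.2.2.symm))⟩

theorem SerreGraph.Subgraph.label_folded {Γ : SerreGraph.{u}} {p : Γ.V}
    (K : (Γ.cover p).Subgraph) : Folded K.label := fun _ _ h h' =>
  Subgraph.valE_injective (cover_edge_ext (congrArg Subgraph.valV h) h')

/-- Both labellings are folded, so the links only record which labels occur; at an interior vertex
of `K` the cylinder condition says the hull has no further edges. -/
theorem link_label_eq {K : (Γ.cover p).Subgraph} (hK : K.IsFiniteSubtree) {S : BigClosed N}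
    (hS : S ∈ subsetCyl α K) {i : ℕ} (hi : i < n S) {x : K.coe.V}
    (hx : Subgraph.valV x ∈ hullV α S) (h : 2 ≤ K.coe.degree x) :
    link K.label x = link (hullGraphLabel α n) (hullGraphV S i (Subgraph.valV x) hi hx) := by
  rw [mem_subsetCyl_iff hK] at hS
  obtain ⟨e, he, hex, ht⟩ := Subgraph.exists_notMem_terminalEdges_of_degree hK h
  funext a
  have h1 := K.label_folded.subsingleton x a
  have h2 := (hullGraph_folded (α := α) (n := n)).subsingleton
    (hullGraphV S i (Subgraph.valV x) hi hx) a
  refine natCard_eq_of_subsingleton (fun f =>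
    ⟨hullGraphE S i (Subgraph.valE f.1) hi (hS.1 (Subgraph.valE_mem f.1)), ?_, ?_⟩) ?_
  · have h3 : (Γ.cover p).o (Subgraph.valE f.1) = Subgraph.valV x :=
      congrArg Subgraph.valV f.2.1
    exact hullGraphV_eq_iff.2 ⟨1, BigClosed.translate_one S, rfl, by rw [actV_one, h3]⟩
  · exact f.2.2
  · rintro ⟨c, hc1, hc2⟩
    obtain ⟨f, hf, h3, rfl⟩ := exists_eq_hullGraphE hc1
    have hfK := hS.2 e he ht f hf (h3.trans hex.symm)
    exact ⟨⟨Subgraph.mkE hfK, Subtype.ext h3, hc2⟩⟩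

theorem vert_mem_hullV {K : (Γ.cover p).Subgraph} (hK : K.IsFiniteSubtree) {S : BigClosed N}
    (hS : S ∈ subsetCyl α K) (x : K.coe.V) : Subgraph.valV x ∈ hullV α S := by
  obtain ⟨e, he, h⟩ := Subgraph.exists_edge_at (cover_isTree p) hK (Subgraph.valV_mem x)
  exact ⟨e, ((mem_subsetCyl_iff hK).1 hS).1 he, h⟩

/-- The occurrence of `K` in the quotient graph given by a copy of the hull of `S`. -/
def hullOccurrence {K : (Γ.cover p).Subgraph} (hK : K.IsFiniteSubtree)
    (q : {q : BigClosed N × ℕ // q.2 < n q.1 ∧ q.1 ∈ subsetCyl α K}) :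
    Occurrence K.label (hullGraphLabel α n) where
  onV x := hullGraphV q.1.1 q.1.2 (Subgraph.valV x) q.2.1 (vert_mem_hullV hK q.2.2 x)
  onE e := hullGraphE q.1.1 q.1.2 (Subgraph.valE e) q.2.1
    (((mem_subsetCyl_iff hK).1 q.2.2).1 (Subgraph.valE_mem e))
  map_o _ := rfl
  map_inv _ := rfl
  label_onV _ := rfl
  label_onE _ := rfl
  link_eq _ h := link_label_eq hK q.2.2 q.2.1 _ h

/-- An element identifying two images of the same vertex of `K` fixes that vertex, so it is trivial.
-/
theorem hullOccurrence_injective {K : (Γ.cover p).Subgraph} (hK : K.IsFiniteSubtree) :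
    Function.Injective (hullOccurrence (α := α) (n := n) hK) := by
  rintro ⟨⟨S, i⟩, hq⟩ ⟨⟨T, j⟩, hq'⟩ h
  obtain ⟨x⟩ := hK.connected.1
  have h1 := congrArg (fun f : Occurrence K.label (hullGraphLabel α n) => f.onV x) h
  obtain ⟨g, h2, h3, h4⟩ := hullGraphV_eq_iff.1 h1
  dsimp only at h2 h3
  obtain rfl := actV_free α h4
  rw [BigClosed.translate_one] at h2
  exact Subtype.ext (Prod.ext h2 h3)

/-- After a translation the image of one vertex `x₀` is represented by `x₀` itself in some hull
copy. Labels then determine the lift along paths of `K`, and preservation of links excludes extra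
hull edges at interior vertices. -/
theorem hullOccurrence_surjective (hE : Finite (hullGraph α n).E)
    (hn : ∀ g S, n (BigClosed.translate g S) = n S) {K : (Γ.cover p).Subgraph}
    (hK : K.IsFiniteSubtree) : Function.Surjective (hullOccurrence (α := α) (n := n) hK) := by
  intro f
  obtain ⟨x₀⟩ := hK.connected.1
  obtain ⟨S, i, hi, hx₀, h0⟩ : ∃ S i, ∃ (hi : i < n S) (hx : Subgraph.valV x₀ ∈ hullV α S),
      f.onV x₀ = hullGraphV S i (Subgraph.valV x₀) hi hx := by
    obtain ⟨S, i, y, hi, hy, h⟩ := exists_hullGraphV (f.onV x₀)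
    have h1 := f.label_onV x₀
    rw [h, label_hullGraphV] at h1
    obtain ⟨g, hg⟩ : ∃ g, actV α g y = Subgraph.valV x₀ := exists_actV_eq α h1
    refine ⟨BigClosed.translate g S, i, by rwa [hn], ?_, ?_⟩
    · rw [← hg]; exact hullV_translate.2 hy
    · rw [h]; exact hullGraphV_eq_iff.2 ⟨g, rfl, rfl, hg⟩
  have hstep : ∀ (e : K.coe.E) (hx : Subgraph.valV (K.coe.o e) ∈ hullV α S),
      f.onV (K.coe.o e) = hullGraphV S i (Subgraph.valV (K.coe.o e)) hi hx →
      ∃ he : Subgraph.valE e ∈ hullE α S, f.onE e = hullGraphE S i (Subgraph.valE e) hi he := by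
    intro e hx h
    rw [f.map_o] at h
    obtain ⟨c, hc, h1, h2⟩ := exists_eq_hullGraphE h
    have h3 := f.label_onE e
    rw [h2, label_hullGraphE] at h3
    have : c = Subgraph.valE e := cover_edge_ext h1 h3
    subst this
    exact ⟨hc, h2⟩
  have hpath : ∀ (l : List K.coe.E) (a b : K.coe.V), K.coe.IsPath a l b →
      (∃ hx, f.onV a = hullGraphV S i (Subgraph.valV a) hi hx) →
      ∃ hx, f.onV b = hullGraphV S i (Subgraph.valV b) hi hx := by
    intro l
    induction l with
    | nil => intro a b h ha; have h : a = b := h; rwa [← h]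
    | cons e l ih =>
      rintro a b ⟨rfl, h⟩ ⟨hx, ha⟩
      obtain ⟨he, h1⟩ := hstep e hx ha
      refine ih _ _ h ⟨t_mem_hullV he, ?_⟩
      change f.onV (K.coe.o (K.coe.inv e)) = _
      rw [f.map_o, f.map_inv, h1, inv_hullGraphE, o_hullGraphE]
      rfl
  have hV : ∀ x, ∃ hx, f.onV x = hullGraphV S i (Subgraph.valV x) hi hx := by
    intro x
    obtain ⟨l, hl⟩ := hK.connected.2 x₀ x
    exact hpath l _ _ hl ⟨hx₀, h0⟩
  have hE' : ∀ e, ∃ he, f.onE e = hullGraphE S i (Subgraph.valE e) hi he := by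
    intro e
    obtain ⟨hx, h⟩ := hV (K.coe.o e)
    exact hstep e hx h
  have hS : S ∈ subsetCyl α K := by
    rw [mem_subsetCyl_iff hK]
    refine ⟨fun e he => (hE' (Subgraph.mkE he)).1, fun e he ht c hc h => ?_⟩
    have h1 := f.link_eq _ (Subgraph.two_le_degree_of_notMem_terminalEdges hK he ht)
    obtain ⟨hx, h2⟩ := hV (Subgraph.mkV (K.t_mem he))
    have h3 : link (hullGraphLabel α n) (f.onV (Subgraph.mkV (K.t_mem he))) (lab c) ≠ 0 := by
      have : Nonempty {d : (hullGraph α n).E //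
          (hullGraph α n).o d = f.onV (Subgraph.mkV (K.t_mem he)) ∧
          (hullGraphLabel α n).onE d = lab c} := by
        refine ⟨hullGraphE S i c hi hc, ?_, rfl⟩
        rw [h2]
        exact hullGraphV_eq_iff.2 ⟨1, BigClosed.translate_one S, rfl, by rw [actV_one, h]; rfl⟩
      exact (Nat.card_pos).ne'
    rw [← h1] at h3
    obtain ⟨⟨d, hd1, hd2⟩⟩ := (Nat.card_ne_zero.1 h3).1
    have h4 : (Γ.cover p).o (Subgraph.valE d) = (Γ.cover p).t e :=
      congrArg Subgraph.valV hd1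
    have h5 : Subgraph.valE d = c := cover_edge_ext (h4.trans h.symm) hd2
    rw [← h5]
    exact Subgraph.valE_mem d
  refine ⟨⟨(S, i), hi, hS⟩, Occurrence.ext_maps (fun x => ?_) fun e => ?_⟩
  · exact (hV x).2.symm
  · exact (hE' e).2.symm

theorem natCard_occurrence (hconn : Γ.Connected)
    (hfin : ∀ e : (Γ.cover p).E, {S | e ∈ hullE α S ∧ n S ≠ 0}.Finite)
    (hn : ∀ g S, n (BigClosed.translate g S) = n S) {K : (Γ.cover p).Subgraph}
    (hK : K.IsFiniteSubtree) :
    (Nat.card (Occurrence K.label (hullGraphLabel α n)) : ℝ≥0∞) =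
      ∑' S : BigClosed N, (subsetCyl α K).indicator (fun S => (n S : ℝ≥0∞)) S := by
  have hE := finite_hullGraph_edges hconn hfin hn
  rw [← Nat.card_congr (Equiv.ofBijective _
    ⟨hullOccurrence_injective (α := α) (n := n) hK, hullOccurrence_surjective hE hn hK⟩)]
  obtain ⟨e, he⟩ := hK.nondegenerate
  -- All these hulls contain one fixed edge of `K`, so the sum has finite support.
  have hA : {S | S ∈ subsetCyl α K ∧ n S ≠ 0}.Finite := (hfin e).subset fun S hS =>
    ⟨((mem_subsetCyl_iff hK).1 hS.1).1 he, hS.2⟩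
  have hcard : Nat.card {q : BigClosed N × ℕ // q.2 < n q.1 ∧ q.1 ∈ subsetCyl α K} =
      ∑ S ∈ hA.toFinset, n S := by
    have : {q : BigClosed N × ℕ | q.2 < n q.1 ∧ q.1 ∈ subsetCyl α K} =
        ((hA.toFinset.sigma fun S => Finset.range (n S)).map
          (Equiv.sigmaEquivProd (BigClosed N) ℕ).toEmbedding : Set (BigClosed N × ℕ)) := by
      ext ⟨S, i⟩
      simp only [Set.mem_ofPred_eq, Finset.coe_map, Set.mem_image, Finset.mem_coe,
        Finset.mem_sigma, Set.Finite.mem_toFinset, Finset.mem_range]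
      constructor
      · rintro ⟨h1, h2⟩
        exact ⟨⟨S, i⟩, ⟨⟨h2, Nat.ne_zero_of_lt h1⟩, h1⟩, rfl⟩
      · rintro ⟨⟨T, j⟩, ⟨⟨h1, h2⟩, h3⟩, h4⟩
        obtain ⟨rfl, rfl⟩ := Prod.mk.inj h4
        exact ⟨h3, h1⟩
    change Nat.card ({q : BigClosed N × ℕ | q.2 < n q.1 ∧ q.1 ∈ subsetCyl α K} : Set _) = _
    rw [this, Nat.card_coe_set_eq, Set.ncard_coe_finset, Finset.card_map, Finset.card_sigma]
    simp
  rw [hcard, tsum_eq_sum (s := hA.toFinset), Nat.cast_sum]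
  · refine Finset.sum_congr rfl fun S hS => ?_
    rw [Set.indicator_of_mem ((Set.Finite.mem_toFinset hA).1 hS).1]
  · intro S hS
    by_cases h : S ∈ subsetCyl α K
    · rw [Set.indicator_of_mem h]
      have : n S = 0 := by
        by_contra h'
        exact hS ((Set.Finite.mem_toFinset hA).2 ⟨h, h'⟩)
      rw [this, Nat.cast_zero]
    · exact Set.indicator_of_notMem h _

end HullGraph

end SubsetCurrents

/-! ### The main theorem -/

theorem theorem4p6 (N : ℕ) (hN : 2 ≤ N)
    (Γ : SerreGraph.{u}) (hV : Finite Γ.V) (hE : Finite Γ.E) (hconn : Γ.Connected)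
    (hdeg : ∀ v : Γ.V, Γ.degree v ≠ 1)
    (p : Γ.V) (α : FreeGroup (Fin N) ≃* Γ.Pi1 p)
    (μ : SubsetCurrent N) (hμ : μ.toMeasure ≠ 0)
    (hint : ∀ K : (Γ.cover p).Subgraph, K.IsFiniteSubtree →
      ∃ m : ℤ, (weight α K μ).toReal = (m : ℝ)) :
    (∃ (D : SerreGraph.{u}) (τ : D.Hom Γ),
      SerreGraph.IsFiniteCyclicallyReduced τ ∧ IsCurrentOfGraph α τ μ) ∧
    (∃ (k : ℕ) (H : Fin k → Subgroup (FreeGroup (Fin N))), 1 ≤ k ∧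
      (∀ i, H i ≠ ⊥ ∧ (H i).FG) ∧
      μ.toMeasure = ∑ i, countingCurrent (H i)) := by
  have hfin : ∀ ν : SubsetCurrent N, ∀ e : (Γ.cover p).E,
      ν.toMeasure {S | e ∈ hullE α S} < ∞ := fun ν e =>
    ν.finite_of_isCompact _ (isCompact_setOf_mem_hullE α e)
  have hnat : ∀ K : (Γ.cover p).Subgraph, K.IsFiniteSubtree →
      ∃ n : ℕ, μ.toMeasure (subsetCyl α K) = n := by
    intro K hK
    obtain ⟨e, he⟩ := hK.nondegenerate
    -- Finiteness must be known first: `toReal` sends `∞` to `0`, so the integrality hypothesis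
    -- alone would not exclude an infinite weight.
    have hlt : μ.toMeasure (subsetCyl α K) < ∞ :=
      (measure_mono fun S hS => ((mem_subsetCyl_iff hK).1 hS).1 he).trans_lt (hfin μ e)
    obtain ⟨m, hm⟩ := hint K hK
    have hm0 : 0 ≤ m := by
      have : (0 : ℝ) ≤ m := hm ▸ ENNReal.toReal_nonneg
      exact_mod_cast this
    obtain ⟨k, rfl⟩ := Int.eq_ofNat_of_zero_le hm0
    refine ⟨k, ?_⟩
    rw [← ENNReal.ofReal_toReal hlt.ne]
    change ENNReal.ofReal (weight α K μ).toReal = _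
    rw [hm]
    simp
  have hinv : ∀ g S, μ.toMeasure {BigClosed.translate g S} = μ.toMeasure {S} := by
    intro g S
    rw [← μ.invariant g _ (measurableSet_singleton _)]
    congr 1
    ext T
    constructor
    · intro h
      have h : BigClosed.translate g T = BigClosed.translate g S := h
      have := congrArg (BigClosed.translate g⁻¹) h
      rwa [BigClosed.translate_inv_translate, BigClosed.translate_inv_translate] at this
    · intro h
      have h : T = S := h
      rw [h]; exact rfl
  refine ⟨?_, exists_measure_eq_sum_countingCurrent hconn hnat (hfin μ) hμ hinv⟩
  choose n hn _ using exists_natCast_eq_measure_singleton hnat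
  have hn0 : ∀ S, n S ≠ 0 ↔ μ.toMeasure {S} ≠ 0 := by
    intro S
    rw [hn S, Ne, Ne, Nat.cast_eq_zero]
  have hninv : ∀ g S, n (BigClosed.translate g S) = n S := by
    intro g S
    have := hinv g S
    rw [hn, hn] at this
    exact_mod_cast this
  have hnfin : ∀ e : (Γ.cover p).E, {S | e ∈ hullE α S ∧ n S ≠ 0}.Finite := by
    intro e
    simp only [hn0]
    exact finite_atoms hnat (hfin μ) e
  have hsum := measure_eq_tsum_atoms hnat (hfin μ)
  have hweight : ∀ K : (Γ.cover p).Subgraph, K.IsFiniteSubtree →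
      weight α K μ = (Nat.card (SerreGraph.Occurrence K.label (hullGraphLabel α n)) : ℝ≥0∞) := by
    intro K hK
    rw [natCard_occurrence hconn hnfin hninv hK, weight, hsum]
    simp only [hn]
  refine ⟨hullGraph α n, hullGraphLabel α n,
    hullGraph_isFiniteCyclicallyReduced hconn hnfin hninv ?_, hweight, ?_⟩
  -- Without atoms the sum over singletons vanishes, contradicting `μ ≠ 0`.
  · by_contra! h
    refine hμ (Measure.measure_univ_eq_zero.1 ?_)
    rw [hsum]
    simp [hn, h]
  · intro ν hν
    have heq : ∀ K : (Γ.cover p).Subgraph, K.IsFiniteSubtree →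
        ν.toMeasure (subsetCyl α K) = μ.toMeasure (subsetCyl α K) := fun K hK =>
      (hν K hK).trans (hweight K hK).symm
    have hνnat : ∀ K : (Γ.cover p).Subgraph, K.IsFiniteSubtree →
        ∃ n : ℕ, ν.toMeasure (subsetCyl α K) = n := fun K hK => by
      rw [heq K hK]; exact hnat K hK
    -- `ν` has the same integral weights, so it is atomic as well, and its singleton masses are
    -- limits of those weights.
    have hm : ν.toMeasure = μ.toMeasure := by
      refine Measure.ext fun A _ => ?_
      rw [hsum, measure_eq_tsum_atoms hνnat (hfin ν)]
      simp only [measure_singleton_eq hnat heq]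
    obtain ⟨ν, _, _⟩ := ν
    obtain ⟨μ, _, _⟩ := μ
    change ν = μ at hm
    subst hm
    rfl
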